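/- A \emph{cake} is a (closed, solid) non-isosceles triangle in the Euclidean plane, with angles $\alpha,\beta,\gamma$; its \emph{box} is the mirror image of the cake in a line (any line). A \emph{polygon} is the closed region bounded by a simple closed polygonal line. The cake \emph{can be nicely cut into $n$ pieces} if it is a union of $n$ polygons with pairwise disjoint interiors which can be put into the box all together, i.e. moved by compositions of rotations and translations (a separate motion for each piece, no turning over) to positions inside the box with pairwise disjoint interiors. (1) If a cake can be nicely cut into $2$ pieces, then $k\alpha+l\beta+m\gamma=0$ for some integers $k,l,m$ that are not all zero. (2) Consequently almost all cakes need $3$ pieces: for almost every pair $(\alpha,\beta)\in\mathbb{R}^2$ with respect to Lebesgue measure, for every cake two of whose angles are $\alpha$ and $\beta$, the least $n$ such that the cake can be nicely cut into $n$ pieces is $3$. (3) In particular, the answer to Boltyansky's question is three: the least $n$ such that every cake can be nicely cut into $n$ pieces is $3$. -/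

import Mathlib

open MeasureTheory EuclideanGeometry

namespace CakeCutting

/-- A closed polygonal line in the plane is *simple* if it has at least three vertices and, running
once around it, no point is visited twice. Each edge is traversed without its final point, which is
the initial point of the next edge. -/
def IsSimplePolygon {n : ℕ} (v : Polygon ℂ n) : Prop :=
  3 ≤ n ∧
    ∀ i j : Fin n, ∀ s ∈ Set.Ico (0 : ℝ) 1, ∀ t ∈ Set.Ico (0 : ℝ) 1,
      v.edgePath ℝ i s = v.edgePath ℝ j t → i = j ∧ s = t

/-- A *polygon* as a subset of the Euclidean plane `ℂ`: the closed region enclosed by a simple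
closed polygonal line. The region enclosed by a Jordan curve is the only compact set that is
the closure of its interior and whose topological boundary is that curve. -/
def IsPolygon (P : Set ℂ) : Prop :=
  IsCompact P ∧ closure (interior P) = P ∧
    ∃ (n : ℕ) (v : Polygon ℂ n), IsSimplePolygon v ∧ frontier P = v.boundary ℝ

/-- Two plane sets do not overlap: they have no interior point in common. -/
def NonOverlapping (P Q : Set ℂ) : Prop :=
  Disjoint (interior P) (interior Q)

/-- A motion of the plane composed of rotations and translations (no turning over):
`z ↦ a * z + b` with `‖a‖ = 1`. -/
def IsProperMotion (g : ℂ → ℂ) : Prop :=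
  ∃ a b : ℂ, ‖a‖ = 1 ∧ ∀ z, g z = a * z + b

/-- The sets `P i` form a cutting of `S` into polygons. -/
def IsCutting {n : ℕ} (P : Fin n → Set ℂ) (S : Set ℂ) : Prop :=
  (∀ i, IsPolygon (P i)) ∧ Pairwise (fun i j => NonOverlapping (P i) (P j)) ∧ ⋃ i, P i = S

/-- The sets `P i` can all together be put into `S` by means of rotations and translations:
the moved copies lie in `S` and do not overlap. -/
def CanBePacked {n : ℕ} (P : Fin n → Set ℂ) (S : Set ℂ) : Prop :=
  ∃ g : Fin n → ℂ → ℂ, (∀ i, IsProperMotion (g i)) ∧ (∀ i, g i '' P i ⊆ S) ∧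
    Pairwise (fun i j => NonOverlapping (g i '' P i) (g j '' P j))

/-- `box` is the mirror image of the (solid) triangle `T` in some line of the plane. -/
def IsBox (T : Affine.Triangle ℝ ℂ) (box : Set ℂ) : Prop :=
  ∃ p q : ℂ, p ≠ q ∧ box = EuclideanGeometry.reflection line[ℝ, p, q] '' T.closedInterior

/-- The triangle `T` can be cut into `n` polygons that can be put into `box` all together by means
of rotations and translations. -/
def NicelyCuttable (T : Affine.Triangle ℝ ℂ) (box : Set ℂ) (n : ℕ) : Prop :=
  ∃ P : Fin n → Set ℂ, IsCutting P T.closedInterior ∧ CanBePacked P box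

/-- The angle of the triangle `T` at its first vertex. -/
noncomputable def angleA (T : Affine.Triangle ℝ ℂ) : ℝ :=
  ∠ (T.points 1) (T.points 0) (T.points 2)

/-- The angle of the triangle `T` at its second vertex. -/
noncomputable def angleB (T : Affine.Triangle ℝ ℂ) : ℝ :=
  ∠ (T.points 0) (T.points 1) (T.points 2)

/-- The angle of the triangle `T` at its third vertex. -/
noncomputable def angleC (T : Affine.Triangle ℝ ℂ) : ℝ :=
  ∠ (T.points 0) (T.points 2) (T.points 1)

end CakeCutting

/-! Suppose two pieces suffice. Undoing the motion of the first piece leaves it at rest, so the cake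
is `T = P ∪ Q` and the box contains `P ∪ g Q` with `g z = r * z + b`. Equal areas turn this
containment into an equality. Boundaries are compared through jumps: at a point `x` and a unit
vector `u`, the indicator of a set is read off on the two sides of the line through `x` orthogonal
to `u`. Jumps add up over non-overlapping pieces, so `P` cancels. The jump of the cake minus that of
the box, at a moved flag, is then the jump of `Q` there minus its jump at the original flag
(`exchange_of_cutting`). This difference telescopes along orbits of `g` (`Exchange.jump_sub_orbit`).

If `r` has finite order, or `g` is a translation, the jump of `Q` cannot decrease forever along an
orbit. Hence the orbit of each flag on a side of the cake meets a side of the box, or meets a side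
of the cake with the opposite normal. Independence of the angles makes the second event a half turn
of a side onto itself, and leaves too few ways to match sides of the cake with sides of the box.
Midpoints and the distinct side lengths give the contradiction (`Exchange.false_of_isOfFinOrder`).

If `r` has infinite order, `Q` has edges in only finitely many directions of the orbit. The
telescoping sum therefore vanishes, and integrating it over the plane with respect to length gives a
relation with coefficients `0` and `±1` between side lengths of cake and box. The strict triangle
inequality and scalenity refute it (`Exchange.false_of_not_isOfFinOrder`).

In both cases directions are measured in a quotient of `ℝ` over `ℚ` by `π`, and by `arg r` when
needed (`Exchange.false_of_independent`).

Conversely, the perpendiculars from the incenter cut every triangle into three mirror symmetric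
kites. A symmetric piece reaches its mirror image by a proper motion (`nicelyCuttable_three`).
Integral relations between the angles form a countable union of null lines (`ae_int_independent`).
-/

namespace CakeCutting

open Filter Topology

/-! ### Flags of the plane and the lines they decide -/

/-- The real inner product of the plane. -/
def dot (u v : ℂ) : ℝ := u.re * v.re + u.im * v.im

lemma dot_add_right (u v w : ℂ) : dot u (v + w) = dot u v + dot u w := by
  simp [dot]; ring

lemma dot_sub_right (u v w : ℂ) : dot u (v - w) = dot u v - dot u w := by
  simp [dot]; ring

lemma dot_neg_right (u v : ℂ) : dot u (-v) = -dot u v := by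
  simp [dot]; ring

lemma dot_neg_left (u v : ℂ) : dot (-u) v = -dot u v := by
  simp [dot]; ring

lemma dot_ofReal_mul_right (u v : ℂ) (t : ℝ) : dot u (t * v) = t * dot u v := by
  simp [dot]; ring

lemma dot_ofReal_mul_left (u v : ℂ) (t : ℝ) : dot (t * u) v = t * dot u v := by
  simp [dot]; ring

lemma dot_comm (u v : ℂ) : dot u v = dot v u := by
  simp [dot]; ring

lemma continuous_dot (w : ℂ) : Continuous (dot w) := by
  unfold dot; fun_prop

lemma dot_self (u : ℂ) : dot u u = ‖u‖ ^ 2 := by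
  rw [Complex.sq_norm, Complex.normSq_apply, dot]

/-- A nonzero vector is not orthogonal to both a nonzero vector and its quarter turn. -/
lemma dot_ne_zero_of_dot_I_mul_eq_zero {w u : ℂ} (hw : w ≠ 0) (hu : u ≠ 0)
    (h : dot w (Complex.I * u) = 0) : dot w u ≠ 0 := by
  intro h2
  simp only [dot, Complex.mul_re, Complex.mul_im, Complex.I_re, Complex.I_im] at h h2
  have hu' : 0 < u.re ^ 2 + u.im ^ 2 := by
    have := Complex.normSq_pos.2 hu
    rw [Complex.normSq_apply] at this
    nlinarith
  apply hw
  apply Complex.ext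
  · have : w.re * (u.re ^ 2 + u.im ^ 2) = 0 := by linear_combination u.re * h2 - u.im * h
    simpa [hu'.ne'] using this
  · have : w.im * (u.re ^ 2 + u.im ^ 2) = 0 := by linear_combination u.im * h2 + u.re * h
    simpa [hu'.ne'] using this

/-- The germ of a flag: the points `x + s * d + t * e` with `0 < t ≪ s ≪ 1`. -/
def flag (x d e : ℂ) : Filter ℂ :=
  (𝓝[>] (0 : ℝ)).bind fun s => (𝓝[>] (0 : ℝ)).map fun t : ℝ => x + s * d + t * e

lemma mem_flag {x d e : ℂ} {S : Set ℂ} :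
    S ∈ flag x d e ↔ ∀ᶠ s : ℝ in 𝓝[>] 0, ∀ᶠ t : ℝ in 𝓝[>] 0, x + s * d + t * e ∈ S := by
  rw [flag, mem_bind']; rfl

instance flag_neBot (x d e : ℂ) : (flag x d e).NeBot := by
  refine ⟨fun h => ?_⟩
  have : (∅ : Set ℂ) ∈ flag x d e := by rw [h]; exact mem_bot
  rw [mem_flag] at this
  obtain ⟨s, hs⟩ := this.exists
  obtain ⟨t, ht⟩ := hs.exists
  exact ht

lemma eventually_lt_add_mul {a c : ℝ} (b : ℝ) (h : c < a) :
    ∀ᶠ t : ℝ in 𝓝[>] 0, c < a + t * b := by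
  have : Tendsto (fun t : ℝ => a + t * b) (𝓝[>] 0) (𝓝 (a + 0 * b)) :=
    (Continuous.tendsto (by fun_prop) 0).mono_left nhdsWithin_le_nhds
  exact this.eventually_const_lt (by simpa using h)

lemma flag_le_nhds (x d e : ℂ) : flag x d e ≤ 𝓝 x := by
  intro U hU
  rw [mem_flag]
  have h1 : Tendsto (fun s : ℝ => x + s * d) (𝓝[>] 0) (𝓝 x) := by
    have : Tendsto (fun s : ℝ => x + s * d) (𝓝[>] 0) (𝓝 (x + (0 : ℝ) * d)) :=
      (Continuous.tendsto (by fun_prop) 0).mono_left nhdsWithin_le_nhds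
    simpa using this
  filter_upwards [h1.eventually (eventually_mem_nhds_iff.2 hU)] with s hs
  have h2 : Tendsto (fun t : ℝ => x + s * d + t * e) (𝓝[>] 0) (𝓝 (x + s * d)) := by
    have : Tendsto (fun t : ℝ => x + s * d + t * e) (𝓝[>] 0) (𝓝 (x + s * d + (0 : ℝ) * e)) :=
      (Continuous.tendsto (by fun_prop) 0).mono_left nhdsWithin_le_nhds
    simpa using this
  exact h2.eventually hs

lemma mem_closure_of_mem_flag {x d e : ℂ} {S : Set ℂ} (h : S ∈ flag x d e) : x ∈ closure S := by
  rw [mem_closure_iff_nhds]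
  intro U hU
  exact (flag_neBot x d e).nonempty_of_mem (inter_mem (flag_le_nhds x d e hU) h)

lemma dot_flag_point (w x d e : ℂ) (s t : ℝ) :
    dot w (x + s * d + t * e) = dot w x + s * dot w d + t * dot w e := by
  rw [dot_add_right, dot_add_right, dot_ofReal_mul_right, dot_ofReal_mul_right]

lemma lt_dot_mem_flag_of_lt {w x : ℂ} {c : ℝ} (d e : ℂ) (h : c < dot w x) :
    {z | c < dot w z} ∈ flag x d e :=
  flag_le_nhds x d e ((isOpen_lt continuous_const (continuous_dot w)).mem_nhds h)

lemma lt_dot_mem_flag_of_pos {w x d : ℂ} {c : ℝ} (e : ℂ) (h : dot w x = c) (hd : 0 < dot w d) :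
    {z | c < dot w z} ∈ flag x d e := by
  rw [mem_flag]
  filter_upwards [self_mem_nhdsWithin] with s hs
  simp only [dot_flag_point]
  exact eventually_lt_add_mul _ (by have := mul_pos (Set.mem_Ioi.1 hs) hd; linarith)

lemma lt_dot_mem_flag_of_pos_right {w x d e : ℂ} {c : ℝ} (h : dot w x = c) (hd : dot w d = 0)
    (he : 0 < dot w e) : {z | c < dot w z} ∈ flag x d e := by
  rw [mem_flag]
  filter_upwards with s
  filter_upwards [self_mem_nhdsWithin] with t ht
  simp only [dot_flag_point, h, hd]
  have := mul_pos (Set.mem_Ioi.1 ht) he; linarith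

lemma setOf_lt_dot_neg (w : ℂ) (c : ℝ) : {z | -c < dot (-w) z} = {z | dot w z < c} := by
  ext z; simp [dot_neg_left]

lemma dot_lt_mem_flag_of_lt {w x : ℂ} {c : ℝ} (d e : ℂ) (h : dot w x < c) :
    {z | dot w z < c} ∈ flag x d e := by
  rw [← setOf_lt_dot_neg]
  exact lt_dot_mem_flag_of_lt d e (by rw [dot_neg_left]; linarith)

lemma dot_lt_mem_flag_of_neg {w x d : ℂ} {c : ℝ} (e : ℂ) (h : dot w x = c) (hd : dot w d < 0) :
    {z | dot w z < c} ∈ flag x d e := by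
  rw [← setOf_lt_dot_neg]
  exact lt_dot_mem_flag_of_pos e (by rw [dot_neg_left, h]) (by rw [dot_neg_left]; linarith)

lemma dot_lt_mem_flag_of_neg_right {w x d e : ℂ} {c : ℝ} (h : dot w x = c) (hd : dot w d = 0)
    (he : dot w e < 0) : {z | dot w z < c} ∈ flag x d e := by
  rw [← setOf_lt_dot_neg]
  exact lt_dot_mem_flag_of_pos_right (by rw [dot_neg_left, h]) (by rw [dot_neg_left]; linarith)
    (by rw [dot_neg_left]; linarith)

/-- The filter `F` lies on one side of the line `dot w z = c`. -/
def Decides (F : Filter ℂ) (w : ℂ) (c : ℝ) : Prop :=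
  {z | c < dot w z} ∈ F ∨ {z | dot w z < c} ∈ F

/-- Since `t` is infinitesimal against `s`, a line transverse to `d` is decided before `e` matters.
Flags with the same `x` and `d` therefore lie on the same side of it. -/
lemma decides_flag_sup {w d : ℂ} (hd : dot w d ≠ 0) (x e e' : ℂ) (c : ℝ) :
    Decides (flag x d e ⊔ flag x d e') w c := by
  simp only [Decides, mem_sup]
  rcases lt_trichotomy c (dot w x) with h | h | h
  · exact .inl ⟨lt_dot_mem_flag_of_lt _ _ h, lt_dot_mem_flag_of_lt _ _ h⟩
  · rcases lt_or_gt_of_ne hd with h1 | h1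
    · exact .inr ⟨dot_lt_mem_flag_of_neg _ h.symm h1, dot_lt_mem_flag_of_neg _ h.symm h1⟩
    · exact .inl ⟨lt_dot_mem_flag_of_pos _ h.symm h1, lt_dot_mem_flag_of_pos _ h.symm h1⟩
  · exact .inr ⟨dot_lt_mem_flag_of_lt _ _ h, dot_lt_mem_flag_of_lt _ _ h⟩

lemma Decides.mono {F G : Filter ℂ} {w : ℂ} {c : ℝ} (h : Decides F w c) (hGF : G ≤ F) :
    Decides G w c :=
  h.imp (fun h => hGF h) (fun h => hGF h)

lemma decides_flag {w d e : ℂ} (hde : dot w d = 0 → dot w e ≠ 0) (x : ℂ) (c : ℝ) :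
    Decides (flag x d e) w c := by
  by_cases hd : dot w d = 0
  · rcases lt_trichotomy c (dot w x) with h | h | h
    · exact .inl (lt_dot_mem_flag_of_lt _ _ h)
    · rcases lt_or_gt_of_ne (hde hd) with h1 | h1
      · exact .inr (dot_lt_mem_flag_of_neg_right h.symm hd h1)
      · exact .inl (lt_dot_mem_flag_of_pos_right h.symm hd h1)
    · exact .inr (dot_lt_mem_flag_of_lt _ _ h)
  · exact (decides_flag_sup hd x e e c).mono le_sup_left

lemma convex_lt_dot (w : ℂ) (c : ℝ) : Convex ℝ {z | c < dot w z} :=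
  convex_halfSpace_gt ⟨dot_add_right w, fun t z => by
    rw [Complex.real_smul, dot_ofReal_mul_right, smul_eq_mul]⟩ c

lemma convex_dot_lt (w : ℂ) (c : ℝ) : Convex ℝ {z | dot w z < c} :=
  convex_halfSpace_lt ⟨dot_add_right w, fun t z => by
    rw [Complex.real_smul, dot_ofReal_mul_right, smul_eq_mul]⟩ c

/-- A filter deciding finitely many lines contains a convex set missing all of them. -/
lemma exists_convex_mem_of_decides {F : Filter ℂ} (L : Finset (ℂ × ℝ))
    (hF : ∀ l ∈ L, Decides F l.1 l.2) :
    ∃ C ∈ F, Convex ℝ C ∧ ∀ l ∈ L, ∀ z ∈ C, dot l.1 z ≠ l.2 := by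
  classical
  let H : ℂ × ℝ → Set ℂ := fun l =>
    if {z | l.2 < dot l.1 z} ∈ F then {z | l.2 < dot l.1 z} else {z | dot l.1 z < l.2}
  refine ⟨⋂ l ∈ L, H l, ?_, ?_, ?_⟩
  · rw [Filter.biInter_finset_mem]
    intro l hl
    by_cases h : {z | l.2 < dot l.1 z} ∈ F
    · simp only [H, if_pos h]; exact h
    · simp only [H, if_neg h]; exact (hF l hl).resolve_left h
  · refine convex_iInter₂ fun l _ => ?_
    by_cases h : {z | l.2 < dot l.1 z} ∈ F
    · simp only [H, if_pos h]; exact convex_lt_dot _ _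
    · simp only [H, if_neg h]; exact convex_dot_lt _ _
  · intro l hl z hz
    have hz' := Set.mem_iInter₂.1 hz l hl
    by_cases h : {z | l.2 < dot l.1 z} ∈ F
    · simp only [H, if_pos h] at hz'; exact ne_of_gt hz'
    · simp only [H, if_neg h] at hz'; exact ne_of_lt hz'

/-- The frontier of `S` is covered by the finitely many lines in `L`. -/
def FrontierIn (S : Set ℂ) (L : Finset (ℂ × ℝ)) : Prop :=
  (∀ l ∈ L, l.1 ≠ 0) ∧ ∀ z ∈ frontier S, ∃ l ∈ L, dot l.1 z = l.2

/-- A convex set missing all the lines misses the frontier; being connected, it lies wholly inside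
or wholly outside. -/
lemma FrontierIn.interior_or {S : Set ℂ} {L : Finset (ℂ × ℝ)} (hS : FrontierIn S L)
    {F : Filter ℂ} (hF : ∀ l ∈ L, Decides F l.1 l.2) :
    interior S ∈ F ∨ (closure S)ᶜ ∈ F := by
  obtain ⟨C, hCF, hC, hCL⟩ := exists_convex_mem_of_decides L hF
  have hsub : C ⊆ interior S ∪ (closure S)ᶜ := by
    intro z hz
    by_contra h
    simp only [Set.mem_union, Set.mem_compl_iff, not_or, not_not] at h
    obtain ⟨l, hl, hzl⟩ := hS.2 z ⟨h.2, h.1⟩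
    exact hCL l hl z hz hzl
  have hdisj : Disjoint (interior S) (closure S)ᶜ :=
    Set.disjoint_left.2 fun z hz hz' => hz' (subset_closure (interior_subset hz))
  rcases IsPreconnected.subset_or_subset isOpen_interior isClosed_closure.isOpen_compl hdisj hsub
    hC.isPreconnected with h | h
  · exact .inl (mem_of_superset hCF h)
  · exact .inr (mem_of_superset hCF h)

lemma FrontierIn.interior_or_flag {S : Set ℂ} {L : Finset (ℂ × ℝ)} (hS : FrontierIn S L)
    (x : ℂ) {u e : ℂ} (hu : u ≠ 0) (he : e = u ∨ e = -u) :
    interior S ∈ flag x (Complex.I * u) e ∨ (closure S)ᶜ ∈ flag x (Complex.I * u) e := by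
  refine hS.interior_or fun l hl => decides_flag (fun h => ?_) x l.2
  have := dot_ne_zero_of_dot_I_mul_eq_zero (hS.1 l hl) hu h
  rcases he with rfl | rfl
  · exact this
  · rwa [dot_neg_right, neg_ne_zero]

/-! ### Jumps of indicator functions -/

open Classical in
/-- The value at `F` of the indicator function of `S`. -/
noncomputable def val (F : Filter ℂ) (S : Set ℂ) : ℤ := if S ∈ F then 1 else 0

lemma val_of_mem {F : Filter ℂ} {S : Set ℂ} (h : S ∈ F) : val F S = 1 := if_pos h

lemma val_of_notMem {F : Filter ℂ} {S : Set ℂ} (h : S ∉ F) : val F S = 0 := if_neg h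

lemma notMem_of_compl_mem {F : Filter ℂ} [F.NeBot] {S A : Set ℂ} (hA : Aᶜ ∈ F) (h : S ⊆ A) :
    S ∉ F := fun hS => by
  obtain ⟨z, hz⟩ := (‹F.NeBot›).nonempty_of_mem (inter_mem hS hA)
  exact hz.2 (h hz.1)

/-- The jump of the indicator function of `S` across the line through `x` orthogonal to `u`. -/
noncomputable def jump (S : Set ℂ) (x u : ℂ) : ℤ :=
  val (flag x (Complex.I * u) u) S - val (flag x (Complex.I * u) (-u)) S

lemma jump_neg_iff {S : Set ℂ} {x u : ℂ} : jump S x u < 0 ↔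
    S ∉ flag x (Complex.I * u) u ∧ S ∈ flag x (Complex.I * u) (-u) := by
  unfold jump val; split_ifs <;> simp_all

lemma jump_pos_iff {S : Set ℂ} {x u : ℂ} : 0 < jump S x u ↔
    S ∈ flag x (Complex.I * u) u ∧ S ∉ flag x (Complex.I * u) (-u) := by
  unfold jump val; split_ifs <;> simp_all

lemma jump_eq_zero_of_notMem_closure {S : Set ℂ} {x : ℂ} (u : ℂ) (h : x ∉ closure S) :
    jump S x u = 0 := by
  rw [jump, val_of_notMem (fun h' => h (mem_closure_of_mem_flag h')),
    val_of_notMem (fun h' => h (mem_closure_of_mem_flag h')), sub_zero]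

/-- If every line of `L` is transverse to `I * u`, the two flags compared by the jump are decided
together, and the indicator agrees on them. So a set bounded by finitely many lines jumps in
finitely many directions only. -/
lemma FrontierIn.exists_of_jump_ne_zero {S : Set ℂ} {L : Finset (ℂ × ℝ)} (hS : FrontierIn S L)
    {x u : ℂ} (h : jump S x u ≠ 0) : ∃ l ∈ L, dot l.1 (Complex.I * u) = 0 := by
  by_contra! hL
  have := hS.interior_or
    (F := flag x (Complex.I * u) u ⊔ flag x (Complex.I * u) (-u))
    (fun l hl => decides_flag_sup (hL l hl) x _ _ l.2)
  simp only [mem_sup] at this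
  apply h
  rcases this with ⟨h1, h2⟩ | ⟨h1, h2⟩
  · rw [jump, val_of_mem (mem_of_superset h1 interior_subset),
      val_of_mem (mem_of_superset h2 interior_subset), sub_self]
  · rw [jump, val_of_notMem (notMem_of_compl_mem h1 subset_closure),
      val_of_notMem (notMem_of_compl_mem h2 subset_closure), sub_self]

lemma image_mem_flag_iff {r b : ℂ} (hr : r ≠ 0) {S : Set ℂ} {x d e : ℂ} :
    (fun z => r * z + b) '' S ∈ flag (r * x + b) (r * d) (r * e) ↔ S ∈ flag x d e := by
  have hinj : Function.Injective (fun z => r * z + b) := fun y z h => by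
    simpa [hr] using h
  rw [mem_flag, mem_flag]
  have : ∀ s t : ℝ, r * x + b + s * (r * d) + t * (r * e) = r * (x + s * d + t * e) + b := by
    intro s t; ring
  simp_rw [this, hinj.mem_set_image]

lemma jump_image {r b : ℂ} (hr : r ≠ 0) (S : Set ℂ) (x u : ℂ) :
    jump ((fun z => r * z + b) '' S) (r * x + b) (r * u) = jump S x u := by
  have h1 : Complex.I * (r * u) = r * (Complex.I * u) := by ring
  have h2 : -(r * u) = r * -u := by ring
  have h3 : ∀ d e, val (flag (r * x + b) (r * d) (r * e)) ((fun z => r * z + b) '' S) =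
      val (flag x d e) S := fun d e => by
    by_cases h : S ∈ flag x d e
    · rw [val_of_mem h, val_of_mem ((image_mem_flag_iff hr).2 h)]
    · rw [val_of_notMem h, val_of_notMem (mt (image_mem_flag_iff hr).1 h)]
  rw [jump, h1, h2, h3, h3, jump]

/-! ### Triangles described by their outward normals -/

lemma sum_fin_three_cyclic {M : Type*} [AddCommMonoid M] (f : Fin 3 → M) (i : Fin 3) :
    ∑ j, f j = f i + f (i + 1) + f (i + 2) := by
  rw [Fin.sum_univ_three]
  fin_cases i
  · rfl
  · change _ = f 1 + f 2 + f 0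
    rw [add_assoc, add_comm]
  · change _ = f 2 + f 0 + f 1
    rw [add_comm, add_assoc]

lemma Fin.eq_add_of_ne {i j : Fin 3} (h : j ≠ i) : j = i + 1 ∨ j = i + 2 := by
  decide +revert

/-- The unit vectors `n i` are the outward normals of the sides of the triangle `p`, the side `i`
being opposite to the vertex `p i`. -/
structure IsNormals (p n : Fin 3 → ℂ) : Prop where
  norm : ∀ i, ‖n i‖ = 1
  ortho : ∀ i, dot (n i) (p (i + 2)) = dot (n i) (p (i + 1))
  neg : ∀ i, dot (n i) (p i) < dot (n i) (p (i + 1))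

lemma eq_ofReal_mul_I_mul {n z : ℂ} (hn : ‖n‖ = 1) (h : dot n z = 0) :
    ∃ t : ℝ, z = t * (Complex.I * n) := by
  have hn' : n.re * n.re + n.im * n.im = 1 := by
    rw [← Complex.normSq_apply, ← Complex.sq_norm, hn, one_pow]
  refine ⟨dot (Complex.I * n) z, ?_⟩
  unfold dot at h ⊢
  apply Complex.ext
  · simp
    linear_combination n.re * h - z.re * hn'
  · simp
    linear_combination n.im * h - z.im * hn'

lemma dot_lt_notMem_of_lt_dot_mem {F : Filter ℂ} [F.NeBot] {w : ℂ} {c : ℝ}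
    (h : {z | c < dot w z} ∈ F) : {z | dot w z < c} ∉ F := fun h' => by
  obtain ⟨z, hz, hz'⟩ := (‹F.NeBot›).nonempty_of_mem (inter_mem h h')
  exact lt_asymm (show c < dot w z from hz) hz'

namespace IsNormals

variable {p n : Fin 3 → ℂ}

lemma ne_zero (h : IsNormals p n) (i : Fin 3) : n i ≠ 0 := by
  rw [← norm_ne_zero_iff, h.norm]; exact one_ne_zero

lemma injective (h : IsNormals p n) : Function.Injective p := by
  intro i j hij
  by_contra hne
  rcases Fin.eq_add_of_ne (Ne.symm hne) with rfl | rfl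
  · exact (h.neg i).ne (by rw [hij])
  · exact (h.neg i).ne (by rw [hij, h.ortho])

lemma cross_ne_zero (h : IsNormals p n) :
    (p 1 - p 0).re * (p 2 - p 0).im - (p 1 - p 0).im * (p 2 - p 0).re ≠ 0 := by
  intro h0
  have ho : dot (n 0) (p 2 - p 1) = 0 := by rw [dot_sub_right, sub_eq_zero]; exact h.ortho 0
  have hn := h.neg 0
  obtain ⟨t, ht⟩ := eq_ofReal_mul_I_mul (h.norm 0) ho
  have ht0 : t ≠ 0 := by
    rintro rfl
    have : p 2 = p 1 := by simpa [sub_eq_zero] using ht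
    exact absurd (h.injective this) (by decide)
  have e1 := congrArg Complex.re ht
  have e2 := congrArg Complex.im ht
  simp only [Complex.sub_re, Complex.sub_im, Complex.mul_re, Complex.mul_im, Complex.ofReal_re,
    Complex.ofReal_im, Complex.I_re, Complex.I_im] at e1 e2 h0
  simp only [dot, zero_add] at hn
  have : t * (((n 0).re * (p 0).re + (n 0).im * (p 0).im) -
      ((n 0).re * (p 1).re + (n 0).im * (p 1).im)) = 0 := by
    linear_combination -h0 - ((p 0).re - (p 1).re) * e2 + ((p 0).im - (p 1).im) * e1
  rcases mul_eq_zero.1 this with h1 | h1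
  · exact ht0 h1
  · linarith

lemma exists_barycentric (h : IsNormals p n) (z : ℂ) :
    ∃ c : Fin 3 → ℝ, ∑ i, c i = 1 ∧ ∑ i, (c i : ℂ) * p i = z := by
  set D := (p 1 - p 0).re * (p 2 - p 0).im - (p 1 - p 0).im * (p 2 - p 0).re with hD
  have hD0 : D ≠ 0 := h.cross_ne_zero
  let a := ((z - p 0).re * (p 2 - p 0).im - (z - p 0).im * (p 2 - p 0).re) / D
  let b := ((p 1 - p 0).re * (z - p 0).im - (p 1 - p 0).im * (z - p 0).re) / D
  refine ⟨![1 - a - b, a, b], ?_, ?_⟩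
  · simp only [Fin.sum_univ_three, Matrix.cons_val]
    ring
  · have ha : a * D = (z - p 0).re * (p 2 - p 0).im - (z - p 0).im * (p 2 - p 0).re :=
      div_mul_cancel₀ _ hD0
    have hb : b * D = (p 1 - p 0).re * (z - p 0).im - (p 1 - p 0).im * (z - p 0).re :=
      div_mul_cancel₀ _ hD0
    simp only [Complex.sub_re, Complex.sub_im] at hD ha hb
    simp only [Fin.sum_univ_three, Matrix.cons_val]
    apply Complex.ext
    · apply mul_right_cancel₀ hD0
      simp only [Complex.add_re, Complex.re_ofReal_mul]
      linear_combination ((p 1).re - (p 0).re) * ha + ((p 2).re - (p 0).re) * hb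
        - (z.re - (p 0).re) * hD
    · apply mul_right_cancel₀ hD0
      simp only [Complex.add_im, Complex.im_ofReal_mul]
      linear_combination ((p 1).im - (p 0).im) * ha + ((p 2).im - (p 0).im) * hb
        - (z.im - (p 0).im) * hD

/-- The functional `dot (n i)` is constant on side `i`, so its value only sees the weight of the
opposite vertex. This translates half-plane conditions into signs of barycentric coordinates. -/
lemma dot_barycentric (h : IsNormals p n) {c : Fin 3 → ℝ} (hc : ∑ i, c i = 1) (i : Fin 3) :
    dot (n i) (∑ j, (c j : ℂ) * p j) =
      dot (n i) (p (i + 1)) + c i * (dot (n i) (p i) - dot (n i) (p (i + 1))) := by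
  rw [sum_fin_three_cyclic _ i] at hc ⊢
  simp only [dot_add_right, dot_ofReal_mul_right, h.ortho i]
  linear_combination dot (n i) (p (i + 1)) * hc

lemma dot_vertex_le (h : IsNormals p n) (i j : Fin 3) :
    dot (n i) (p j) ≤ dot (n i) (p (i + 1)) := by
  rcases eq_or_ne j i with rfl | hne
  · exact (h.neg j).le
  · rcases Fin.eq_add_of_ne hne with rfl | rfl
    · exact le_rfl
    · exact (h.ortho i).le

lemma mem_convexHull_iff (h : IsNormals p n) {z : ℂ} :
    z ∈ convexHull ℝ (Set.range p) ↔ ∀ i, dot (n i) z ≤ dot (n i) (p (i + 1)) := by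
  constructor
  · intro hz i
    have : convexHull ℝ (Set.range p) ⊆ {z | dot (n i) z ≤ dot (n i) (p (i + 1))} := by
      refine convexHull_min ?_ (convex_halfSpace_le ⟨dot_add_right _, fun t z => ?_⟩ _)
      · rintro _ ⟨j, rfl⟩
        exact h.dot_vertex_le i j
      · rw [Complex.real_smul, dot_ofReal_mul_right, smul_eq_mul]
    exact this hz
  · intro hz
    obtain ⟨c, hc, rfl⟩ := h.exists_barycentric z
    have : ∀ i, 0 ≤ c i := fun i => by
      have h1 := hz i
      rw [h.dot_barycentric hc i] at h1
      have h2 := h.neg i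
      by_contra! h3
      nlinarith
    simp_rw [← Complex.real_smul]
    exact (convex_convexHull ℝ _).sum_mem (fun i _ => this i) hc
      (fun i _ => subset_convexHull ℝ _ ⟨i, rfl⟩)

lemma mem_segment (h : IsNormals p n) {z : ℂ} (hz : z ∈ convexHull ℝ (Set.range p)) {i : Fin 3}
    (hi : dot (n i) z = dot (n i) (p (i + 1))) : z ∈ segment ℝ (p (i + 1)) (p (i + 2)) := by
  rw [h.mem_convexHull_iff] at hz
  obtain ⟨c, hc, rfl⟩ := h.exists_barycentric z
  have hpos : ∀ i, 0 ≤ c i := fun i => by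
    have h1 := hz i
    rw [h.dot_barycentric hc i] at h1
    have h2 := h.neg i
    by_contra! h3
    nlinarith
  have hi0 : c i = 0 := by
    rw [h.dot_barycentric hc i] at hi
    have h2 := h.neg i
    have : c i * (dot (n i) (p i) - dot (n i) (p (i + 1))) = 0 := by linarith
    exact (mul_eq_zero.1 this).resolve_right (by linarith)
  rw [sum_fin_three_cyclic _ i, hi0] at hc ⊢
  exact ⟨c (i + 1), c (i + 2), hpos _, hpos _, by linarith, by simp [Complex.real_smul]⟩

lemma dot_eq_of_mem_segment (h : IsNormals p n) {z : ℂ} {i : Fin 3}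
    (hz : z ∈ segment ℝ (p (i + 1)) (p (i + 2))) : dot (n i) z = dot (n i) (p (i + 1)) := by
  obtain ⟨a, b, -, -, hab, rfl⟩ := hz
  simp only [Complex.real_smul, dot_add_right, dot_ofReal_mul_right, h.ortho i]
  rw [← add_mul, hab, one_mul]

/-- As `j ≠ i`, the vertex `p j` is an end of side `i`, has positive weight in `z`, and lies
strictly inside side `j`. -/
lemma dot_lt_of_mem_openSegment (h : IsNormals p n) {z : ℂ} {i j : Fin 3} (hij : j ≠ i)
    (hz : z ∈ openSegment ℝ (p (i + 1)) (p (i + 2))) : dot (n j) z < dot (n j) (p (j + 1)) := by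
  obtain ⟨a, b, ha, hb, hab, rfl⟩ := hz
  simp only [Complex.real_smul, dot_add_right, dot_ofReal_mul_right]
  have h1 := h.neg j
  have h3 : (a + b) * dot (n j) (p (j + 1)) = dot (n j) (p (j + 1)) := by rw [hab, one_mul]
  rcases Fin.eq_add_of_ne hij with rfl | rfl
  · have h2 := mul_le_mul_of_nonneg_left (h.dot_vertex_le (i + 1) (i + 2)) hb.le
    have h4 := mul_lt_mul_of_pos_left h1 ha
    linarith
  · have h2 := mul_le_mul_of_nonneg_left (h.dot_vertex_le (i + 2) (i + 1)) ha.le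
    have h4 := mul_lt_mul_of_pos_left h1 hb
    linarith

lemma isClosed_convexHull (p : Fin 3 → ℂ) : IsClosed (convexHull ℝ (Set.range p)) :=
  ((Set.finite_range p).isCompact_convexHull ℝ).isClosed

lemma norm_eq_or_eq_neg {u v : ℂ} (hu : ‖u‖ = 1) (hv : ‖v‖ = 1)
    (h : dot u (Complex.I * v) = 0) : v = u ∨ v = -u := by
  obtain ⟨t, ht⟩ := eq_ofReal_mul_I_mul hu h
  have ht' : v = t * u := by
    apply mul_left_cancel₀ Complex.I_ne_zero
    rw [ht]; ring
  have : |t| = 1 := by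
    have := congrArg (fun z : ℂ => ‖z‖) ht'
    rw [norm_mul, hu, hv, mul_one, Complex.norm_real, Real.norm_eq_abs] at this
    exact this.symm
  rcases abs_eq (zero_le_one) |>.1 this with rfl | rfl
  · left; simpa using ht'
  · right; simpa using ht'

/-- Whether a flag belongs to a triangle is decided differently on the two sides of `u` only
across a side of the triangle. -/
lemma exists_of_mem_flag_of_notMem_flag (h : IsNormals p n) {x u e : ℂ} (hu : ‖u‖ = 1)
    (he : e = u ∨ e = -u)
    (hin : convexHull ℝ (Set.range p) ∈ flag x (Complex.I * u) (-e))
    (hout : convexHull ℝ (Set.range p) ∉ flag x (Complex.I * u) e) :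
    ∃ i, e = n i ∧ x ∈ segment ℝ (p (i + 1)) (p (i + 2)) := by
  have hu0 : u ≠ 0 := by rw [← norm_ne_zero_iff, hu]; exact one_ne_zero
  have hx : x ∈ convexHull ℝ (Set.range p) := by
    have := mem_closure_of_mem_flag hin
    rwa [(isClosed_convexHull p).closure_eq] at this
  -- Every side line decides the flag; if all decided inward, the flag would belong to the triangle.
  have hout' : ∃ i, {z | dot (n i) (p (i + 1)) < dot (n i) z} ∈ flag x (Complex.I * u) e := by
    by_contra! hne
    apply hout
    have : ∀ i, {z | dot (n i) z < dot (n i) (p (i + 1))} ∈ flag x (Complex.I * u) e := fun i =>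
      (decides_flag (fun h0 => by
        have := dot_ne_zero_of_dot_I_mul_eq_zero (h.ne_zero i) hu0 h0
        rcases he with rfl | rfl
        · exact this
        · rwa [dot_neg_right, neg_ne_zero]) x _).resolve_left (hne i)
    refine mem_of_superset (Filter.iInter_mem.2 this) fun z hz => ?_
    rw [h.mem_convexHull_iff]
    exact fun i => (Set.mem_iInter.1 hz i).le
  obtain ⟨i, hi⟩ := hout'
  have hdown : {z | dot (n i) (p (i + 1)) < dot (n i) z} ∉ flag x (Complex.I * u) (-e) := by
    intro h'
    obtain ⟨z, hz, hz'⟩ := (flag_neBot _ _ _).nonempty_of_mem (inter_mem h' hin)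
    exact absurd ((h.mem_convexHull_iff.1 hz') i) (not_le.2 hz)
  have hle := h.mem_convexHull_iff.1 hx i
  have heq : dot (n i) x = dot (n i) (p (i + 1)) := by
    by_contra hne
    have hlt := lt_of_le_of_ne hle hne
    exact dot_lt_notMem_of_lt_dot_mem hi (dot_lt_mem_flag_of_lt (Complex.I * u) e hlt)
  -- Otherwise the direction `I * u` alone would put both flags on the same side of the line of side
  -- `i`.
  have hI : dot (n i) (Complex.I * u) = 0 := by
    by_contra hne
    rcases lt_or_gt_of_ne hne with h1 | h1
    · exact dot_lt_notMem_of_lt_dot_mem hi (dot_lt_mem_flag_of_neg e heq h1)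
    · exact hdown (lt_dot_mem_flag_of_pos _ heq h1)
  have hpos : 0 < dot (n i) e := by
    by_contra hne
    rcases lt_or_eq_of_le (not_lt.1 hne) with h1 | h1
    · exact dot_lt_notMem_of_lt_dot_mem hi (dot_lt_mem_flag_of_neg_right heq hI h1)
    · have := dot_ne_zero_of_dot_I_mul_eq_zero (h.ne_zero i) hu0 hI
      rcases he with rfl | rfl
      · exact this h1
      · rw [dot_neg_right] at h1; exact this (by linarith)
  refine ⟨i, ?_, h.mem_segment hx heq⟩
  have hor : e = n i ∨ e = -n i := by
    rcases norm_eq_or_eq_neg (h.norm i) hu hI with h1 | h1 <;> rcases he with h2 | h2 <;>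
      simp [h1, h2]
  rcases hor with h1 | h1
  · exact h1
  · rw [h1, dot_neg_right, dot_self, h.norm] at hpos
    norm_num at hpos

lemma exists_of_jump_neg (h : IsNormals p n) {x u : ℂ} (hu : ‖u‖ = 1)
    (hj : jump (convexHull ℝ (Set.range p)) x u < 0) :
    ∃ i, u = n i ∧ x ∈ segment ℝ (p (i + 1)) (p (i + 2)) := by
  rw [jump_neg_iff] at hj
  exact h.exists_of_mem_flag_of_notMem_flag hu (.inl rfl) hj.2 hj.1

lemma exists_of_jump_pos (h : IsNormals p n) {x u : ℂ} (hu : ‖u‖ = 1)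
    (hj : 0 < jump (convexHull ℝ (Set.range p)) x u) :
    ∃ i, u = -n i ∧ x ∈ segment ℝ (p (i + 1)) (p (i + 2)) := by
  rw [jump_pos_iff] at hj
  obtain ⟨i, hi, hx⟩ := h.exists_of_mem_flag_of_notMem_flag hu (e := -u) (.inr rfl)
    (by rw [neg_neg]; exact hj.1) hj.2
  exact ⟨i, by rw [← hi, neg_neg], hx⟩

lemma openSegment_mem_flag (h : IsNormals p n) {x : ℂ} {i : Fin 3}
    (hx : x ∈ openSegment ℝ (p (i + 1)) (p (i + 2))) {d e : ℂ} (hd : dot (n i) d = 0) :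
    (dot (n i) e < 0 → convexHull ℝ (Set.range p) ∈ flag x d e) ∧
    (0 < dot (n i) e → convexHull ℝ (Set.range p) ∉ flag x d e) := by
  have heq := h.dot_eq_of_mem_segment (openSegment_subset_segment ℝ _ _ hx)
  constructor
  · intro he
    have : ∀ j, {z | dot (n j) z < dot (n j) (p (j + 1))} ∈ flag x d e := fun j => by
      rcases eq_or_ne j i with rfl | hne
      · exact dot_lt_mem_flag_of_neg_right heq hd he
      · exact dot_lt_mem_flag_of_lt d e (h.dot_lt_of_mem_openSegment hne hx)
    refine mem_of_superset (Filter.iInter_mem.2 this) fun z hz => ?_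
    rw [h.mem_convexHull_iff]
    exact fun i => (Set.mem_iInter.1 hz i).le
  · intro he h'
    obtain ⟨z, hz, hz'⟩ := (flag_neBot _ _ _).nonempty_of_mem
      (inter_mem (lt_dot_mem_flag_of_pos_right heq hd he) h')
    exact absurd ((h.mem_convexHull_iff.1 hz') i) (not_le.2 hz)

lemma dot_I_mul_self (u : ℂ) : dot u (Complex.I * u) = 0 := by
  simp [dot]; ring

lemma jump_normal (h : IsNormals p n) {x : ℂ} {i : Fin 3}
    (hx : x ∈ openSegment ℝ (p (i + 1)) (p (i + 2))) :
    jump (convexHull ℝ (Set.range p)) x (n i) = -1 := by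
  have hf := fun e => h.openSegment_mem_flag hx (e := e) (dot_I_mul_self (n i))
  have hs : dot (n i) (n i) = 1 := by rw [dot_self, h.norm, one_pow]
  rw [jump, val_of_notMem ((hf _).2 (by rw [hs]; exact one_pos)),
    val_of_mem ((hf _).1 (by rw [dot_neg_right, hs]; norm_num))]
  rfl

lemma jump_neg_normal (h : IsNormals p n) {x : ℂ} {i : Fin 3}
    (hx : x ∈ openSegment ℝ (p (i + 1)) (p (i + 2))) :
    jump (convexHull ℝ (Set.range p)) x (-n i) = 1 := by
  have hd : dot (n i) (Complex.I * -n i) = 0 := by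
    rw [mul_neg, dot_neg_right, dot_I_mul_self, neg_zero]
  have hf := fun e => h.openSegment_mem_flag hx (e := e) hd
  have hs : dot (n i) (n i) = 1 := by rw [dot_self, h.norm, one_pow]
  rw [jump, neg_neg, val_of_notMem ((hf (n i)).2 (by rw [hs]; exact one_pos)),
    val_of_mem ((hf _).1 (by rw [dot_neg_right, hs]; norm_num))]
  rfl

end IsNormals

/-! ### Telescoping jumps along the orbits of the motion -/

lemma add_one_ne_add_two (i : Fin 3) : i + 1 ≠ i + 2 := by
  decide +revert

lemma add_eq_of_ne {l i : Fin 3} (h : l ≠ i) : l + 1 = i ∨ l + 2 = i := by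
  decide +revert

lemma exists_ne_and_ne (i j : Fin 3) : ∃ l, l ≠ i ∧ l ≠ j := by
  decide +revert

lemma eq_or_eq_or_eq_of_ne {l i j : Fin 3} (h : l ≠ i) (h' : l ≠ j) (h'' : i ≠ j) (s : Fin 3) :
    s = l ∨ s = i ∨ s = j := by
  decide +revert

lemma pair_eq_of_ne {l i j : Fin 3} (h : l ≠ i) (h' : l ≠ j) (h'' : i ≠ j) :
    (i = l + 1 ∧ j = l + 2) ∨ (i = l + 2 ∧ j = l + 1) := by
  decide +revert

lemma exists_strict_drop {q : ℤ → ℤ} (hq : ∀ k, q (k + 1) ≤ q k) (h0 : q 0 < q (-1)) {k l : ℤ}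
    (hk : 0 ≤ k) (hl : l < 0) : q k < q l := by
  have hq' : Antitone q := antitone_int_of_succ_le hq
  calc q k ≤ q 0 := hq' hk
    _ < q (-1) := h0
    _ ≤ q l := hq' (by omega)

/-- The piece `Q` is moved by `z ↦ r * z + b`, which changes the shape `T` into `B`. -/
structure Exchange (T B Q : Set ℂ) (r b : ℂ) : Prop where
  norm_eq_one : ‖r‖ = 1
  isBounded : Bornology.IsBounded Q
  frontierIn : ∃ L, FrontierIn Q L
  jump_sub : ∀ x u : ℂ, ‖u‖ = 1 → jump T (r * x + b) (r * u) - jump B (r * x + b) (r * u) =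
    jump Q (r * x + b) (r * u) - jump Q x u

namespace Exchange

variable {T B Q : Set ℂ} {r b : ℂ}

lemma ne_zero (E : Exchange T B Q r b) : r ≠ 0 := by
  rw [← norm_ne_zero_iff, E.norm_eq_one]; exact one_ne_zero

lemma norm_zpow_mul (E : Exchange T B Q r b) (k : ℤ) {u : ℂ} (hu : ‖u‖ = 1) :
    ‖r ^ k * u‖ = 1 := by
  rw [norm_mul, norm_zpow, E.norm_eq_one, one_zpow, hu, one_mul]

/-- Along an orbit of the motion, the difference of the jumps of `T` and `B` telescopes. -/
lemma jump_sub_orbit (E : Exchange T B Q r b) {x : ℤ → ℂ} (hx : ∀ k, x (k + 1) = r * x k + b)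
    {u : ℂ} (hu : ‖u‖ = 1) (k : ℤ) :
    jump T (x (k + 1)) (r ^ (k + 1) * u) - jump B (x (k + 1)) (r ^ (k + 1) * u) =
      jump Q (x (k + 1)) (r ^ (k + 1) * u) - jump Q (x k) (r ^ k * u) := by
  have := E.jump_sub (x k) (r ^ k * u) (E.norm_zpow_mul k hu)
  rwa [← hx, ← mul_assoc, ← zpow_one_add₀ E.ne_zero, add_comm 1 k] at this

/-- If `T` never jumps up and `B` never jumps down along the orbit, the jump of `Q` is antitone
there. It drops strictly from time `-1` to time `0`, so it cannot agree at a negative and a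
nonnegative time. -/
lemma exists_orbit_of_jump_neg (E : Exchange T B Q r b) {x : ℤ → ℂ}
    (hx : ∀ k, x (k + 1) = r * x k + b) {u : ℂ} (hu : ‖u‖ = 1) (hT : jump T (x 0) u < 0)
    {k l : ℤ} (hk : 0 ≤ k) (hl : l < 0)
    (hkl : jump Q (x k) (r ^ k * u) = jump Q (x l) (r ^ l * u)) :
    ∃ k, 0 < jump T (x k) (r ^ k * u) ∨ jump B (x k) (r ^ k * u) < 0 := by
  by_contra! h
  refine (exists_strict_drop (q := fun k => jump Q (x k) (r ^ k * u)) (fun k => ?_) ?_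
    hk hl).ne hkl
  · have h1 := E.jump_sub_orbit hx hu k
    have h2 := h (k + 1)
    linarith
  · have h1 := E.jump_sub_orbit hx hu (-1)
    have h2 := h 0
    simp only [neg_add_cancel, zpow_zero, one_mul] at h1 h2
    simp only [zpow_zero, one_mul]
    linarith

/-- The orbit of a point under a rotation. -/
lemma rotation_orbit (hr : r ≠ 0) (h1 : r ≠ 1) (b x : ℂ) (k : ℤ) :
    b / (1 - r) + r ^ (k + 1) * (x - b / (1 - r)) =
      r * (b / (1 - r) + r ^ k * (x - b / (1 - r))) + b := by
  have h1' : 1 - r ≠ 0 := sub_ne_zero.2 h1.symm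
  have : b = (1 - r) * (b / (1 - r)) := by field_simp
  rw [zpow_add_one₀ hr]
  linear_combination -this

/-- The jump of `Q` repeats a value along the orbit: by periodicity for a rotation of finite order,
and by boundedness of `Q` for a translation. The position of the flag met is recorded only for
rotations, about the center `b / (1 - r)`. -/
lemma exists_jump_of_jump_neg (E : Exchange T B Q r b) (hr : ∃ N : ℕ, 0 < N ∧ r ^ N = 1)
    {x u : ℂ} (hu : ‖u‖ = 1) (hT : jump T x u < 0) :
    ∃ (k : ℤ) (y : ℂ), (0 < jump T y (r ^ k * u) ∨ jump B y (r ^ k * u) < 0) ∧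
      (r ≠ 1 → y = b / (1 - r) + r ^ k * (x - b / (1 - r))) := by
  by_cases h1 : r = 1
  · subst h1
    have hx : ∀ k : ℤ, x + (k + 1 : ℤ) * b = 1 * (x + k * b) + b := fun k => by
      push_cast; ring
    have hkl : ∃ k l : ℤ, 0 ≤ k ∧ l < 0 ∧ jump Q (x + k * b) (1 ^ k * u) =
        jump Q (x + l * b) (1 ^ l * u) := by
      by_cases hb : b = 0
      · exact ⟨0, -1, le_rfl, by norm_num, by simp [hb]⟩
      · obtain ⟨R, hR⟩ := E.isBounded.closure.subset_closedBall x
        have hfar : ∀ k : ℤ, R < |(k : ℝ)| * ‖b‖ → jump Q (x + k * b) (1 ^ k * u) = 0 := by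
          intro k hk
          refine jump_eq_zero_of_notMem_closure _ fun hmem => ?_
          have := hR hmem
          rw [Metric.mem_closedBall, dist_eq_norm, add_sub_cancel_left, norm_mul,
            Complex.norm_intCast] at this
          linarith
        obtain ⟨N, hN⟩ := exists_nat_gt (R / ‖b‖)
        -- `N` itself may be zero, while the times `±(N + 1)` are nonnegative and strictly negative.
        have hN' : R < ((N + 1 : ℕ) : ℝ) * ‖b‖ := by
          rw [div_lt_iff₀ (norm_pos_iff.2 hb)] at hN
          push_cast
          nlinarith [norm_nonneg b]
        refine ⟨(N + 1 : ℕ), -(N + 1 : ℕ), by positivity, by push_cast; omega, ?_⟩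
        rw [hfar _ (by rw [Int.cast_natCast, Nat.abs_cast]; exact hN'),
          hfar _ (by rw [Int.cast_neg, abs_neg, Int.cast_natCast, Nat.abs_cast]; exact hN')]
    obtain ⟨k, l, hk, hl, hkl⟩ := hkl
    obtain ⟨k, hk⟩ := E.exists_orbit_of_jump_neg (x := fun k => x + k * b) hx hu
      (by simpa using hT) hk hl hkl
    exact ⟨k, _, hk, fun h => absurd rfl h⟩
  · obtain ⟨N, hN, hrN⟩ := hr
    obtain ⟨k, hk⟩ := E.exists_orbit_of_jump_neg
      (x := fun k => b / (1 - r) + r ^ k * (x - b / (1 - r)))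
      (rotation_orbit E.ne_zero h1 b x) hu (by simpa using hT) le_rfl
      (show -(N : ℤ) < 0 by omega) (by simp [hrN])
    exact ⟨k, _, hk, fun _ => rfl⟩

end Exchange

/-! ### Isometries carrying one segment into another -/

lemma mapsTo_segment_of_openSegment {φ : ℂ → ℂ} (hφ : Continuous φ) {P P' R R' : ℂ}
    (h : ∀ x ∈ openSegment ℝ P P', φ x ∈ segment ℝ R R') {x : ℂ} (hx : x ∈ segment ℝ P P') :
    φ x ∈ segment ℝ R R' := by
  rw [← closure_openSegment] at hx
  have hc : IsClosed (segment ℝ R R') := by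
    rw [← convexHull_pair]
    exact (((Set.finite_singleton _).insert _).isCompact_convexHull ℝ).isClosed
  have := map_mem_closure hφ hx h
  rwa [hc.closure_eq] at this

lemma dist_le_of_mapsTo_openSegment {φ : ℂ → ℂ} (hφ : Isometry φ) {P P' R R' : ℂ}
    (h : ∀ x ∈ openSegment ℝ P P', φ x ∈ segment ℝ R R') : dist P P' ≤ dist R R' := by
  have h1 := mapsTo_segment_of_openSegment hφ.continuous h (left_mem_segment ℝ P P')
  have h2 := mapsTo_segment_of_openSegment hφ.continuous h (right_mem_segment ℝ P P')
  obtain ⟨a, b, ha, hb, hab, e1⟩ := h1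
  obtain ⟨c, d, hc, hd, hcd, e2⟩ := h2
  rw [← hφ.dist_eq, ← e1, ← e2, dist_eq_norm, dist_eq_norm]
  have hb' : b = 1 - a := by linarith
  have hd' : d = 1 - c := by linarith
  have : a • R + b • R' - (c • R + d • R') = (a - c) • (R - R') := by
    rw [hb', hd']; module
  rw [this, norm_smul, Real.norm_eq_abs]
  have : |a - c| ≤ 1 := abs_le.2 ⟨by linarith, by linarith⟩
  nlinarith [norm_nonneg (R - R')]

/-- A half turn reverses the direction of the segment and keeps its length, so it must exchange the
ends. -/
lemma add_eq_of_pointReflection_mapsTo {O P P' : ℂ} (hne : P ≠ P')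
    (h : ∀ x ∈ openSegment ℝ P P', 2 * O - x ∈ segment ℝ P P') : 2 * O = P + P' := by
  have h1 := mapsTo_segment_of_openSegment (φ := fun x => 2 * O - x) (by fun_prop) h
    (left_mem_segment ℝ P P')
  have h2 := mapsTo_segment_of_openSegment (φ := fun x => 2 * O - x) (by fun_prop) h
    (right_mem_segment ℝ P P')
  obtain ⟨a, b, ha, hb, hab, e1⟩ := h1
  obtain ⟨c, d, hc, hd, hcd, e2⟩ := h2
  simp only [Complex.real_smul] at e1 e2
  have hb' : (b : ℂ) = 1 - a := by
    rw [eq_sub_iff_add_eq']; exact_mod_cast hab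
  have hd' : (d : ℂ) = 1 - c := by
    rw [eq_sub_iff_add_eq']; exact_mod_cast hcd
  rw [hb'] at e1
  rw [hd'] at e2
  -- The coefficients satisfy `c - a = 1` with both in `[0, 1]`, which forces `a = 0`: the end `P`
  -- goes to `P'`.
  have : ((c : ℂ) - a - 1) * (P - P') = 0 := by linear_combination e2 - e1
  have hca : (c : ℂ) - a - 1 = 0 := (mul_eq_zero.1 this).resolve_right (sub_ne_zero.2 hne)
  have hca' : c - a - 1 = 0 := by exact_mod_cast hca
  have ha0 : a = 0 := by linarith
  rw [ha0] at e1
  push_cast at e1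
  linear_combination -e1

lemma isometry_rotation {c : ℂ} (hc : ‖c‖ = 1) (O : ℂ) : Isometry fun x => O + c * (x - O) := by
  refine Isometry.of_dist_eq fun x y => ?_
  rw [dist_eq_norm, dist_eq_norm]
  have : O + c * (x - O) - (O + c * (y - O)) = c * (x - y) := by ring
  rw [this, norm_mul, hc, one_mul]

/-! ### Rotations of finite order and translations -/

namespace Exchange

variable {Q : Set ℂ} {r b : ℂ} {p n p' m : Fin 3 → ℂ}

/-- The orbit of a flag on a side either is turned around on the same side, or arrives at the
other triangle. -/
lemma exists_of_mem_openSegment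
    (E : Exchange (convexHull ℝ (Set.range p)) (convexHull ℝ (Set.range p')) Q r b)
    (hp : IsNormals p n) (hp' : IsNormals p' m) (hr : ∃ N : ℕ, 0 < N ∧ r ^ N = 1) {i : Fin 3}
    (hi : ∀ (k : ℤ) (j), r ^ k * n i = -n j → j = i) {x : ℂ}
    (hx : x ∈ openSegment ℝ (p (i + 1)) (p (i + 2))) :
    (r ≠ 1 ∧ 2 * (b / (1 - r)) - x ∈ segment ℝ (p (i + 1)) (p (i + 2))) ∨
    ∃ (k : ℤ) (j : Fin 3), r ^ k * n i = m j ∧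
      (r ≠ 1 → b / (1 - r) + r ^ k * (x - b / (1 - r)) ∈ segment ℝ (p' (j + 1)) (p' (j + 2))) := by
  obtain ⟨k, y, hy, hy'⟩ := E.exists_jump_of_jump_neg hr (hp.norm i)
    (x := x) (by rw [hp.jump_normal hx]; norm_num)
  rcases hy with hy | hy
  · left
    obtain ⟨j, hj, hyj⟩ := hp.exists_of_jump_pos (E.norm_zpow_mul k (hp.norm i)) hy
    obtain rfl := hi k j hj
    -- A power of the rotation reversing the normal of a side is the half turn about the same
    -- center.
    have hk : r ^ k = -1 := mul_right_cancel₀ (hp.ne_zero j) (by rw [hj]; ring)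
    have h1 : r ≠ 1 := by
      rintro rfl
      rw [one_zpow] at hk
      norm_num at hk
    refine ⟨h1, ?_⟩
    convert hyj using 1
    rw [hy' h1, hk]; ring
  · right
    obtain ⟨j, hj, hyj⟩ := hp'.exists_of_jump_neg (E.norm_zpow_mul k (hp.norm i)) hy
    exact ⟨k, j, hj, fun h1 => by rwa [← hy' h1]⟩

/-- A side whose normal never reaches a normal of the other triangle is turned into itself by a half
turn, so the center of rotation is its midpoint. A translation has no half turn, so every side would
be matched. -/
lemma midpoint_of_unmatched
    (E : Exchange (convexHull ℝ (Set.range p)) (convexHull ℝ (Set.range p')) Q r b)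
    (hp : IsNormals p n) (hp' : IsNormals p' m) (hr : ∃ N : ℕ, 0 < N ∧ r ^ N = 1) {i : Fin 3}
    (hi : ∀ (k : ℤ) (j), r ^ k * n i = -n j → j = i) (hm : ∀ (k : ℤ) (j), r ^ k * n i ≠ m j) :
    r ≠ 1 ∧ 2 * (b / (1 - r)) = p (i + 1) + p (i + 2) := by
  have key : ∀ x ∈ openSegment ℝ (p (i + 1)) (p (i + 2)),
      r ≠ 1 ∧ 2 * (b / (1 - r)) - x ∈ segment ℝ (p (i + 1)) (p (i + 2)) := fun x hx =>
    (E.exists_of_mem_openSegment hp hp' hr hi hx).resolve_right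
      fun ⟨k, j, h, _⟩ => hm k j h
  have hne : p (i + 1) ≠ p (i + 2) := hp.injective.ne (add_one_ne_add_two i)
  obtain ⟨x, hx⟩ : (openSegment ℝ (p (i + 1)) (p (i + 2))).Nonempty :=
    ⟨_, midpoint_mem_openSegment _ _⟩
  exact ⟨(key x hx).1, add_eq_of_pointReflection_mapsTo hne fun x hx => (key x hx).2⟩

/-- When the center is the midpoint of another side, no half turn about it can bring a point of side
`i` back to side `i`. All of side `i` is then carried into side `j` of the other triangle, by a
rotation determined by the two normals. -/
lemma dist_le_of_matched
    (E : Exchange (convexHull ℝ (Set.range p)) (convexHull ℝ (Set.range p')) Q r b)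
    (hp : IsNormals p n) (hp' : IsNormals p' m) (hr : ∃ N : ℕ, 0 < N ∧ r ^ N = 1) {i j l : Fin 3}
    (hi : ∀ (k : ℤ) (j), r ^ k * n i = -n j → j = i)
    (hm : ∀ (k : ℤ) (l), r ^ k * n i = m l → l = j) (hr1 : r ≠ 1) (hl : l ≠ i)
    (hO : 2 * (b / (1 - r)) = p (l + 1) + p (l + 2)) :
    dist (p (i + 1)) (p (i + 2)) ≤ dist (p' (j + 1)) (p' (j + 2)) := by
  refine dist_le_of_mapsTo_openSegment (φ := fun x => b / (1 - r) + m j / n i * (x - b / (1 - r)))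
    (isometry_rotation (by rw [norm_div, hp.norm, hp'.norm, div_one]) _) fun x hx => ?_
  rcases E.exists_of_mem_openSegment hp hp' hr hi hx with ⟨-, h⟩ | ⟨k, l', hk, h⟩
  -- One end of side `l` is the vertex opposite to side `i`, so the center lies strictly inside the
  -- line of side `i`, and the half turn takes this line to a different one.
  · exfalso
    have h1 := hp.dot_eq_of_mem_segment h
    have h2 := hp.dot_eq_of_mem_segment (openSegment_subset_segment ℝ _ _ hx)
    rw [hO, dot_sub_right, dot_add_right, h2] at h1
    have h3 := hp.neg i
    have h4 := hp.dot_vertex_le i (l + 1)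
    have h5 := hp.dot_vertex_le i (l + 2)
    have h6 := add_eq_of_ne hl
    rcases h6 with h6 | h6 <;> rw [h6] at h1 <;> linarith
  · obtain rfl := hm k l' hk
    rw [← hk, mul_div_cancel_right₀ _ (hp.ne_zero i)]
    exact h hr1

/-- A rotation by a rational part of the full turn cannot exchange two mirror triangles in general
position. The map `f` measures the directions of the normals. -/
theorem false_of_isOfFinOrder {V : Type*} [AddCommGroup V]
    (E : Exchange (convexHull ℝ (Set.range p)) (convexHull ℝ (Set.range p')) Q r b)
    (hp : IsNormals p n) (hp' : IsNormals p' m) (hr : ∃ N : ℕ, 0 < N ∧ r ^ N = 1)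
    (hdist : ∀ i j, dist (p' i) (p' j) = dist (p i) (p j))
    (hscal : Function.Injective fun i => dist (p (i + 1)) (p (i + 2)))
    {f : Fin 3 → V} {S : V} (hf : Function.Injective f) (hf1 : Function.Injective fun i => 2 • f i)
    (hf2 : ∀ i, f (i + 1) + f (i + 2) ≠ 2 • f i)
    (hn : ∀ (k : ℤ) (i j), r ^ k * n i = -n j → f i = f j)
    (hm : ∀ (k : ℤ) (i j), r ^ k * n i = m j → f i + f j = S) : False := by
  have hi : ∀ (i) (k : ℤ) (j), r ^ k * n i = -n j → j = i := fun i k j h =>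
    hf (hn k i j h).symm
  by_cases hM : ∃ i j, i ≠ j ∧ f i + f j = S
  · obtain ⟨i, j, hij, hS⟩ := hM
    obtain ⟨l, hli, hlj⟩ : ∃ l, l ≠ i ∧ l ≠ j := exists_ne_and_ne i j
    -- The classes of `i` and `j` already sum to `S`. A partner `i` or `j` for `l` would contradict
    -- injectivity of `f`, and the partner `l` would contradict `hf2`.
    have hl : ∀ (k : ℤ) (j), r ^ k * n l ≠ m j := by
      intro k s hs
      have h1 := hm k l s hs
      have h2 := eq_or_eq_or_eq_of_ne hli hlj hij s
      rcases h2 with rfl | rfl | rfl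
      · apply hf2 s
        have h3 := pair_eq_of_ne hli hlj hij
        rw [two_nsmul, h1, ← hS]
        rcases h3 with ⟨rfl, rfl⟩ | ⟨rfl, rfl⟩
        · rfl
        · exact add_comm _ _
      · apply hlj
        apply hf
        apply add_right_cancel (b := f s)
        rw [h1, ← hS, add_comm]
      · apply hli
        apply hf
        exact add_right_cancel (h1.trans hS.symm)
    obtain ⟨hr1, hO⟩ := E.midpoint_of_unmatched hp hp' hr (hi l) hl
    have h1 := E.dist_le_of_matched hp hp' hr (j := j) (hi i)
      (fun k s hs => hf (add_left_cancel ((hm k i s hs).trans hS.symm))) hr1 hli hO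
    have h2 := E.dist_le_of_matched hp hp' hr (j := i) (hi j)
      (fun k s hs => hf (add_left_cancel ((hm k j s hs).trans
        (hS.symm.trans (add_comm _ _))))) hr1 hlj hO
    rw [hdist] at h1 h2
    exact hij (hscal (le_antisymm h1 h2))
  · push Not at hM
    -- Now a side can only be matched with the side of the same index, which fixes `2 • f i`. At
    -- least two sides stay unmatched, and the center would be the midpoint of both.
    have hun : ∀ i, 2 • f i ≠ S → r ≠ 1 ∧ 2 * (b / (1 - r)) = p (i + 1) + p (i + 2) := by
      intro i hS
      refine E.midpoint_of_unmatched hp hp' hr (hi i) fun k j hj => ?_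
      by_cases hij : i = j
      · subst hij
        exact hS (by rw [two_nsmul]; exact hm k i i hj)
      · exact hM i j hij (hm k i j hj)
    obtain ⟨i, j, hij, h1, h2⟩ : ∃ i j, i ≠ j ∧ 2 • f i ≠ S ∧ 2 • f j ≠ S := by
      by_cases h0 : 2 • f 0 = S
      · refine ⟨1, 2, by decide, ?_, ?_⟩ <;> rw [← h0] <;> exact hf1.ne (by decide)
      · by_cases h1 : 2 • f 1 = S
        · exact ⟨0, 2, by decide, h0, by rw [← h1]; exact hf1.ne (by decide)⟩
        · exact ⟨0, 1, by decide, h0, h1⟩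
    have e1 := (hun i h1).2
    have e2 := (hun j h2).2
    have s1 := sum_fin_three_cyclic p i
    have s2 := sum_fin_three_cyclic p j
    exact hij (hp.injective (by linear_combination s2 - s1 + e1 - e2))

end Exchange

/-! ### Rotations of infinite order: summing jumps and integrating over length -/

lemma add_one_add_one (l : Fin 3) : l + 1 + 1 = l + 2 := by
  decide +revert

lemma add_one_add_two (l : Fin 3) : l + 1 + 2 = l := by
  decide +revert

lemma add_two_add_one (l : Fin 3) : l + 2 + 1 = l := by
  decide +revert

lemma add_two_add_two (l : Fin 3) : l + 2 + 2 = l + 1 := by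
  decide +revert

lemma ne_add_one (l : Fin 3) : l ≠ l + 1 := by
  decide +revert

lemma ne_add_two (l : Fin 3) : l ≠ l + 2 := by
  decide +revert

lemma zpow_injective_of_forall_pow_ne_one {r : ℂ} (hr0 : r ≠ 0)
    (hr : ∀ N : ℕ, 0 < N → r ^ N ≠ 1) : Function.Injective fun k : ℤ => r ^ k := by
  have key : ∀ k : ℤ, 0 < k → r ^ k ≠ 1 := fun k hk h => by
    lift k to ℕ using hk.le
    exact hr k (by exact_mod_cast hk) (by exact_mod_cast h)
  intro k l hkl
  dsimp only at hkl
  have h1 : r ^ (k - l) = 1 := by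
    rw [zpow_sub₀ hr0, hkl, div_self (zpow_ne_zero _ hr0)]
  have h2 : r ^ (l - k) = 1 := by
    rw [zpow_sub₀ hr0, hkl, div_self (zpow_ne_zero _ hr0)]
  rcases lt_trichotomy k l with h | h | h
  · exact absurd h2 (key _ (by omega))
  · exact h
  · exact absurd h1 (key _ (by omega))

/-- Each line of `L` admits two unit normals, and an orbit of directions of infinite order visits
each of them at most once. The bound does not depend on the point, which allows integration over `x`
later. -/
lemma FrontierIn.finite_setOf_jump_ne_zero {Q : Set ℂ} {L : Finset (ℂ × ℝ)}
    (hL : FrontierIn Q L) {r u : ℂ} (hr1 : ‖r‖ = 1) (hr : ∀ N : ℕ, 0 < N → r ^ N ≠ 1)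
    (hu : ‖u‖ = 1) : {k : ℤ | ∃ x, jump Q x (r ^ k * u) ≠ 0}.Finite := by
  have hr0 : r ≠ 0 := by rw [← norm_ne_zero_iff, hr1]; exact one_ne_zero
  have hu0 : u ≠ 0 := by rw [← norm_ne_zero_iff, hu]; exact one_ne_zero
  have hinj : ∀ w : ℂ, {k : ℤ | r ^ k * u = w}.Finite := fun w =>
    Set.Subsingleton.finite fun k hk l hl =>
      zpow_injective_of_forall_pow_ne_one hr0 hr (mul_right_cancel₀ hu0
        ((show r ^ k * u = w from hk).trans (show r ^ l * u = w from hl).symm))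
  refine Set.Finite.subset (L.finite_toSet.biUnion fun l _ =>
    (hinj ((‖l.1‖⁻¹ : ℝ) * l.1)).union (hinj (-((‖l.1‖⁻¹ : ℝ) * l.1)))) ?_
  rintro k ⟨x, hx⟩
  obtain ⟨l, hl, h⟩ := hL.exists_of_jump_ne_zero hx
  refine Set.mem_biUnion hl ?_
  have hl0 : ‖l.1‖ ≠ 0 := norm_ne_zero_iff.2 (hL.1 l hl)
  refine norm_eq_or_eq_neg ?_ (by rw [norm_mul, norm_zpow, hr1, one_zpow, hu, one_mul]) ?_
  · rw [norm_mul, Complex.norm_real, norm_inv, norm_norm, inv_mul_cancel₀ hl0]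
  · rw [dot_ofReal_mul_left, h, mul_zero]
where
  norm_eq_or_eq_neg := @IsNormals.norm_eq_or_eq_neg

lemma exists_nat_forall_of_finite {s : Set ℤ} (hs : s.Finite) :
    ∃ K : ℕ, ∀ k : ℤ, (K : ℤ) ≤ |k| → k ∉ s := by
  obtain ⟨K, hK⟩ := (hs.image Int.natAbs).bddAbove
  refine ⟨K + 1, fun k hk hks => ?_⟩
  have h1 : k.natAbs ≤ K := hK ⟨k, hks, rfl⟩
  rw [Int.abs_eq_natAbs] at hk
  omega

namespace Exchange

variable {T B Q : Set ℂ} {r b : ℂ}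

/-- The sums of the jumps of `T` and of `B` along the orbit of a flag are equal. -/
lemma exists_sum_jump_eq (E : Exchange T B Q r b) (hr : ∀ N : ℕ, 0 < N → r ^ N ≠ 1) {u : ℂ}
    (hu : ‖u‖ = 1) : ∃ K : ℕ, ∀ x,
      ∑ j ∈ Finset.range (2 * K + 1),
        jump T (b / (1 - r) + r ^ (j - K : ℤ) * (x - b / (1 - r))) (r ^ (j - K : ℤ) * u) =
      ∑ j ∈ Finset.range (2 * K + 1),
        jump B (b / (1 - r) + r ^ (j - K : ℤ) * (x - b / (1 - r))) (r ^ (j - K : ℤ) * u) := by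
  obtain ⟨L, hL⟩ := E.frontierIn
  obtain ⟨K, hK⟩ := exists_nat_forall_of_finite (hL.finite_setOf_jump_ne_zero E.norm_eq_one hr hu)
  refine ⟨K, fun x => ?_⟩
  have hr1 : r ≠ 1 := fun h => hr 1 one_pos (by rw [h, one_pow])
  let X : ℤ → ℂ := fun k => b / (1 - r) + r ^ k * (x - b / (1 - r))
  have hX : ∀ k, X (k + 1) = r * X k + b := rotation_orbit E.ne_zero hr1 b x
  have hzero : ∀ k : ℤ, (K : ℤ) ≤ |k| → jump Q (X k) (r ^ k * u) = 0 := fun k hk => by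
    by_contra h
    exact hK k hk ⟨_, h⟩
  rw [← sub_eq_zero, ← Finset.sum_sub_distrib]
  -- With this shift the sum telescopes to the jumps of `Q` at times `K` and `-K - 1`, both in the
  -- range where they vanish.
  obtain ⟨F, hF⟩ : ∃ F : ℕ → ℤ, ∀ j, F j = jump Q (X (j - K - 1)) (r ^ (j - K - 1 : ℤ) * u) :=
    ⟨_, fun _ => rfl⟩
  have : ∀ j ∈ Finset.range (2 * K + 1),
      jump T (X (j - K)) (r ^ (j - K : ℤ) * u) - jump B (X (j - K)) (r ^ (j - K : ℤ) * u) =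
      F (j + 1) - F j := by
    intro j _
    have h := E.jump_sub_orbit hX hu (j - K - 1)
    have e1 : (j - K - 1 : ℤ) + 1 = j - K := by ring
    have e2 : ((j + 1 : ℕ) : ℤ) - K - 1 = j - K := by push_cast; ring
    rw [e1] at h
    rw [hF, hF, e2]
    exact h
  refine (Finset.sum_congr rfl this).trans ?_
  rw [Finset.sum_range_sub, hF, hF, hzero, hzero, sub_self]
  · rw [Int.abs_eq_natAbs]; omega
  · rw [Int.abs_eq_natAbs]; omega

end Exchange

open Classical in
/-- `1` if `v = w`, `-1` if `v = -w`, and `0` otherwise. -/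
noncomputable def signOf (v w : ℂ) : ℤ := (if v = w then 1 else 0) - (if v = -w then 1 else 0)

lemma signOf_self {w : ℂ} (hw : w ≠ 0) : signOf w w = 1 := by
  rw [signOf, if_pos rfl, if_neg (self_ne_neg.2 hw), sub_zero]

lemma signOf_neg {w : ℂ} (hw : w ≠ 0) : signOf (-w) w = -1 := by
  rw [signOf, if_pos rfl, if_neg (neg_ne_self.2 hw), zero_sub]

lemma signOf_of_ne {v w : ℂ} (h : v ≠ w) (h' : v ≠ -w) : signOf v w = 0 := by
  rw [signOf, if_neg h, if_neg h', sub_zero]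

lemma eq_or_eq_neg_of_signOf_ne_zero {v w : ℂ} (h : signOf v w ≠ 0) : v = w ∨ v = -w := by
  by_contra! h'
  exact h (signOf_of_ne h'.1 h'.2)

lemma signOf_mem (v w : ℂ) : signOf v w = -1 ∨ signOf v w = 0 ∨ signOf v w = 1 := by
  unfold signOf; split_ifs <;> simp

namespace IsNormals

variable {p n : Fin 3 → ℂ}

open Classical in
/-- The jumps of a triangle, away from its vertices. -/
lemma jump_eq_sum (h : IsNormals p n) {x v : ℂ} (hv : ‖v‖ = 1) (hx : x ∉ Set.range p) :
    (jump (convexHull ℝ (Set.range p)) x v : ℝ) =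
      ∑ s, (-signOf v (n s) : ℝ) * (segment ℝ (p (s + 1)) (p (s + 2))).indicator 1 x := by
  by_cases hs : ∃ s, x ∈ segment ℝ (p (s + 1)) (p (s + 2))
  · obtain ⟨s, hs⟩ := hs
    have hos : x ∈ openSegment ℝ (p (s + 1)) (p (s + 2)) :=
      mem_openSegment_of_ne_left_right (fun h => hx ⟨_, h⟩) (fun h => hx ⟨_, h⟩) hs
    have huniq : ∀ t, x ∈ segment ℝ (p (t + 1)) (p (t + 2)) → t = s := fun t ht => by
      by_contra hts
      exact (h.dot_lt_of_mem_openSegment hts hos).ne (h.dot_eq_of_mem_segment ht)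
    rw [Finset.sum_eq_single s (fun t _ hts => by
      rw [Set.indicator_of_notMem (fun ht => hts (huniq t ht)), mul_zero]) (by simp),
      Set.indicator_of_mem hs, Pi.one_apply, mul_one]
    by_cases h1 : v = n s
    · rw [h1, h.jump_normal hos, signOf_self (h.ne_zero s)]; simp
    · by_cases h2 : v = -n s
      · rw [h2, h.jump_neg_normal hos, signOf_neg (h.ne_zero s)]; simp
      · rw [signOf_of_ne h1 h2]
        rcases lt_trichotomy (jump (convexHull ℝ (Set.range p)) x v) 0 with hj | hj | hj
        · obtain ⟨t, ht, hxt⟩ := h.exists_of_jump_neg hv hj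
          exact absurd (huniq t hxt ▸ ht) h1
        · rw [hj]; simp
        · obtain ⟨t, ht, hxt⟩ := h.exists_of_jump_pos hv hj
          exact absurd (huniq t hxt ▸ ht) h2
  · push Not at hs
    rw [Finset.sum_eq_zero fun t _ => by rw [Set.indicator_of_notMem (hs t), mul_zero]]
    rcases lt_trichotomy (jump (convexHull ℝ (Set.range p)) x v) 0 with hj | hj | hj
    · obtain ⟨t, -, hxt⟩ := h.exists_of_jump_neg hv hj
      exact absurd hxt (hs t)
    · rw [hj]; simp
    · obtain ⟨t, -, hxt⟩ := h.exists_of_jump_pos hv hj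
      exact absurd hxt (hs t)

lemma measurableSet_segment (x y : ℂ) : MeasurableSet (segment ℝ x y) := by
  rw [← convexHull_pair]
  exact (((Set.finite_singleton _).insert _).isCompact_convexHull ℝ).isClosed.measurableSet

lemma ae_notMem_range (p : Fin 3 → ℂ) : ∀ᵐ x ∂(Measure.hausdorffMeasure 1 : Measure ℂ),
    x ∉ Set.range p := by
  have : NullSingletonClass (Measure.hausdorffMeasure 1 : Measure ℂ) :=
    Measure.nullSingletonClass_hausdorff ℂ one_pos
  exact measure_eq_zero_iff_ae_notMem.1 ((Set.finite_range p).measure_zero _)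

/-- The vertices are null for one-dimensional Hausdorff measure. Elsewhere the jump is a signed sum
of indicators of sides, each of measure its length. -/
lemma integrable_jump (h : IsNormals p n) {v : ℂ} (hv : ‖v‖ = 1) :
    Integrable (fun x => (jump (convexHull ℝ (Set.range p)) x v : ℝ))
      (Measure.hausdorffMeasure 1) ∧
    ∫ x, (jump (convexHull ℝ (Set.range p)) x v : ℝ) ∂(Measure.hausdorffMeasure 1) =
      ∑ s, (-signOf v (n s) : ℝ) * dist (p (s + 1)) (p (s + 2)) := by
  have hae : (fun x => (jump (convexHull ℝ (Set.range p)) x v : ℝ)) =ᵐ[Measure.hausdorffMeasure 1]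
      fun x => ∑ s, (-signOf v (n s) : ℝ) *
        (segment ℝ (p (s + 1)) (p (s + 2))).indicator 1 x := by
    filter_upwards [ae_notMem_range p] with x hx
    exact h.jump_eq_sum hv hx
  have hint : ∀ s : Fin 3, Integrable ((segment ℝ (p (s + 1)) (p (s + 2))).indicator
      (1 : ℂ → ℝ)) (Measure.hausdorffMeasure 1) := fun s => by
    refine (integrable_indicator_iff (measurableSet_segment _ _)).2 ?_
    refine integrableOn_const (C := (1 : ℝ)) ?_
    rw [hausdorffMeasure_segment]
    exact edist_ne_top _ _
  refine ⟨(integrable_congr hae).2 (integrable_finsetSum _ fun s _ => (hint s).const_mul _), ?_⟩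
  rw [integral_congr_ae hae, integral_finsetSum _ fun s _ => (hint s).const_mul _]
  refine Finset.sum_congr rfl fun s _ => ?_
  rw [integral_const_mul, integral_indicator_one (measurableSet_segment _ _), measureReal_def,
    hausdorffMeasure_segment, edist_dist, ENNReal.toReal_ofReal dist_nonneg]

/-- A rotation of the plane as an isometric equivalence. -/
noncomputable def rotationEquiv (O c : ℂ) (hc : ‖c‖ = 1) : ℂ ≃ᵢ ℂ :=
  IsometryEquiv.mk' (fun x => O + c * (x - O)) (fun x => O + c⁻¹ * (x - O)) (fun x => by
    have hc0 : c ≠ 0 := by rw [← norm_ne_zero_iff, hc]; exact one_ne_zero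
    field_simp
    ring) (isometry_rotation hc O)

lemma integral_jump_rotation (h : IsNormals p n) (O : ℂ) {c v : ℂ} (hc : ‖c‖ = 1) (hv : ‖v‖ = 1) :
    Integrable (fun x => (jump (convexHull ℝ (Set.range p)) (O + c * (x - O)) v : ℝ))
      (Measure.hausdorffMeasure 1) ∧
    ∫ x, (jump (convexHull ℝ (Set.range p)) (O + c * (x - O)) v : ℝ)
      ∂(Measure.hausdorffMeasure 1) =
      ∑ s, (-signOf v (n s) : ℝ) * dist (p (s + 1)) (p (s + 2)) := by
  have hmp := (rotationEquiv O c hc).measurePreserving_hausdorffMeasure 1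
  have hemb : MeasurableEmbedding (rotationEquiv O c hc) :=
    (rotationEquiv O c hc).toHomeomorph.measurableEmbedding
  obtain ⟨h1, h2⟩ := h.integrable_jump hv
  generalize hg : (fun x => (jump (convexHull ℝ (Set.range p)) x v : ℝ)) = g at h1 h2
  have hcomp : (fun x => (jump (convexHull ℝ (Set.range p)) (O + c * (x - O)) v : ℝ)) =
      g ∘ rotationEquiv O c hc := by
    rw [← hg]; rfl
  rw [hcomp]
  refine ⟨(hmp.integrable_comp_emb hemb).2 h1, ?_⟩
  rw [← h2]
  exact hmp.integral_comp hemb g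

lemma dist_lt_add (h : IsNormals p n) (i : Fin 3) :
    dist (p (i + 1)) (p (i + 2)) < dist (p (i + 1)) (p i) + dist (p i) (p (i + 2)) := by
  refine lt_of_le_of_ne (dist_triangle _ _ _) fun heq => ?_
  have hw := dist_add_dist_eq_iff.1 heq.symm
  rw [← mem_segment_iff_wbtw] at hw
  exact (h.neg i).ne (h.dot_eq_of_mem_segment hw)

end IsNormals

/-- The number of times, counted with sign, that the first powers of `r` carry `u` to `w`. -/
noncomputable def orbitCount (r : ℂ) (K : ℕ) (u w : ℂ) : ℤ :=
  ∑ j ∈ Finset.range (2 * K + 1), signOf (r ^ (j - K : ℤ) * u) w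

/-- Squaring removes the sign, and `r ^ 2` still separates exponents. The orbit therefore meets `w`
or `-w` at most once, and the count has a single nonzero term. -/
lemma orbitCount_eq {r : ℂ} (hr0 : r ≠ 0) (hr : ∀ N : ℕ, 0 < N → r ^ N ≠ 1) {K : ℕ} {u w : ℂ}
    (hu : u ≠ 0) {j : ℕ} (hj : j ∈ Finset.range (2 * K + 1))
    (hs : signOf (r ^ (j - K : ℤ) * u) w ≠ 0) :
    orbitCount r K u w = signOf (r ^ (j - K : ℤ) * u) w := by
  refine Finset.sum_eq_single j (fun i _ hij => ?_) fun h => absurd hj h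
  by_contra hi
  have h2 : (r ^ (i - K : ℤ) * u) ^ 2 = (r ^ (j - K : ℤ) * u) ^ 2 := by
    rcases eq_or_eq_neg_of_signOf_ne_zero hs with h | h <;>
    rcases eq_or_eq_neg_of_signOf_ne_zero hi with h' | h' <;> rw [h, h'] <;> ring
  rw [mul_pow, mul_pow] at h2
  have h3 := mul_right_cancel₀ (pow_ne_zero 2 hu) h2
  rw [← zpow_natCast, ← zpow_natCast, ← zpow_mul, ← zpow_mul] at h3
  have := zpow_injective_of_forall_pow_ne_one hr0 hr h3
  push_cast at this
  omega

lemma orbitCount_mem {r : ℂ} (hr0 : r ≠ 0) (hr : ∀ N : ℕ, 0 < N → r ^ N ≠ 1) (K : ℕ) {u : ℂ}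
    (hu : u ≠ 0) (w : ℂ) :
    orbitCount r K u w = 0 ∨ (orbitCount r K u w = -1 ∨ orbitCount r K u w = 1) ∧
      ∃ k : ℤ, r ^ k * u = w ∨ r ^ k * u = -w := by
  by_cases h : ∃ j ∈ Finset.range (2 * K + 1), signOf (r ^ (j - K : ℤ) * u) w ≠ 0
  · obtain ⟨j, hj, hs⟩ := h
    right
    rw [orbitCount_eq hr0 hr hu hj hs]
    have := signOf_mem (r ^ (j - K : ℤ) * u) w
    exact ⟨by tauto, _, eq_or_eq_neg_of_signOf_ne_zero hs⟩
  · push Not at h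
    exact .inl (Finset.sum_eq_zero h)

lemma orbitCount_self {r : ℂ} (hr0 : r ≠ 0) (hr : ∀ N : ℕ, 0 < N → r ^ N ≠ 1) (K : ℕ) {u : ℂ}
    (hu : u ≠ 0) : orbitCount r K u u = 1 := by
  have h1 : signOf (r ^ ((K : ℕ) - K : ℤ) * u) u = 1 := by
    rw [sub_self, zpow_zero, one_mul, signOf_self hu]
  rw [orbitCount_eq hr0 hr hu (j := K) (Finset.mem_range.2 (by omega))
    (by rw [h1]; exact one_ne_zero), h1]

namespace Exchange

variable {Q : Set ℂ} {r b : ℂ} {p n p' m : Fin 3 → ℂ}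

/-- Hausdorff measure is invariant under the rotations `r ^ k` about the center, so integrating the
pointwise identity of jump sums leaves the side lengths weighted by signed orbit counts. -/
lemma exists_sum_orbitCount_eq
    (E : Exchange (convexHull ℝ (Set.range p)) (convexHull ℝ (Set.range p')) Q r b)
    (hp : IsNormals p n) (hp' : IsNormals p' m) (hr : ∀ N : ℕ, 0 < N → r ^ N ≠ 1) {u : ℂ}
    (hu : ‖u‖ = 1) : ∃ K : ℕ,
      ∑ s, (orbitCount r K u (n s) : ℝ) * dist (p (s + 1)) (p (s + 2)) =
      ∑ s, (orbitCount r K u (m s) : ℝ) * dist (p' (s + 1)) (p' (s + 2)) := by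
  obtain ⟨K, hK⟩ := E.exists_sum_jump_eq hr hu
  refine ⟨K, ?_⟩
  have key : ∀ {p n : Fin 3 → ℂ}, IsNormals p n →
      ∫ x, ((∑ j ∈ Finset.range (2 * K + 1), jump (convexHull ℝ (Set.range p))
        (b / (1 - r) + r ^ (j - K : ℤ) * (x - b / (1 - r))) (r ^ (j - K : ℤ) * u) : ℤ) : ℝ)
        ∂(Measure.hausdorffMeasure 1) =
      -∑ s, (orbitCount r K u (n s) : ℝ) * dist (p (s + 1)) (p (s + 2)) := by
    intro p n hp
    have hc : ∀ k : ℤ, ‖r ^ k‖ = 1 := fun k => by rw [norm_zpow, E.norm_eq_one, one_zpow]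
    have hI := fun j : ℕ => hp.integral_jump_rotation (b / (1 - r)) (hc (j - K))
      (E.norm_zpow_mul (j - K) hu)
    push_cast
    rw [integral_finsetSum _ fun j _ => (hI j).1, Finset.sum_congr rfl fun j _ => (hI j).2,
      Finset.sum_comm, ← Finset.sum_neg_distrib]
    refine Finset.sum_congr rfl fun s _ => ?_
    rw [← Finset.sum_mul, orbitCount, Finset.sum_neg_distrib]
    push_cast
    ring
  have h1 := key hp
  rw [integral_congr_ae (ae_of_all _ fun x => by rw [hK x]), key hp'] at h1
  linarith

/-- A rotation by an irrational part of the full turn cannot exchange two mirror triangles in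
general position. The map `f` measures the directions of the normals. -/
theorem false_of_not_isOfFinOrder {V : Type*} [AddCommGroup V]
    (E : Exchange (convexHull ℝ (Set.range p)) (convexHull ℝ (Set.range p')) Q r b)
    (hp : IsNormals p n) (hp' : IsNormals p' m) (hr : ∀ N : ℕ, 0 < N → r ^ N ≠ 1)
    (hdist : ∀ i j, dist (p' i) (p' j) = dist (p i) (p j))
    (hscal : Function.Injective fun i => dist (p (i + 1)) (p (i + 2)))
    (hV : ∀ x y : V, 2 • x = 2 • y → x = y) {f : Fin 3 → V} {S : V}
    (hf : ∃ i j, f i ≠ f j)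
    (hn : ∀ (k : ℤ) (i j), r ^ k * n i = n j ∨ r ^ k * n i = -n j → f i = f j)
    (hm : ∀ (k : ℤ) (i j), r ^ k * n i = m j ∨ r ^ k * n i = -m j → f i + f j = S) : False := by
  let a : Fin 3 → ℝ := fun i => dist (p (i + 1)) (p (i + 2))
  have ha : ∀ i, 0 < a i := fun i => dist_pos.2 (hp.injective.ne (add_one_ne_add_two i))
  have htri : ∀ i, a i < a (i + 1) + a (i + 2) := fun i => by
    have h1 := hp.dist_lt_add i
    simp only [a, add_one_add_one, add_one_add_two, add_two_add_one, add_two_add_two]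
    rw [dist_comm (p (i + 2)) (p i), dist_comm (p i) (p (i + 1))]
    linarith
  -- Apply the length identity to the orbit of `n i`. Only sides whose direction class is compatible
  -- with that of `i` can have a nonzero coefficient.
  have key : ∀ i, ∃ e e' : Fin 3 → ℤ, ∑ s, (e s : ℝ) * a s = ∑ s, (e' s : ℝ) * a s ∧ e i = 1 ∧
      (∀ s, e s = 0 ∨ (e s = -1 ∨ e s = 1) ∧ f i = f s) ∧
      (∀ s, e' s = 0 ∨ (e' s = -1 ∨ e' s = 1) ∧ f i + f s = S) := by
    intro i
    obtain ⟨K, hK⟩ := E.exists_sum_orbitCount_eq hp hp' hr (hp.norm i)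
    simp_rw [hdist] at hK
    refine ⟨_, _, hK, orbitCount_self E.ne_zero hr K (hp.ne_zero i), fun s => ?_, fun s => ?_⟩
    · exact (orbitCount_mem E.ne_zero hr K (hp.ne_zero i) (n s)).imp_right
        fun ⟨h, k, hk⟩ => ⟨h, hn k i s hk⟩
    · exact (orbitCount_mem E.ne_zero hr K (hp.ne_zero i) (m s)).imp_right
        fun ⟨h, k, hk⟩ => ⟨h, hm k i s hk⟩
  by_cases hinj : Function.Injective f
  · have h2 : ∀ i, 2 • f i = S := by
      intro i
      obtain ⟨e, e', hsum, hi, he, he'⟩ := key i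
      have hL : ∑ s, (e s : ℝ) * a s = a i := by
        rw [Finset.sum_eq_single i (fun s _ hs => ?_) (by simp), hi, Int.cast_one, one_mul]
        rw [(he s).resolve_right fun h => hs (hinj h.2).symm, Int.cast_zero, zero_mul]
      obtain ⟨t, ht⟩ : ∃ t, e' t ≠ 0 := by
        by_contra! h
        rw [hL, Finset.sum_eq_zero fun s _ => by rw [h s, Int.cast_zero, zero_mul]] at hsum
        exact (ha i).ne' hsum
      obtain ⟨ht1, ht2⟩ := (he' t).resolve_left ht
      have hR : ∑ s, (e' s : ℝ) * a s = e' t * a t := by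
        rw [Finset.sum_eq_single t (fun s _ hs => ?_) (by simp)]
        rw [(he' s).resolve_right fun h => hs (hinj (add_left_cancel (h.2.trans ht2.symm))),
          Int.cast_zero, zero_mul]
      rw [hL, hR] at hsum
      have hit : i = t := by
        apply hscal
        change a i = a t
        rcases ht1 with h | h <;> rw [h] at hsum <;> push_cast at hsum
        · linarith [ha i, ha t]
        · linarith
      rw [two_nsmul]
      conv_lhs => rw [hit]
      rw [← hit]
      rw [← hit] at ht2
      exact ht2
    have := hinj (hV _ _ ((h2 0).trans (h2 1).symm))
    exact absurd this (by decide)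
  -- As `f` is neither injective nor constant, exactly two classes coincide and the third is
  -- isolated.
  · obtain ⟨l, hl, hll⟩ : ∃ l, f (l + 1) = f (l + 2) ∧ f l ≠ f (l + 1) := by
      obtain ⟨i, j, hij, hne⟩ : ∃ i j, f i = f j ∧ i ≠ j := by
        simpa [Function.Injective] using hinj
      obtain ⟨l, hli, hlj⟩ := exists_ne_and_ne i j
      refine ⟨l, ?_, fun h => ?_⟩
      · rcases pair_eq_of_ne hli hlj hne with ⟨rfl, rfl⟩ | ⟨rfl, rfl⟩
        · exact hij
        · exact hij.symm
      · obtain ⟨s, t, hst⟩ := hf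
        have hall : ∀ s, f s = f l := by
          intro s
          have h1 : f i = f l := by
            rcases pair_eq_of_ne hli hlj hne with ⟨rfl, rfl⟩ | ⟨rfl, rfl⟩
            · exact h.symm
            · exact hij.trans h.symm
          rcases eq_or_eq_or_eq_of_ne hli hlj hne s with rfl | rfl | rfl
          · rfl
          · exact h1
          · exact hij.symm.trans h1
        exact hst ((hall s).trans (hall t).symm)
    have hll' : f l ≠ f (l + 2) := hl ▸ hll
    obtain ⟨e, e', hsum, hi, he, he'⟩ := key l
    rw [sum_fin_three_cyclic _ l, sum_fin_three_cyclic _ l, hi,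
      (he (l + 1)).resolve_right fun h => hll h.2,
      (he (l + 2)).resolve_right fun h => hll' h.2] at hsum
    by_cases h0 : e' l = 0
    · rw [h0] at hsum
      push_cast at hsum
      have p0 := ha l
      have p1 := ha (l + 1)
      have p2 := ha (l + 2)
      have q0 := htri l
      have q1 := htri (l + 1)
      have q2 := htri (l + 2)
      rw [add_one_add_one, add_one_add_two] at q1
      rw [add_two_add_one, add_two_add_two] at q2
      have n1 : a l ≠ a (l + 1) := hscal.ne (ne_add_one l)
      have n2 : a l ≠ a (l + 2) := hscal.ne (ne_add_two l)
      rcases he' (l + 1) with h1 | ⟨h1 | h1, -⟩ <;> rcases he' (l + 2) with h2 | ⟨h2 | h2, -⟩ <;>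
        rw [h1, h2] at hsum <;> push_cast at hsum
      -- Each of the nine sign patterns contradicts positivity, a strict triangle inequality, or the
      -- inequality of two sides.
      all_goals first
        | linarith
        | exact n1 (by linarith)
        | exact n2 (by linarith)
    -- Here `S` is twice the isolated class, so the orbit of `n (l + 1)` meets no side of the box at
    -- all; its relation would say `a (l + 1) = 0` or `a (l + 1) = ± a (l + 2)`.
    · have hS : f l + f l = S := ((he' l).resolve_left h0).2
      obtain ⟨d, d', hsum', hi', hd, hd'⟩ := key (l + 1)
      rw [sum_fin_three_cyclic _ l, sum_fin_three_cyclic _ l, hi',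
        (hd l).resolve_right fun h => hll h.2.symm,
        (hd' l).resolve_right fun h => hll (add_right_cancel (hS.trans h.2.symm)),
        (hd' (l + 1)).resolve_right fun h => hll (hV _ _ (by
          rw [two_nsmul, two_nsmul, hS, h.2])),
        (hd' (l + 2)).resolve_right fun h => hll (hV _ _ (by
          rw [two_nsmul, two_nsmul, hS, ← h.2, hl]))] at hsum'
      have p1 := ha (l + 1)
      have p2 := ha (l + 2)
      have n1 : a (l + 1) ≠ a (l + 2) := hscal.ne (add_one_ne_add_two l)
      rcases hd (l + 2) with h2 | ⟨h2 | h2, -⟩ <;> rw [h2] at hsum' <;> push_cast at hsum'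
      · linarith
      · exact n1 (by linarith)
      · linarith

end Exchange

/-! ### Direction classes and independence of the angles -/

namespace IsNormals

variable {p n : Fin 3 → ℂ}

lemma inner_eq_dot (u v : ℂ) : inner ℝ u v = dot u v := by
  rw [Complex.inner, dot]; simp; ring

/-- The angle between two outward normals is supplementary to the angle of the triangle. -/
lemma dot_normals (h : IsNormals p n) (i : Fin 3) :
    dot (n (i + 1)) (n (i + 2)) = -Real.cos (∠ (p (i + 1)) (p i) (p (i + 2))) := by
  have ho1 := h.ortho (i + 2)
  have ho2 := h.ortho (i + 1)
  have hn1 := h.neg (i + 1)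
  have hn2 := h.neg (i + 2)
  rw [add_two_add_two, add_two_add_one] at ho1
  rw [add_one_add_one, add_one_add_two] at ho2
  rw [add_one_add_one] at hn1
  rw [add_two_add_one] at hn2
  obtain ⟨s, hs⟩ := eq_ofReal_mul_I_mul (h.norm (i + 2)) (z := p (i + 1) - p i)
    (by rw [dot_sub_right, ho1, sub_self])
  obtain ⟨t, ht⟩ := eq_ofReal_mul_I_mul (h.norm (i + 1)) (z := p (i + 2) - p i)
    (by rw [dot_sub_right, ← ho2, sub_self])
  have e1 : s * dot (n (i + 1)) (Complex.I * n (i + 2)) < 0 := by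
    rw [← dot_ofReal_mul_right, ← hs, dot_sub_right]; linarith
  have e2 : t * dot (n (i + 2)) (Complex.I * n (i + 1)) < 0 := by
    rw [← dot_ofReal_mul_right, ← ht, dot_sub_right]; linarith
  have e3 : dot (n (i + 2)) (Complex.I * n (i + 1)) = -dot (n (i + 1)) (Complex.I * n (i + 2)) := by
    simp [dot]; ring
  have hst : s * t < 0 := by
    rw [e3] at e2
    have := mul_pos_of_neg_of_neg e1 e2
    by_contra! hst
    nlinarith [mul_nonneg hst (sq_nonneg (dot (n (i + 1)) (Complex.I * n (i + 2))))]
  have hI : ∀ (a : ℝ) (j : Fin 3), ‖(a : ℂ) * (Complex.I * n j)‖ = |a| := fun a j => by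
    rw [norm_mul, norm_mul, h.norm, Complex.norm_real, Complex.norm_I, Real.norm_eq_abs, mul_one,
      mul_one]
  have hd : dot (Complex.I * n (i + 2)) (Complex.I * n (i + 1)) = dot (n (i + 1)) (n (i + 2)) := by
    simp [dot]; ring
  rw [EuclideanGeometry.angle, vsub_eq_sub, vsub_eq_sub, InnerProductGeometry.cos_angle, hs, ht,
    hI, hI, inner_eq_dot, dot_ofReal_mul_left, dot_ofReal_mul_right, hd, ← abs_mul,
    abs_of_neg hst]
  have hs0 : s ≠ 0 := left_ne_zero_of_mul hst.ne
  have ht0 : t ≠ 0 := right_ne_zero_of_mul hst.ne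
  field_simp

end IsNormals

section Directions

variable {V : Type*} [AddCommGroup V] [Module ℚ V]

/-- Representatives of an angle differ by integer multiples of `2π`, which `Φ` kills. This is what
makes the direction class additive despite the branch cut of `arg`. -/
lemma map_eq_of_coe_angle_eq {Φ : ℝ →ₗ[ℚ] V} (hπ : Φ Real.pi = 0) {x y : ℝ}
    (h : (x : Real.Angle) = y) : Φ x = Φ y := by
  obtain ⟨k, hk⟩ := Real.Angle.angle_eq_iff_two_pi_dvd_sub.1 h
  have : x - y = ((2 * k : ℤ) : ℚ) • Real.pi := by
    rw [hk, Rat.smul_def]; push_cast; ring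
  rw [← sub_eq_zero, ← map_sub, this, map_smul, hπ, smul_zero]

/-- The direction of a complex number, modulo the kernel of `Φ`. -/
noncomputable def dirClass (Φ : ℝ →ₗ[ℚ] V) (z : ℂ) : V := Φ z.arg

lemma dirClass_mul {Φ : ℝ →ₗ[ℚ] V} (hπ : Φ Real.pi = 0) {z w : ℂ} (hz : z ≠ 0) (hw : w ≠ 0) :
    dirClass Φ (z * w) = dirClass Φ z + dirClass Φ w := by
  rw [dirClass, dirClass, dirClass, ← map_add]
  apply map_eq_of_coe_angle_eq hπ
  rw [Complex.arg_mul_coe_angle hz hw, Real.Angle.coe_add]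

lemma dirClass_neg {Φ : ℝ →ₗ[ℚ] V} (hπ : Φ Real.pi = 0) {z : ℂ} (hz : z ≠ 0) :
    dirClass Φ (-z) = dirClass Φ z := by
  have h : dirClass Φ (-1) = 0 := by rw [dirClass, Complex.arg_neg_one, hπ]
  rw [← neg_one_mul, dirClass_mul hπ (by norm_num) hz, h, zero_add]

lemma dirClass_conj {Φ : ℝ →ₗ[ℚ] V} (hπ : Φ Real.pi = 0) (z : ℂ) :
    dirClass Φ (starRingEnd ℂ z) = -dirClass Φ z := by
  rw [dirClass, dirClass, ← map_neg]
  apply map_eq_of_coe_angle_eq hπ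
  rw [Complex.arg_conj_coe_angle, Real.Angle.coe_neg]

lemma dirClass_zpow {Φ : ℝ →ₗ[ℚ] V} (hπ : Φ Real.pi = 0) (z : ℂ) (k : ℤ) :
    dirClass Φ (z ^ k) = k • dirClass Φ z := by
  rw [dirClass, dirClass, ← map_zsmul]
  apply map_eq_of_coe_angle_eq hπ
  rw [Complex.arg_zpow_coe_angle, Real.Angle.coe_zsmul]

lemma dirClass_zpow_mul {Φ : ℝ →ₗ[ℚ] V} (hπ : Φ Real.pi = 0) {r : ℂ} (hr0 : r ≠ 0)
    (hr : dirClass Φ r = 0) (k : ℤ) {z : ℂ} (hz : z ≠ 0) :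
    dirClass Φ (r ^ k * z) = dirClass Φ z := by
  rw [dirClass_mul hπ (zpow_ne_zero _ hr0) hz, dirClass_zpow hπ, hr, smul_zero, zero_add]

lemma dot_eq_cos_arg_sub {z w : ℂ} (hz : ‖z‖ = 1) (hw : ‖w‖ = 1) :
    dot z w = Real.cos (z.arg - w.arg) := by
  have hz0 : z ≠ 0 := by rw [← norm_ne_zero_iff, hz]; exact one_ne_zero
  have hw0 : w ≠ 0 := by rw [← norm_ne_zero_iff, hw]; exact one_ne_zero
  rw [Real.cos_sub, Complex.cos_arg hz0, Complex.cos_arg hw0, Complex.sin_arg, Complex.sin_arg, hz,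
    hw, dot]
  ring

/-- The classes of the directions of two outward normals differ by the class of an angle. -/
lemma IsNormals.dirClass_sub {Φ : ℝ →ₗ[ℚ] V} (hπ : Φ Real.pi = 0) {p n : Fin 3 → ℂ}
    (h : IsNormals p n) (i : Fin 3) :
    dirClass Φ (n (i + 1)) - dirClass Φ (n (i + 2)) = Φ (∠ (p (i + 1)) (p i) (p (i + 2))) ∨
    dirClass Φ (n (i + 1)) - dirClass Φ (n (i + 2)) = -Φ (∠ (p (i + 1)) (p i) (p (i + 2))) := by
  have h1 := h.dot_normals i
  rw [dot_eq_cos_arg_sub (h.norm _) (h.norm _), ← Real.cos_add_pi,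
    Real.Angle.cos_eq_iff_coe_eq_or_eq_neg] at h1
  rw [dirClass, dirClass, ← map_sub]
  refine h1.imp (fun h1 => ?_) fun h1 => ?_
  · rw [map_eq_of_coe_angle_eq hπ h1, map_add, hπ, add_zero]
  · rw [← Real.Angle.coe_neg] at h1
    rw [map_eq_of_coe_angle_eq hπ h1, map_neg, map_add, hπ, add_zero]

end Directions

section Independence

variable {θ : Fin 3 → ℝ}

lemma linearIndependent_of_forall_int
    (h : ∀ k l m : ℤ, k * θ 0 + l * θ 1 + m * θ 2 = 0 → k = 0 ∧ l = 0 ∧ m = 0) :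
    LinearIndependent ℚ θ := by
  rw [← LinearIndependent.iff_fractionRing ℤ ℚ, Fintype.linearIndependent_iff]
  intro g hg
  simp only [Fin.sum_univ_three, zsmul_eq_mul] at hg
  obtain ⟨h0, h1, h2⟩ := h _ _ _ hg
  intro i
  fin_cases i
  · exact h0
  · exact h1
  · exact h2

/-- Since `π` is the sum of the angles, its rational multiples have equal coordinates in the
independent family `θ`. -/
lemma coeff_eq_of_mkQ_eq_zero (h : LinearIndependent ℚ θ) (hsum : ∑ i, θ i = Real.pi)
    {c : Fin 3 → ℚ} (hc : (Submodule.span ℚ {Real.pi}).mkQ (∑ i, c i • θ i) = 0) (i j : Fin 3) :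
    c i = c j := by
  rw [Submodule.mkQ_apply, Submodule.Quotient.mk_eq_zero, Submodule.mem_span_singleton] at hc
  obtain ⟨q, hq⟩ := hc
  have : ∑ i, (c i - q) • θ i = 0 := by
    simp_rw [sub_smul]
    rw [Finset.sum_sub_distrib, ← Finset.smul_sum, hsum, hq, sub_self]
  have h0 := Fintype.linearIndependent_iff.1 h _ this
  linarith [h0 i, h0 j]

/-- Three independent angles do not fit into a rational space spanned by two numbers. It is used
with `π` and the argument of the rotation. -/
lemma exists_mkQ_ne_zero (h : LinearIndependent ℚ θ) (x y : ℝ) :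
    ∃ i, (Submodule.span ℚ {x, y}).mkQ (θ i) ≠ 0 := by
  by_contra! h0
  have hsub : Set.range θ ≤ Submodule.span ℚ (({x, y} : Finset ℝ) : Set ℝ) := by
    rintro _ ⟨i, rfl⟩
    have := h0 i
    rw [Submodule.mkQ_apply, Submodule.Quotient.mk_eq_zero] at this
    rwa [Finset.coe_pair]
  have h1 := linearIndependent_le_span_aux' θ h _ hsub
  simp only [Fintype.card_fin, Finset.coe_sort_coe, Fintype.card_coe] at h1
  have := Finset.card_le_two (a := x) (b := y)
  omega

end Independence

lemma two_nsmul_injective (V : Type*) [AddCommGroup V] [Module ℚ V] (x y : V)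
    (h : 2 • x = 2 • y) : x = y := by
  have h' : (2 : ℚ) • x = (2 : ℚ) • y := by
    rwa [two_smul, two_smul, ← two_nsmul, ← two_nsmul]
  exact smul_right_injective V (two_ne_zero' ℚ) h'

/-- Two mirror triangles with integrally independent angles cannot be exchanged by moving one
piece. -/
theorem Exchange.false_of_independent {Q : Set ℂ} {r b ω : ℂ} {p n p' m : Fin 3 → ℂ}
    (E : Exchange (convexHull ℝ (Set.range p)) (convexHull ℝ (Set.range p')) Q r b)
    (hp : IsNormals p n) (hp' : IsNormals p' m) (hω : ω ≠ 0)
    (hm : ∀ i, m i = ω * starRingEnd ℂ (n i))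
    (hdist : ∀ i j, dist (p' i) (p' j) = dist (p i) (p j))
    (hscal : Function.Injective fun i => dist (p (i + 1)) (p (i + 2)))
    (hind : LinearIndependent ℚ fun i => ∠ (p (i + 1)) (p i) (p (i + 2)))
    (hsum : ∑ i, ∠ (p (i + 1)) (p i) (p (i + 2)) = Real.pi) : False := by
  have hconj : ∀ i, starRingEnd ℂ (n i) ≠ 0 := fun i =>
    (map_ne_zero (starRingEnd ℂ)).2 (hp.ne_zero i)
  by_cases hr : ∃ N : ℕ, 0 < N ∧ r ^ N = 1
  · let Φ := (Submodule.span ℚ {Real.pi}).mkQ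
    have hπ : Φ Real.pi = 0 := by
      rw [Submodule.mkQ_apply, Submodule.Quotient.mk_eq_zero]
      exact Submodule.mem_span_singleton_self _
    -- A root of unity has torsion class, and a rational vector space is torsion free.
    have hrΦ : dirClass Φ r = 0 := by
      obtain ⟨N, hN, hrN⟩ := hr
      have h1 := dirClass_zpow hπ r N
      rw [zpow_natCast, hrN, dirClass, Complex.arg_one, map_zero] at h1
      have h2 : ((N : ℤ) : ℚ) • dirClass Φ r = 0 := by rw [Int.cast_smul_eq_zsmul, ← h1]
      refine (smul_eq_zero.1 h2).resolve_left ?_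
      exact_mod_cast hN.ne'
    have hne : ∀ i, dirClass Φ (n (i + 1)) ≠ dirClass Φ (n (i + 2)) := by
      intro i h
      have h1 : Φ (∠ (p (i + 1)) (p i) (p (i + 2))) = 0 := by
        rcases hp.dirClass_sub hπ i with h2 | h2 <;> rw [h, sub_self] at h2
        · exact h2.symm
        · exact neg_eq_zero.1 h2.symm
      have h3 := coeff_eq_of_mkQ_eq_zero hind hsum (c := Pi.single i 1) (by
        rw [Finset.sum_eq_single i (fun j _ hj => by rw [Pi.single_eq_of_ne hj, zero_smul])
          (by simp), Pi.single_eq_same, one_smul]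
        exact h1) i (i + 1)
      rw [Pi.single_eq_same, Pi.single_eq_of_ne (ne_add_one i).symm] at h3
      exact one_ne_zero h3
    have hinj : Function.Injective fun i => dirClass Φ (n i) := by
      intro i j hij
      by_contra h
      obtain ⟨l, hli, hlj⟩ := exists_ne_and_ne i j
      rcases pair_eq_of_ne hli hlj h with ⟨rfl, rfl⟩ | ⟨rfl, rfl⟩
      · exact hne l hij
      · exact hne l hij.symm
    refine E.false_of_isOfFinOrder hp hp' hr hdist hscal (f := fun i => dirClass Φ (n i))
      (S := dirClass Φ ω) hinj (fun i j h => hinj (two_nsmul_injective _ _ _ h)) ?_ ?_ ?_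
    · intro i h
      have h1 := hp.dirClass_sub hπ (i + 1)
      have h2 := hp.dirClass_sub hπ (i + 2)
      rw [add_one_add_one, add_one_add_two] at h1
      rw [add_two_add_one, add_two_add_two] at h2
      have h3 : (dirClass Φ (n (i + 2)) - dirClass Φ (n i)) -
          (dirClass Φ (n i) - dirClass Φ (n (i + 1))) = 0 := by
        rw [← sub_eq_zero] at h
        rw [← h]
        abel
      -- The differences of classes are angles up to unknown signs. Whatever the signs, the angle at
      -- `i` has coefficient zero while that at `i + 1` has not, so the combination is not a
      -- multiple of `π`.
      obtain ⟨q, q', hq, hqq⟩ : ∃ q q' : ℚ, q ≠ 0 ∧ Φ (q • ∠ (p (i + 2)) (p (i + 1)) (p i) +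
          q' • ∠ (p i) (p (i + 2)) (p (i + 1))) = 0 := by
        rcases h1 with h1 | h1 <;> rcases h2 with h2 | h2 <;> rw [h1, h2] at h3
        · exact ⟨1, -1, by norm_num, by rw [← h3]; simp only [map_add, map_smul]; module⟩
        · exact ⟨1, 1, by norm_num, by rw [← h3]; simp only [map_add, map_smul]; module⟩
        · exact ⟨-1, -1, by norm_num, by rw [← h3]; simp only [map_add, map_smul]; module⟩
        · exact ⟨-1, 1, by norm_num, by rw [← h3]; simp only [map_add, map_smul]; module⟩
      have h4 := coeff_eq_of_mkQ_eq_zero hind hsum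
        (c := Pi.single (i + 1) q + Pi.single (i + 2) q') (by
        rw [sum_fin_three_cyclic _ i]
        simp only [Pi.add_apply, Pi.single_eq_same, Pi.single_eq_of_ne (ne_add_one i),
          Pi.single_eq_of_ne (ne_add_two i), Pi.single_eq_of_ne (add_one_ne_add_two i),
          Pi.single_eq_of_ne (add_one_ne_add_two i).symm, add_zero, zero_add, zero_smul,
          add_one_add_one, add_one_add_two, add_two_add_one, add_two_add_two]
        exact hqq) (i + 1) i
      simp only [Pi.add_apply, Pi.single_eq_same, Pi.single_eq_of_ne (ne_add_one i),
          Pi.single_eq_of_ne (ne_add_two i), Pi.single_eq_of_ne (add_one_ne_add_two i),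
          add_zero] at h4
      exact hq h4
    · intro k i j h
      rw [← dirClass_zpow_mul hπ E.ne_zero hrΦ k (hp.ne_zero i), h, dirClass_neg hπ (hp.ne_zero j)]
    · intro k i j h
      rw [← dirClass_zpow_mul hπ E.ne_zero hrΦ k (hp.ne_zero i), h, hm,
        dirClass_mul hπ hω (hconj j), dirClass_conj hπ, neg_add_cancel_right]
  · push Not at hr
    let Φ := (Submodule.span ℚ {Real.pi, r.arg}).mkQ
    have hπ : Φ Real.pi = 0 := by
      rw [Submodule.mkQ_apply, Submodule.Quotient.mk_eq_zero]
      exact Submodule.subset_span (by simp)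
    have hrΦ : dirClass Φ r = 0 := by
      rw [dirClass, Submodule.mkQ_apply, Submodule.Quotient.mk_eq_zero]
      exact Submodule.subset_span (by simp)
    refine E.false_of_not_isOfFinOrder hp hp' hr hdist hscal (two_nsmul_injective _)
      (f := fun i => dirClass Φ (n i)) (S := dirClass Φ ω) ?_ ?_ ?_
    · obtain ⟨i, hi⟩ := exists_mkQ_ne_zero hind Real.pi r.arg
      refine ⟨i + 1, i + 2, fun h => hi ?_⟩
      rcases hp.dirClass_sub hπ i with h2 | h2 <;> rw [h, sub_self] at h2
      · exact h2.symm
      · exact neg_eq_zero.1 h2.symm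
    · intro k i j h
      rw [← dirClass_zpow_mul hπ E.ne_zero hrΦ k (hp.ne_zero i)]
      rcases h with h | h
      · rw [h]
      · rw [h, dirClass_neg hπ (hp.ne_zero j)]
    · intro k i j h
      rw [← dirClass_zpow_mul hπ E.ne_zero hrΦ k (hp.ne_zero i)]
      have hmj : dirClass Φ (m j) = dirClass Φ ω - dirClass Φ (n j) := by
        rw [hm, dirClass_mul hπ hω (hconj j), dirClass_conj hπ, sub_eq_add_neg]
      rcases h with h | h
      · rw [h, hmj, sub_add_cancel]
      · rw [h, dirClass_neg hπ (hp'.ne_zero j), hmj, sub_add_cancel]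

/-! ### Pieces, areas and the reduction to one moving piece -/

/-- A compact set with polygonal boundary. -/
def IsPiece (P : Set ℂ) : Prop := IsCompact P ∧ ∃ L, FrontierIn P L

lemma isPiece_empty : IsPiece ∅ :=
  ⟨isCompact_empty, ∅, by simp, by simp⟩

lemma exists_line (a b : ℂ) : ∃ l : ℂ × ℝ, l.1 ≠ 0 ∧ ∀ z ∈ affineSegment ℝ a b,
    dot l.1 z = l.2 := by
  by_cases h : a = b
  · refine ⟨(1, dot 1 a), one_ne_zero, fun z hz => ?_⟩
    rw [h, affineSegment_same] at hz
    rw [Set.mem_singleton_iff.1 hz, h]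
  · refine ⟨(Complex.I * (b - a), dot (Complex.I * (b - a)) a),
      mul_ne_zero Complex.I_ne_zero (sub_ne_zero.2 (Ne.symm h)), fun z hz => ?_⟩
    obtain ⟨t, -, rfl⟩ := hz
    rw [AffineMap.lineMap_apply, vsub_eq_sub, vadd_eq_add, Complex.real_smul, dot_add_right,
      dot_ofReal_mul_right, dot_comm _ (b - a), IsNormals.dot_I_mul_self, mul_zero, zero_add]

lemma IsPolygon.isPiece {P : Set ℂ} (h : IsPolygon P) : IsPiece P := by
  classical
  obtain ⟨hc, -, n, v, -, hv⟩ := h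
  choose l hl0 hl using fun i => exists_line (v i) (v (finRotate n i))
  refine ⟨hc, Finset.univ.image l, ?_, ?_⟩
  · simpa using hl0
  · intro z hz
    rw [hv] at hz
    obtain ⟨i, hi⟩ := Set.mem_iUnion.1 hz
    exact ⟨l i, Finset.mem_image_of_mem _ (Finset.mem_univ i), hl i z hi⟩

lemma volume_line {w : ℂ} (hw : w ≠ 0) (c : ℝ) : volume {z | dot w z = c} = 0 := by
  let f : ℂ →ₗ[ℝ] ℝ :=
    { toFun := dot w
      map_add' := dot_add_right w
      map_smul' := fun t z => by
        rw [Complex.real_smul, dot_ofReal_mul_right, RingHom.id_apply, smul_eq_mul] }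
  have hww : dot w w ≠ 0 := by
    rw [dot_self]; exact pow_ne_zero 2 (norm_ne_zero_iff.2 hw)
  have h1 : (LinearMap.ker f : Set ℂ) = {z | dot w z = 0} := rfl
  have h2 : volume {z | dot w z = 0} = 0 := by
    rw [← h1]
    refine Measure.addHaar_submodule _ _ fun h => hww ?_
    have : w ∈ LinearMap.ker f := by rw [h]; trivial
    exact this
  have h3 : {z | dot w z = c} = (fun z => z + -((c / dot w w : ℝ) * w)) ⁻¹' {z | dot w z = 0} := by
    ext z
    simp only [Set.mem_ofPred_eq, Set.mem_preimage, dot_add_right, dot_neg_right,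
      dot_ofReal_mul_right, div_mul_cancel₀ _ hww]
    rw [add_neg_eq_zero]
  rw [h3, measure_preimage_add_right, h2]

lemma IsPiece.volume_frontier {P : Set ℂ} (h : IsPiece P) : volume (frontier P) = 0 := by
  obtain ⟨-, L, hL0, hL⟩ := h
  have hsub : frontier P ⊆ ⋃ l ∈ L, {z | dot l.1 z = l.2} := fun z hz => by
    obtain ⟨l, hl, h⟩ := hL z hz
    exact Set.mem_biUnion hl h
  refine measure_mono_null hsub ?_
  refine (measure_biUnion_null_iff L.countable_toSet).2 ?_
  exact fun l hl => volume_line (hL0 l hl) _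

lemma NonOverlapping.volume_union {P Q : Set ℂ} (h : NonOverlapping P Q) (hP : IsPiece P)
    (hQ : IsPiece Q) : volume (P ∪ Q) = volume P + volume Q := by
  refine measure_union₀ hQ.1.measurableSet.nullMeasurableSet ?_
  refine measure_mono_null (t := frontier P ∪ frontier Q) ?_
    (measure_union_null hP.volume_frontier hQ.volume_frontier)
  intro z hz
  by_contra h'
  simp only [Set.mem_union, not_or] at h'
  have hzP : z ∈ interior P := by
    by_contra hi
    exact h'.1 ⟨subset_closure hz.1, hi⟩
  have hzQ : z ∈ interior Q := by
    by_contra hi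
    exact h'.2 ⟨subset_closure hz.2, hi⟩
  exact Set.disjoint_left.1 (show Disjoint (interior P) (interior Q) from h) hzP hzQ

lemma IsPiece.interior_or {P : Set ℂ} (h : IsPiece P) (x : ℂ) {u e : ℂ} (hu : u ≠ 0)
    (he : e = u ∨ e = -u) :
    interior P ∈ flag x (Complex.I * u) e ∨ Pᶜ ∈ flag x (Complex.I * u) e := by
  obtain ⟨hc, L, hL⟩ := h
  have := hL.interior_or_flag x hu he
  rwa [hc.isClosed.closure_eq] at this

/-- A flag lies in the interior or in the complement of each piece, never on a frontier; disjoint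
interiors then make the indicators add. -/
lemma NonOverlapping.val_union {P Q : Set ℂ} (h : NonOverlapping P Q) (hP : IsPiece P)
    (hQ : IsPiece Q) (x : ℂ) {u e : ℂ} (hu : u ≠ 0) (he : e = u ∨ e = -u) :
    val (flag x (Complex.I * u) e) (P ∪ Q) =
      val (flag x (Complex.I * u) e) P + val (flag x (Complex.I * u) e) Q := by
  rcases hP.interior_or x hu he with h1 | h1 <;> rcases hQ.interior_or x hu he with h2 | h2
  · exfalso
    obtain ⟨z, hz⟩ := (flag_neBot _ _ _).nonempty_of_mem (inter_mem h1 h2)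
    exact Set.disjoint_left.1 h hz.1 hz.2
  · rw [val_of_mem (mem_of_superset h1 (interior_subset.trans Set.subset_union_left)),
      val_of_mem (mem_of_superset h1 interior_subset),
      val_of_notMem (notMem_of_compl_mem h2 subset_rfl), add_zero]
  · rw [val_of_mem (mem_of_superset h2 (interior_subset.trans Set.subset_union_right)),
      val_of_mem (mem_of_superset h2 interior_subset),
      val_of_notMem (notMem_of_compl_mem h1 subset_rfl), zero_add]
  · rw [val_of_notMem (notMem_of_compl_mem h1 subset_rfl),
      val_of_notMem (notMem_of_compl_mem h2 subset_rfl), val_of_notMem, add_zero]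
    refine notMem_of_compl_mem (A := P ∪ Q) ?_ subset_rfl
    rw [Set.compl_union]
    exact inter_mem h1 h2

lemma NonOverlapping.jump_union {P Q : Set ℂ} (h : NonOverlapping P Q) (hP : IsPiece P)
    (hQ : IsPiece Q) (x : ℂ) {u : ℂ} (hu : u ≠ 0) :
    jump (P ∪ Q) x u = jump P x u + jump Q x u := by
  rw [jump, h.val_union hP hQ x hu (.inl rfl), h.val_union hP hQ x hu (.inr rfl), jump, jump]
  ring

/-- Two closed sets of the same area, one of them contained in the closure of the interior of the
other, have the same germs. -/
lemma jump_eq_of_volume_eq {A B : Set ℂ} (hA : IsCompact A) (hAB : A ⊆ B)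
    (hB : B ⊆ closure (interior B)) (hvol : volume B ≤ volume A) (x u : ℂ) :
    jump A x u = jump B x u := by
  have heq : B = A := by
    refine (Set.Subset.antisymm hAB fun z hz => ?_).symm
    by_contra hzA
    have h1 : (interior B ∩ Aᶜ).Nonempty := by
      obtain ⟨y, hy, hy'⟩ := mem_closure_iff.1 (hB hz) Aᶜ hA.isClosed.isOpen_compl hzA
      exact ⟨y, hy', hy⟩
    have h2 := (isOpen_interior.inter hA.isClosed.isOpen_compl).measure_pos volume h1
    have h3 : volume A + volume (interior B ∩ Aᶜ) ≤ volume A := by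
      rw [← measure_union (Set.disjoint_left.2 fun y hy hy' => hy'.2 hy)
        (isOpen_interior.inter hA.isClosed.isOpen_compl).measurableSet]
      exact (measure_mono (Set.union_subset hAB
        (Set.inter_subset_left.trans interior_subset))).trans hvol
    have h4 := ENNReal.add_lt_add_left (hA.measure_lt_top (μ := volume)).ne h2
    rw [add_zero] at h4
    exact absurd h3 (not_le.2 h4)
  rw [heq]

lemma IsPiece.volume_image {P : Set ℂ} (hP : IsCompact P) {f : ℂ → ℂ} (hf : Continuous f)
    (hinj : Function.Injective f) (hm : MeasurePreserving f) : volume (f '' P) = volume P := by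
  rw [← hm.measure_preimage (hP.image hf).measurableSet.nullMeasurableSet,
    Set.preimage_image_eq _ hinj]

lemma measurePreserving_motion {r : ℂ} (hr : ‖r‖ = 1) (b : ℂ) :
    MeasurePreserving fun z => r * z + b :=
  (measurePreserving_add_right volume b).comp
    (rotation ⟨r, by simpa [Submonoid.unitSphere] using hr⟩).measurePreserving

lemma measurePreserving_antiMotion {r : ℂ} (hr : ‖r‖ = 1) (b : ℂ) :
    MeasurePreserving fun z => r * starRingEnd ℂ z + b :=
  (measurePreserving_motion hr b).comp Complex.conjLIE.measurePreserving

/-- A motion of the plane as a homeomorphism. -/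
noncomputable def motionHomeo (r b : ℂ) (hr : r ≠ 0) : ℂ ≃ₜ ℂ :=
  (Homeomorph.mulLeft₀ r hr).trans (Homeomorph.addRight b)

lemma motionHomeo_apply (r b : ℂ) (hr : r ≠ 0) (z : ℂ) : motionHomeo r b hr z = r * z + b := rfl

lemma coe_motionHomeo (r b : ℂ) (hr : r ≠ 0) : ⇑(motionHomeo r b hr) = fun z => r * z + b := rfl

lemma NonOverlapping.image {P Q : Set ℂ} (h : NonOverlapping P Q) (f : ℂ ≃ₜ ℂ) :
    NonOverlapping (f '' P) (f '' Q) := by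
  rw [NonOverlapping, ← f.image_interior, ← f.image_interior]
  exact Set.disjoint_image_of_injective f.injective h

lemma dot_mul_left {r : ℂ} (hr : ‖r‖ = 1) (w z : ℂ) : dot (r * w) (r * z) = dot w z := by
  have hr' : r.re * r.re + r.im * r.im = 1 := by
    rw [← Complex.normSq_apply, ← Complex.sq_norm, hr, one_pow]
  simp only [dot, Complex.mul_re, Complex.mul_im]
  linear_combination (w.re * z.re + w.im * z.im) * hr'

lemma IsPiece.image_motion {P : Set ℂ} (hP : IsPiece P) {r : ℂ} (hr : ‖r‖ = 1) (b : ℂ) :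
    IsPiece ((fun z => r * z + b) '' P) := by
  classical
  obtain ⟨hc, L, hL0, hL⟩ := hP
  have hr0 : r ≠ 0 := by rw [← norm_ne_zero_iff, hr]; exact one_ne_zero
  refine ⟨hc.image (by fun_prop), L.image fun l => (r * l.1, l.2 + dot (r * l.1) b), ?_, ?_⟩
  · simp only [Finset.mem_image, forall_exists_index, and_imp]
    rintro _ l hl rfl
    exact mul_ne_zero hr0 (hL0 l hl)
  · intro z hz
    rw [← coe_motionHomeo r b hr0, ← Homeomorph.image_frontier] at hz
    obtain ⟨y, hy, rfl⟩ := hz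
    obtain ⟨l, hl, h⟩ := hL y hy
    exact ⟨_, Finset.mem_image_of_mem _ hl, by
      rw [motionHomeo_apply, dot_add_right, dot_mul_left hr, h]⟩

/-- Cutting `T` into `P` and `Q` and moving `Q` alone to fill `B` is an exchange. -/
theorem exchange_of_cutting {T B P Q : Set ℂ} {r b : ℂ} (hr : ‖r‖ = 1) (hP : IsPiece P)
    (hQ : IsPiece Q) (hT : P ∪ Q = T) (hPQ : NonOverlapping P Q)
    (hPB : P ⊆ B) (hQB : (fun z => r * z + b) '' Q ⊆ B)
    (hPQB : NonOverlapping P ((fun z => r * z + b) '' Q)) (hvol : volume B = volume T)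
    (hB : B ⊆ closure (interior B)) : Exchange T B Q r b := by
  have hr0 : r ≠ 0 := by rw [← norm_ne_zero_iff, hr]; exact one_ne_zero
  have hQ' := hQ.image_motion hr b
  refine ⟨hr, hQ.1.isBounded, hQ.2, fun x u hu => ?_⟩
  have hu0 : u ≠ 0 := by rw [← norm_ne_zero_iff, hu]; exact one_ne_zero
  have hru0 : r * u ≠ 0 := mul_ne_zero hr0 hu0
  -- Frontiers are null and motions preserve area, so the packed pieces have the full area of `B`
  -- and leave no gap.
  have hvol' : volume B ≤ volume (P ∪ (fun z => r * z + b) '' Q) := by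
    rw [hvol, ← hT, hPQ.volume_union hP hQ, hPQB.volume_union hP hQ',
      IsPiece.volume_image hQ.1 (f := fun z => r * z + b) (by fun_prop)
        (motionHomeo r b hr0).injective (measurePreserving_motion hr b)]
  rw [← jump_eq_of_volume_eq (hP.1.union hQ'.1) (Set.union_subset hPB hQB) hB hvol',
    hPQB.jump_union hP hQ' _ hru0, ← hT, hPQ.jump_union hP hQ _ hru0, jump_image hr0]
  ring

lemma reflection_line_apply {p q : ℂ} (hpq : p ≠ q) (z : ℂ) :
    EuclideanGeometry.reflection line[ℝ, p, q] z =
      (q - p) / starRingEnd ℂ (q - p) * starRingEnd ℂ (z - p) + p := by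
  set d := q - p with hd
  have hd0 : d ≠ 0 := sub_ne_zero.2 hpq.symm
  have hdd : dot d d ≠ 0 := by
    rw [dot_self]; exact pow_ne_zero 2 (norm_ne_zero_iff.2 hd0)
  -- `p + t * d` is the foot of the perpendicular from `z` to the line.
  set t : ℝ := dot d (z - p) / dot d d with ht
  have hw : p + t * d ∈ line[ℝ, p, q] := by
    have := AffineMap.lineMap_mem_affineSpan_pair t p q
    rwa [AffineMap.lineMap_apply, vsub_eq_sub, vadd_eq_add, Complex.real_smul, ← hd,
      add_comm] at this
  have hv : z - (p + t * d) ∈ (line[ℝ, p, q]).directionᗮ := by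
    rw [direction_affineSpan, vectorSpan_pair_rev, Submodule.mem_orthogonal_singleton_iff_inner_right,
      vsub_eq_sub, ← hd, IsNormals.inner_eq_dot]
    have : z - (p + t * d) = (z - p) - t * d := by ring
    rw [this, dot_sub_right, dot_ofReal_mul_right, ht, div_mul_cancel₀ _ hdd, sub_self]
  have h := EuclideanGeometry.reflection_orthogonal_vadd hw hv
  rw [vadd_eq_add, vadd_eq_add, sub_add_cancel] at h
  rw [h]
  have hc0 : starRingEnd ℂ d ≠ 0 := (map_ne_zero _).2 hd0
  have ht' : (t : ℂ) * (2 * (d * starRingEnd ℂ d)) =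
      starRingEnd ℂ d * (z - p) + d * starRingEnd ℂ (z - p) := by
    have h1 : d * starRingEnd ℂ d = (dot d d : ℝ) := by
      rw [Complex.mul_conj, Complex.normSq_apply, dot]
    have h2 : starRingEnd ℂ d * (z - p) + d * starRingEnd ℂ (z - p) = ((2 * dot d (z - p) : ℝ) : ℂ) := by
      apply Complex.ext
      · simp [dot]; ring
      · simp; ring
    rw [h1, h2, ht]
    have : (dot d d : ℂ) ≠ 0 := by exact_mod_cast hdd
    push_cast
    field_simp
  field_simp
  linear_combination ht'

lemma IsBox.exists_antiMotion {T : Affine.Triangle ℝ ℂ} {box : Set ℂ} (h : IsBox T box) :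
    ∃ ω τ : ℂ, ‖ω‖ = 1 ∧ box = (fun z => ω * starRingEnd ℂ z + τ) '' T.closedInterior := by
  obtain ⟨p, q, hpq, rfl⟩ := h
  have hd0 : q - p ≠ 0 := sub_ne_zero.2 hpq.symm
  refine ⟨(q - p) / starRingEnd ℂ (q - p),
    p - (q - p) / starRingEnd ℂ (q - p) * starRingEnd ℂ p, ?_, ?_⟩
  · rw [norm_div, Complex.norm_conj, div_self (norm_ne_zero_iff.2 hd0)]
  · refine Set.image_congr fun z _ => ?_
    rw [reflection_line_apply hpq, map_sub (starRingEnd ℂ) z p]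
    ring

lemma dot_conj_conj (w z : ℂ) : dot (starRingEnd ℂ w) (starRingEnd ℂ z) = dot w z := by
  simp [dot]

lemma IsNormals.antiMotion {p n : Fin 3 → ℂ} (h : IsNormals p n) {ω : ℂ} (hω : ‖ω‖ = 1) (τ : ℂ) :
    IsNormals (fun i => ω * starRingEnd ℂ (p i) + τ) (fun i => ω * starRingEnd ℂ (n i)) where
  norm i := by rw [norm_mul, hω, Complex.norm_conj, h.norm, one_mul]
  ortho i := by
    simp only [dot_add_right, dot_mul_left hω, dot_conj_conj, h.ortho]
  neg i := by
    simp only [dot_add_right, dot_mul_left hω, dot_conj_conj]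
    linarith [h.neg i]

lemma image_antiMotion_convexHull (p : Fin 3 → ℂ) (ω τ : ℂ) :
    (fun z => ω * starRingEnd ℂ z + τ) '' convexHull ℝ (Set.range p) =
      convexHull ℝ (Set.range fun i => ω * starRingEnd ℂ (p i) + τ) := by
  let f : ℂ →ᵃ[ℝ] ℂ := ((LinearMap.mulLeft ℝ ω).comp
    Complex.conjAe.toLinearMap).toAffineMap + AffineMap.const ℝ ℂ τ
  have hf : ⇑f = fun z => ω * starRingEnd ℂ z + τ := rfl
  rw [← hf, AffineMap.image_convexHull, ← Set.range_comp]
  rfl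

lemma IsNormals.subset_closure_interior {p n : Fin 3 → ℂ} (h : IsNormals p n) :
    convexHull ℝ (Set.range p) ⊆ closure (interior (convexHull ℝ (Set.range p))) := by
  have hne : (interior (convexHull ℝ (Set.range p))).Nonempty := by
    refine ⟨((1 / 3 : ℝ) : ℂ) * ∑ i, p i, ?_⟩
    have hopen : IsOpen {z | ∀ i, dot (n i) z < dot (n i) (p (i + 1))} := by
      rw [Set.ofPred_forall]
      exact isOpen_iInter_of_finite fun i => isOpen_lt (continuous_dot _) continuous_const
    refine interior_maximal (fun z hz => ?_) hopen ?_
    · exact h.mem_convexHull_iff.2 fun i => (hz i).le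
    · intro i
      rw [dot_ofReal_mul_right, sum_fin_three_cyclic _ i, dot_add_right, dot_add_right, h.ortho]
      linarith [h.neg i]
  rw [(convex_convexHull ℝ _).closure_interior_eq_closure_of_nonempty_interior hne]
  exact subset_closure

/-- A normalized quarter turn of each side, up to sign, points outward; affine independence rules
out the case where the sign is undetermined. -/
lemma exists_isNormals {p : Fin 3 → ℂ} (hp : AffineIndependent ℝ p) : ∃ n, IsNormals p n := by
  have key : ∀ i, ∃ n : ℂ, ‖n‖ = 1 ∧ dot n (p (i + 2)) = dot n (p (i + 1)) ∧
      dot n (p i) < dot n (p (i + 1)) := by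
    intro i
    have hd0 : p (i + 2) - p (i + 1) ≠ 0 :=
      sub_ne_zero.2 (hp.injective.ne (add_one_ne_add_two i).symm)
    have hN : ‖p (i + 2) - p (i + 1)‖ ≠ 0 := norm_ne_zero_iff.2 hd0
    set v : ℂ := ((‖p (i + 2) - p (i + 1)‖⁻¹ : ℝ) : ℂ) * (Complex.I * (p (i + 2) - p (i + 1)))
      with hv
    have hv1 : ‖v‖ = 1 := by
      rw [hv, norm_mul, norm_mul, Complex.norm_I, one_mul, Complex.norm_real, norm_inv, norm_norm,
        inv_mul_cancel₀ hN]
    have hvo : dot v (p (i + 2) - p (i + 1)) = 0 := by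
      rw [hv, dot_ofReal_mul_left, dot_comm, IsNormals.dot_I_mul_self, mul_zero]
    have hne : dot v (p i) - dot v (p (i + 1)) ≠ 0 := by
      intro h0
      rw [← dot_sub_right] at h0
      obtain ⟨t, ht⟩ := eq_ofReal_mul_I_mul hv1 h0
      have hmem : p i ∈ line[ℝ, p (i + 1), p (i + 2)] := by
        have := AffineMap.lineMap_mem_affineSpan_pair (-t * ‖p (i + 2) - p (i + 1)‖⁻¹)
          (p (i + 1)) (p (i + 2))
        rw [AffineMap.lineMap_apply, vsub_eq_sub, vadd_eq_add, Complex.real_smul] at this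
        convert this using 1
        rw [← sub_eq_iff_eq_add, ht, hv]
        push_cast
        linear_combination (t : ℂ) * (‖p (i + 2) - p (i + 1)‖ : ℂ)⁻¹ * (p (i + 2) - p (i + 1)) *
          Complex.I_mul_I
      refine hp.notMem_affineSpan_sdiff i Set.univ (affineSpan_mono ℝ ?_ hmem)
      rintro _ (rfl | rfl)
      · exact ⟨i + 1, ⟨trivial, (ne_add_one i).symm⟩, rfl⟩
      · exact ⟨i + 2, ⟨trivial, (ne_add_two i).symm⟩, rfl⟩
    rw [dot_sub_right, sub_eq_zero] at hvo
    rcases lt_or_gt_of_ne hne with h | h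
    · exact ⟨v, hv1, hvo, by linarith⟩
    · refine ⟨-v, by rw [norm_neg, hv1], ?_, ?_⟩
      · rw [dot_neg_left, dot_neg_left, hvo]
      · rw [dot_neg_left, dot_neg_left]; linarith
  choose n h1 h2 h3 using key
  exact ⟨n, h1, h2, h3⟩

/-- A triangle with integrally independent angles cannot be cut into at most two pieces filling
the mirror triangle. -/
theorem false_of_two_pieces {T : Affine.Triangle ℝ ℂ} (hT : T.Scalene)
    (hind : LinearIndependent ℚ fun i => ∠ (T.points (i + 1)) (T.points i) (T.points (i + 2)))
    {ω τ : ℂ} (hω : ‖ω‖ = 1) {P Q : Set ℂ} (hP : IsPiece P) (hQ : IsPiece Q)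
    (hPQ : NonOverlapping P Q) (hu : P ∪ Q = T.closedInterior) {r b : ℂ} (hr : ‖r‖ = 1)
    (hPB : P ⊆ (fun z => ω * starRingEnd ℂ z + τ) '' T.closedInterior)
    (hQB : (fun z => r * z + b) '' Q ⊆ (fun z => ω * starRingEnd ℂ z + τ) '' T.closedInterior)
    (hPQB : NonOverlapping P ((fun z => r * z + b) '' Q)) : False := by
  obtain ⟨n, hn⟩ := exists_isNormals T.independent
  have hω0 : ω ≠ 0 := by rw [← norm_ne_zero_iff, hω]; exact one_ne_zero
  have hvol := IsPiece.volume_image T.isCompact_closedInterior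
    (f := fun z => ω * starRingEnd ℂ z + τ) (by fun_prop)
    (fun y z h => (starRingEnd ℂ).injective (by simpa [hω0] using h)) (measurePreserving_antiMotion hω τ)
  rw [← Affine.Simplex.convexHull_eq_closedInterior] at hu hPB hQB hvol
  rw [image_antiMotion_convexHull] at hPB hQB hvol
  have hm := hn.antiMotion hω τ
  have E := exchange_of_cutting hr hP hQ hu hPQ hPB hQB hPQB hvol hm.subset_closure_interior
  refine E.false_of_independent hn hm hω0 (fun _ => rfl) (fun i j => ?_) (fun i j hij => ?_)
    hind ?_
  · rw [dist_eq_norm, dist_eq_norm, add_sub_add_right_eq_sub, ← mul_sub, ← map_sub, norm_mul, hω,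
      Complex.norm_conj, one_mul]
  · by_contra hne
    obtain ⟨l, hli, hlj⟩ := exists_ne_and_ne i j
    obtain ⟨h1, h2, h3⟩ := Affine.Triangle.scalene_iff_dist_ne_and_dist_ne_and_dist_ne.1 hT
    fin_cases i <;> fin_cases j <;> simp_all [dist_comm]
  · have h := EuclideanGeometry.angle_add_angle_add_angle_eq_pi (p₁ := T.points 0)
      (p₂ := T.points 1) (T.points 2) (T.independent.injective.ne (by decide))
    rw [EuclideanGeometry.angle_comm (T.points 0) (T.points 1),
      EuclideanGeometry.angle_comm (T.points 1) (T.points 2),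
      EuclideanGeometry.angle_comm (T.points 2) (T.points 0)] at h
    rw [Fin.sum_univ_three, ← h, add_rotate]
    rfl

lemma linearIndependent_angles_of_not_dependent {T : Affine.Triangle ℝ ℂ}
    (h : ¬∃ k l m : ℤ, ¬(k = 0 ∧ l = 0 ∧ m = 0) ∧
      (k : ℝ) * angleA T + (l : ℝ) * angleB T + (m : ℝ) * angleC T = 0) :
    LinearIndependent ℚ fun i => ∠ (T.points (i + 1)) (T.points i) (T.points (i + 2)) := by
  refine linearIndependent_of_forall_int fun k l m hklm => ?_
  by_contra hne
  refine h ⟨k, l, m, hne, ?_⟩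
  rw [angleA, angleB, angleC, EuclideanGeometry.angle_comm (T.points 0) (T.points 1)]
  exact hklm

/-- A cake with integrally independent angles cannot be nicely cut into fewer than three pieces. -/
theorem three_le_of_nicelyCuttable {T : Affine.Triangle ℝ ℂ} (hT : T.Scalene) {box : Set ℂ}
    (hbox : IsBox T box) {n : ℕ} (hn : NicelyCuttable T box n)
    (h : ¬∃ k l m : ℤ, ¬(k = 0 ∧ l = 0 ∧ m = 0) ∧
      (k : ℝ) * angleA T + (l : ℝ) * angleB T + (m : ℝ) * angleC T = 0) : 3 ≤ n := by
  have hind := linearIndependent_angles_of_not_dependent h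
  obtain ⟨ω, τ, hω, rfl⟩ := hbox.exists_antiMotion
  obtain ⟨P, ⟨hP, hPP, hPT⟩, g, hg, hgP, hgg⟩ := hn
  choose a b ha hab using hg
  have ha0 : ∀ i, a i ≠ 0 := fun i => by rw [← norm_ne_zero_iff, ha]; exact one_ne_zero
  have hgi : ∀ i, g i = fun z => a i * z + b i := fun i => funext (hab i)
  -- Applying the inverse of `g i` to the whole packing puts piece `i` back in place, and the box
  -- remains an orientation-reversing isometric copy of the cake.
  have hback : ∀ i, (fun z => (a i)⁻¹ * z + -((a i)⁻¹ * b i)) ''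
      ((fun z => ω * starRingEnd ℂ z + τ) '' T.closedInterior) =
      (fun z => ((a i)⁻¹ * ω) * starRingEnd ℂ z + ((a i)⁻¹ * τ - (a i)⁻¹ * b i)) ''
        T.closedInterior := fun i => by
    rw [Set.image_image]
    exact Set.image_congr fun z _ => by ring
  have hback' : ∀ i j, (fun z => (a i)⁻¹ * z + -((a i)⁻¹ * b i)) '' (g j '' P j) =
      (fun z => ((a i)⁻¹ * a j) * z + (a i)⁻¹ * (b j - b i)) '' P j := fun i j => by
    rw [hgi, Set.image_image]
    exact Set.image_congr fun z _ => by ring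
  have hself : ∀ i, (fun z => (a i)⁻¹ * z + -((a i)⁻¹ * b i)) '' (g i '' P i) = P i := fun i => by
    rw [hback', sub_self, inv_mul_cancel₀ (ha0 i)]
    simp
  have hnorm : ∀ i, ‖(a i)⁻¹ * ω‖ = 1 := fun i => by
    rw [norm_mul, norm_inv, ha, hω, inv_one, one_mul]
  by_contra! hlt
  obtain rfl | rfl | rfl : n = 0 ∨ n = 1 ∨ n = 2 := by omega
  · have := T.nonempty_closedInterior
    rw [← hPT, Set.iUnion_of_empty] at this
    exact Set.not_nonempty_empty this
  -- One piece counts as two, the second being empty and moved by the identity.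
  · refine false_of_two_pieces hT hind (hnorm 0)
      (τ := (a 0)⁻¹ * τ - (a 0)⁻¹ * b 0) (hP 0).isPiece isPiece_empty
      (by simp [NonOverlapping]) ?_ (r := 1) (b := 0) (by simp) ?_ (by simp)
      (by simp [NonOverlapping])
    · rw [← hPT, Set.union_empty]
      exact (ciSup_unique (s := P)).symm
    · rw [← hback, ← hself 0]
      exact Set.image_mono (hgP 0)
  · refine false_of_two_pieces hT hind (hnorm 0)
      (τ := (a 0)⁻¹ * τ - (a 0)⁻¹ * b 0) (hP 0).isPiece (hP 1).isPiece
      (hPP (by decide)) ?_ (r := (a 0)⁻¹ * a 1) (b := (a 0)⁻¹ * (b 1 - b 0))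
      (by rw [norm_mul, norm_inv, ha, ha]; norm_num) ?_ ?_ ?_
    · rw [← hPT]
      ext z
      simp [Fin.exists_fin_two]
    · rw [← hback, ← hself 0]
      exact Set.image_mono (hgP 0)
    · rw [← hback, ← hback']
      exact Set.image_mono (hgP 1)
    · rw [← hback', ← hself 0]
      exact (hgg (show (0 : Fin 2) ≠ 1 by decide)).image
        (motionHomeo (a 0)⁻¹ (-((a 0)⁻¹ * b 0)) (inv_ne_zero (ha0 0)))

/-! ### Convex polygons as regions bounded by simple polygonal lines -/

/-- The two-dimensional cross product. -/
def cross (u v : ℂ) : ℝ := u.re * v.im - u.im * v.re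

section ConvexPolygon

/-- Positive on the left of the edge `i` of a polygon. -/
def edgeSide {n : ℕ} (v : Polygon ℂ n) (i : Fin n) (z : ℂ) : ℝ :=
  cross (v (finRotate n i) - v i) (z - v i)

variable {n : ℕ} {v : Polygon ℂ n}

lemma edgeSide_self (i : Fin n) : edgeSide v i (v i) = 0 := by
  simp [edgeSide, cross]

lemma edgeSide_next (i : Fin n) : edgeSide v i (v (finRotate n i)) = 0 := by
  simp [edgeSide, cross]; ring

lemma edgeSide_lineMap (i : Fin n) (x y : ℂ) (t : ℝ) :
    edgeSide v i (AffineMap.lineMap x y t) = (1 - t) * edgeSide v i x + t * edgeSide v i y := by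
  rw [AffineMap.lineMap_apply, vsub_eq_sub, vadd_eq_add, Complex.real_smul]
  simp [edgeSide, cross]
  ring

lemma continuous_edgeSide (i : Fin n) : Continuous (edgeSide v i) := by
  unfold edgeSide cross
  fun_prop

lemma finRotate_ne {n : ℕ} (hn : 3 ≤ n) (i : Fin n) : finRotate n i ≠ i := by
  obtain ⟨m, rfl⟩ : ∃ m, n = m + 3 := ⟨n - 3, by omega⟩
  simp [finRotate_apply]

lemma finRotate_finRotate_ne {n : ℕ} (hn : 3 ≤ n) (i : Fin n) :
    finRotate n (finRotate n i) ≠ i := by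
  obtain ⟨m, rfl⟩ : ∃ m, n = m + 3 := ⟨n - 3, by omega⟩
  rw [finRotate_apply, finRotate_apply, add_assoc, Ne, add_eq_left]
  simp only [Fin.ext_iff, Fin.val_add, Fin.val_one, Fin.val_zero]
  rw [Nat.mod_eq_of_lt (by omega)]
  norm_num

lemma edgeSide_vertex_nonneg (hpos : ∀ i j, j ≠ i → j ≠ finRotate n i → 0 < edgeSide v i (v j))
    (i j : Fin n) : 0 ≤ edgeSide v i (v j) := by
  by_cases h : j = i
  · rw [h, edgeSide_self]
  · by_cases h' : j = finRotate n i
    · rw [h', edgeSide_next]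
    · exact (hpos i j h h').le

lemma mem_edgeSet_iff (hn : 3 ≤ n)
    (hpos : ∀ i j, j ≠ i → j ≠ finRotate n i → 0 < edgeSide v i (v j)) (i : Fin n) (z : ℂ) :
    z ∈ v.edgeSet ℝ i ↔ (∀ j, 0 ≤ edgeSide v j z) ∧ edgeSide v i z = 0 := by
  constructor
  · rintro ⟨t, ⟨ht0, ht1⟩, rfl⟩
    refine ⟨fun j => ?_, ?_⟩
    · rw [edgeSide_lineMap]
      exact add_nonneg (mul_nonneg (sub_nonneg.2 ht1) (edgeSide_vertex_nonneg hpos j _))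
        (mul_nonneg ht0 (edgeSide_vertex_nonneg hpos j _))
    · rw [edgeSide_lineMap, edgeSide_self, edgeSide_next]; ring
  · rintro ⟨hz, hi⟩
    set d := v (finRotate n i) - v i with hd
    have hd0 : d.re * d.re + d.im * d.im ≠ 0 := by
      intro h0
      have h1 : d = 0 := by
        rw [← Complex.normSq_apply] at h0
        exact Complex.normSq_eq_zero.1 h0
      have h2 := hpos i (finRotate n (finRotate n i)) (finRotate_finRotate_ne hn i)
        (finRotate_ne hn _)
      rw [edgeSide, ← hd, h1] at h2
      simp [cross] at h2
    obtain ⟨t, ht⟩ : ∃ t : ℝ, z = AffineMap.lineMap (v i) (v (finRotate n i)) t := by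
      refine ⟨dot d (z - v i) / (d.re * d.re + d.im * d.im), ?_⟩
      rw [AffineMap.lineMap_apply, vsub_eq_sub, vadd_eq_add, Complex.real_smul, ← hd,
        ← sub_eq_iff_eq_add]
      rw [edgeSide, ← hd, cross] at hi
      apply Complex.ext
      · rw [Complex.re_ofReal_mul, dot, div_mul_eq_mul_div, eq_div_iff hd0]
        linear_combination -d.im * hi
      · rw [Complex.im_ofReal_mul, dot, div_mul_eq_mul_div, eq_div_iff hd0]
        linear_combination d.re * hi
    -- On the line of edge `i`, the next and the previous edge cut out exactly the parameters `t ≤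
    -- 1` and `0 ≤ t`.
    have h1 := hz (finRotate n i)
    have h2 := hz ((finRotate n).symm i)
    have p1 := hpos (finRotate n i) i (finRotate_ne hn i).symm (finRotate_finRotate_ne hn i).symm
    have p2 := hpos ((finRotate n).symm i) (finRotate n i)
      (fun h => finRotate_finRotate_ne hn i (by rw [h, Equiv.apply_symm_apply]))
      (by rw [Equiv.apply_symm_apply]; exact finRotate_ne hn i)
    have e2 := edgeSide_next (v := v) ((finRotate n).symm i)
    rw [Equiv.apply_symm_apply] at e2
    rw [ht, edgeSide_lineMap, edgeSide_self] at h1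
    rw [ht, edgeSide_lineMap, e2] at h2
    refine ⟨t, ⟨?_, ?_⟩, ht.symm⟩
    · by_contra! h
      nlinarith
    · by_contra! h
      nlinarith

/-- The region on the left of all edges of a convex polygon. -/
theorem isPolygon_of_convex (hn : 3 ≤ n)
    (hpos : ∀ i j, j ≠ i → j ≠ finRotate n i → 0 < edgeSide v i (v j))
    (hc : IsCompact {z | ∀ i, 0 ≤ edgeSide v i z}) {z₀ : ℂ} (hz₀ : ∀ i, 0 < edgeSide v i z₀) :
    IsPolygon {z | ∀ i, 0 ≤ edgeSide v i z} := by
  have hconv : Convex ℝ {z | ∀ i, 0 ≤ edgeSide v i z} := by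
    rw [convex_iff_segment_subset]
    intro x hx y hy z hz i
    rw [segment_eq_image_lineMap] at hz
    obtain ⟨t, ⟨ht0, ht1⟩, rfl⟩ := hz
    rw [edgeSide_lineMap]
    exact add_nonneg (mul_nonneg (sub_nonneg.2 ht1) (hx i)) (mul_nonneg ht0 (hy i))
  have hopen : IsOpen {z | ∀ i, 0 < edgeSide v i z} := by
    rw [Set.ofPred_forall]
    exact isOpen_iInter_of_finite fun i => isOpen_lt continuous_const (continuous_edgeSide i)
  have hsub : {z | ∀ i, 0 < edgeSide v i z} ⊆ interior {z | ∀ i, 0 ≤ edgeSide v i z} :=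
    interior_maximal (fun z hz i => (hz i).le) hopen
  have hint : ∀ z ∈ interior {z | ∀ i, 0 ≤ edgeSide v i z}, ∀ i, 0 < edgeSide v i z := by
    intro z hz i
    have h0 : 0 ≤ edgeSide v i z := interior_subset hz i
    refine lt_of_le_of_ne h0 fun h => ?_
    -- Moving from `z` slightly away from `z₀` crosses an edge line through `z`, which is impossible
    -- at an interior point.
    have ht : Tendsto (fun t : ℝ => AffineMap.lineMap z z₀ (-t)) (𝓝[>] 0) (𝓝 z) := by
      have : Tendsto (fun t : ℝ => AffineMap.lineMap z z₀ (-t)) (𝓝[>] 0)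
          (𝓝 (AffineMap.lineMap z z₀ (-0 : ℝ))) :=
        (Continuous.tendsto (by
          simp only [AffineMap.lineMap_apply]; fun_prop) 0).mono_left nhdsWithin_le_nhds
      simpa using this
    obtain ⟨t, ht, ht0⟩ := ((ht.eventually (mem_interior_iff_mem_nhds.1 hz)).and
      self_mem_nhdsWithin).exists
    have h1 := ht i
    rw [edgeSide_lineMap, ← h] at h1
    have := mul_pos (Set.mem_Ioi.1 ht0) (hz₀ i)
    linarith
  refine ⟨hc, ?_, n, v, ⟨hn, ?_⟩, ?_⟩
  · rw [hconv.closure_interior_eq_closure_of_nonempty_interior ⟨z₀, hsub hz₀⟩,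
      hc.isClosed.closure_eq]
  · intro i j s hs t ht hst
    have hend : ∀ (i j : Fin n) (s t : ℝ), s ∈ Set.Ico (0 : ℝ) 1 → t ∈ Set.Ico (0 : ℝ) 1 →
        v.edgePath ℝ i s = v.edgePath ℝ j t → i ≠ j → finRotate n j = i := by
      intro i j s t hs ht h hij
      by_contra hne
      have h1 : edgeSide v j (v.edgePath ℝ j t) = 0 := by
        rw [Polygon.edgePath, edgeSide_lineMap, edgeSide_self, edgeSide_next]; ring
      rw [← h, Polygon.edgePath, edgeSide_lineMap] at h1
      have h2 := mul_pos (sub_pos.2 hs.2) (hpos j i hij (Ne.symm hne))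
      have h3 := mul_nonneg hs.1 (edgeSide_vertex_nonneg hpos j (finRotate n i))
      linarith
    by_cases hij : i = j
    · subst hij
      refine ⟨rfl, ?_⟩
      have h1 := congrArg (edgeSide v (finRotate n i)) hst
      rw [Polygon.edgePath, edgeSide_lineMap, edgeSide_lineMap, edgeSide_self] at h1
      have p1 := hpos (finRotate n i) i (finRotate_ne hn i).symm (finRotate_finRotate_ne hn i).symm
      have : (t - s) * edgeSide v (finRotate n i) (v i) = 0 := by linarith
      rcases mul_eq_zero.1 this with h2 | h2
      · linarith
      · exact absurd h2 p1.ne'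
    · exfalso
      have h1 := hend i j s t hs ht hst hij
      have h2 := hend j i t s ht hs hst.symm (Ne.symm hij)
      exact finRotate_finRotate_ne hn j (by rw [h1, h2])
  · ext z
    rw [hc.isClosed.frontier_eq, Polygon.boundary, Set.mem_iUnion]
    simp only [mem_edgeSet_iff hn hpos]
    constructor
    · rintro ⟨hz, hz'⟩
      by_contra! h
      exact hz' (hsub fun i => lt_of_le_of_ne (hz i) (Ne.symm (h i hz)))
    · rintro ⟨i, hz, hi⟩
      exact ⟨hz, fun h => (hint z h i).ne' hi⟩

end ConvexPolygon

/-! ### Kites -/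

lemma cross_add_left (u v w : ℂ) : cross (u + v) w = cross u w + cross v w := by
  simp [cross]; ring

lemma cross_add_right (u v w : ℂ) : cross u (v + w) = cross u v + cross u w := by
  simp [cross]; ring

lemma cross_neg_left (u v : ℂ) : cross (-u) v = -cross u v := by
  simp [cross]; ring

lemma cross_neg_right (u v : ℂ) : cross u (-v) = -cross u v := by
  simp [cross]; ring

lemma cross_swap (u v : ℂ) : cross u v = -cross v u := by
  unfold cross; ring

lemma cross_ofReal_mul_left (u v : ℂ) (t : ℝ) : cross (t * u) v = t * cross u v := by
  simp [cross]; ring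

lemma cross_ofReal_mul_right (u v : ℂ) (t : ℝ) : cross u (t * v) = t * cross u v := by
  simp [cross]; ring

lemma dot_sq_add_cross_sq {p q : ℂ} (hp : ‖p‖ = 1) (hq : ‖q‖ = 1) :
    dot p q ^ 2 + cross p q ^ 2 = 1 := by
  have h1 : p.re * p.re + p.im * p.im = 1 := by
    rw [← Complex.normSq_apply, ← Complex.sq_norm, hp, one_pow]
  have h2 : q.re * q.re + q.im * q.im = 1 := by
    rw [← Complex.normSq_apply, ← Complex.sq_norm, hq, one_pow]
  unfold dot cross
  linear_combination (q.re * q.re + q.im * q.im) * h1 + h2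

/-- The kite with apex `A`, sides in the directions `p` and `q` and opposite vertex `c`, at which
it has right angles with those sides. -/
def kite (A p q c : ℂ) : Set ℂ :=
  {z | 0 ≤ cross p (z - A) ∧ dot p (z - c) ≤ 0 ∧ dot q (z - c) ≤ 0 ∧ 0 ≤ cross (z - A) q}

section Kite

variable {A p q : ℂ} {t κ : ℝ}

/-- The vertices of a kite. -/
def kiteVertices (A p q : ℂ) (t κ : ℝ) : Polygon ℂ 4 :=
  ⟨![A, A + t * p, A + κ * (p + q), A + t * q]⟩

/-- The relation between `κ` and `t` says that the opposite vertex projects onto the foot `A + t *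
p`; this gives the right angle there. -/
lemma kite_perp (hp : ‖p‖ = 1) (hκ : κ * (1 + dot p q) = t) :
    κ * (p + q) - t * p = ((κ * cross p q : ℝ) : ℂ) * (Complex.I * p) := by
  have h1 : p.re * p.re + p.im * p.im = 1 := by
    rw [← Complex.normSq_apply, ← Complex.sq_norm, hp, one_pow]
  rw [← hκ]
  unfold dot cross
  apply Complex.ext
  · simp
    linear_combination -κ * q.re * h1
  · simp
    linear_combination -κ * q.im * h1

lemma edgeSide_kiteVertices (hp : ‖p‖ = 1) (hq : ‖q‖ = 1) (hκ : κ * (1 + dot p q) = t) (z : ℂ) :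
    edgeSide (kiteVertices A p q t κ) 0 z = t * cross p (z - A) ∧
    edgeSide (kiteVertices A p q t κ) 1 z =
      κ * cross p q * -dot p (z - (A + κ * (p + q))) ∧
    edgeSide (kiteVertices A p q t κ) 2 z =
      κ * cross p q * -dot q (z - (A + κ * (p + q))) ∧
    edgeSide (kiteVertices A p q t κ) 3 z = t * cross (z - A) q := by
  have e1 := kite_perp hp hκ
  have hκ' : κ * (1 + dot q p) = t := by rw [dot_comm, hκ]
  have e2 := kite_perp hq hκ'
  rw [cross_swap q p] at e2
  have hs : ∀ i, edgeSide (kiteVertices A p q t κ) i z =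
    cross ((kiteVertices A p q t κ) (i + 1) - (kiteVertices A p q t κ) i)
      (z - (kiteVertices A p q t κ) i) := fun i => by
    rw [edgeSide, finRotate_apply]
  have hI : ∀ u v : ℂ, cross (Complex.I * u) v = -dot u v := fun u v => by
    simp [cross, dot]; ring
  have hII : ∀ u : ℂ, dot u (Complex.I * u) = 0 := IsNormals.dot_I_mul_self
  refine ⟨?_, ?_, ?_, ?_⟩
  · rw [hs]
    change cross (A + t * p - A) (z - A) = _
    rw [add_sub_cancel_left, cross_ofReal_mul_left]
  · rw [hs]
    change cross (A + κ * (p + q) - (A + t * p)) (z - (A + t * p)) = _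
    rw [add_sub_add_left_eq_sub, e1, cross_ofReal_mul_left, hI]
    have : z - (A + t * p) = z - (A + κ * (p + q)) + (κ * (p + q) - t * p) := by ring
    rw [this, dot_add_right, e1, dot_ofReal_mul_right, hII, mul_zero, add_zero]
  · rw [hs]
    change cross (A + t * q - (A + κ * (p + q))) (z - (A + κ * (p + q))) = _
    have : A + t * q - (A + κ * (p + q)) = -(κ * (q + p) - t * q) := by ring
    rw [this, e2, cross_neg_left, cross_ofReal_mul_left, hI]
    ring
  · rw [hs]
    change cross (A - (A + t * q)) (z - (A + t * q)) = _
    have h1 : A - (A + t * q) = ((-t : ℝ) : ℂ) * q := by push_cast; ring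
    have h2 : z - (A + t * q) = (z - A) + ((-t : ℝ) : ℂ) * q := by push_cast; ring
    rw [h1, h2, cross_ofReal_mul_left, cross_add_right, cross_ofReal_mul_right,
      cross_swap q (z - A)]
    have : cross q q = 0 := by simp [cross]; ring
    rw [this]; ring

lemma one_add_dot_pos (hp : ‖p‖ = 1) (hq : ‖q‖ = 1) (hs : 0 < cross p q) :
    0 < 1 + dot p q ∧ dot p q < 1 := by
  have h := dot_sq_add_cross_sq hp hq
  have := pow_pos hs 2
  have h1 : dot p q ^ 2 < 1 := by linarith
  have h2 := abs_lt.1 ((sq_lt_one_iff_abs_lt_one _).1 h1)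
  exact ⟨by linarith [h2.1], h2.2⟩

lemma setOf_edgeSide_kiteVertices (hp : ‖p‖ = 1) (hq : ‖q‖ = 1) (hs : 0 < cross p q) (ht : 0 < t)
    (hκ0 : 0 < κ) (hκ : κ * (1 + dot p q) = t) :
    {z | ∀ i, 0 ≤ edgeSide (kiteVertices A p q t κ) i z} = kite A p q (A + κ * (p + q)) := by
  ext z
  obtain ⟨h0, h1, h2, h3⟩ := edgeSide_kiteVertices (A := A) hp hq hκ z
  have hks : 0 < κ * cross p q := mul_pos hκ0 hs
  have : (∀ i, 0 ≤ edgeSide (kiteVertices A p q t κ) i z) ↔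
      0 ≤ edgeSide (kiteVertices A p q t κ) 0 z ∧ 0 ≤ edgeSide (kiteVertices A p q t κ) 1 z ∧
      0 ≤ edgeSide (kiteVertices A p q t κ) 2 z ∧ 0 ≤ edgeSide (kiteVertices A p q t κ) 3 z := by
    rw [Fin.forall_fin_succ, Fin.forall_fin_succ, Fin.forall_fin_succ, Fin.forall_fin_succ]
    simp only [IsEmpty.forall_iff, and_true]
    rfl
  rw [Set.mem_ofPred_eq, this, h0, h1, h2, h3, mul_nonneg_iff_of_pos_left ht,
    mul_nonneg_iff_of_pos_left hks, mul_nonneg_iff_of_pos_left hks, mul_nonneg_iff_of_pos_left ht,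
    neg_nonneg, neg_nonneg]
  rfl

/-- The axis splits the kite into two triangles. In oblique coordinates along `p` and `q`, the
larger coordinate tells which triangle contains the point. -/
lemma kite_subset_convexHull (hp : ‖p‖ = 1) (hq : ‖q‖ = 1) (hs : 0 < cross p q) (ht : 0 < t)
    (hκ0 : 0 < κ) (hκ : κ * (1 + dot p q) = t) {S : Set ℂ} (hS : Convex ℝ S) (h0 : A ∈ S)
    (h1 : A + t * p ∈ S) (h2 : A + κ * (p + q) ∈ S) (h3 : A + t * q ∈ S) :
    kite A p q (A + κ * (p + q)) ⊆ S := by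
  rintro z ⟨hz0, hz1, hz2, hz3⟩
  have comb : ∀ {B C : ℂ}, B ∈ S → C ∈ S → ∀ {x y : ℝ}, 0 ≤ x → 0 ≤ y → x + y ≤ 1 →
      A + x * (B - A) + y * (C - A) ∈ S := by
    intro B C hB hC x y hx hy hxy
    have := hS.sum_mem (t := Finset.univ) (w := ![1 - x - y, x, y]) (z := ![A, B, C])
      (by
        intro i _
        fin_cases i
        · change 0 ≤ 1 - x - y; linarith
        · exact hx
        · exact hy)
      (by simp only [Fin.sum_univ_three, Matrix.cons_val]; ring)
      (by
        intro i _
        fin_cases i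
        · exact h0
        · exact hB
        · exact hC)
    simp only [Fin.sum_univ_three, Matrix.cons_val, Complex.real_smul] at this
    convert this using 1
    push_cast
    ring
  have hs' := hs.ne'
  set x := cross (z - A) q / cross p q with hx
  set y := cross p (z - A) / cross p q with hy
  have hx0 : 0 ≤ x := div_nonneg hz3 hs.le
  have hy0 : 0 ≤ y := div_nonneg hz0 hs.le
  have hz : z = A + x * p + y * q := by
    have e1 : x * cross p q = cross (z - A) q := div_mul_cancel₀ _ hs'
    have e2 : y * cross p q = cross p (z - A) := div_mul_cancel₀ _ hs'
    unfold cross at e1 e2 hs'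
    simp only [Complex.sub_re, Complex.sub_im] at e1 e2
    apply Complex.ext
    · apply mul_right_cancel₀ hs'
      simp only [Complex.add_re, Complex.re_ofReal_mul]
      linear_combination -p.re * e1 - q.re * e2
    · apply mul_right_cancel₀ hs'
      simp only [Complex.add_im, Complex.im_ofReal_mul]
      linear_combination -p.im * e1 - q.im * e2
  have hpp : dot p p = 1 := by rw [dot_self, hp, one_pow]
  have hqq : dot q q = 1 := by rw [dot_self, hq, one_pow]
  have f1 : x + y * dot p q ≤ t := by
    have e : z - (A + κ * (p + q)) = x * p + y * q - κ * (p + q) := by rw [hz]; ring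
    rw [e, dot_sub_right, dot_add_right, dot_ofReal_mul_right, dot_ofReal_mul_right,
      dot_ofReal_mul_right, dot_add_right, hpp] at hz1
    linarith
  have f2 : y + x * dot p q ≤ t := by
    have e : z - (A + κ * (p + q)) = x * p + y * q - κ * (p + q) := by rw [hz]; ring
    rw [e, dot_sub_right, dot_add_right, dot_ofReal_mul_right, dot_ofReal_mul_right,
      dot_ofReal_mul_right, dot_add_right, hqq, dot_comm q p] at hz2
    linarith
  have hκt : κ⁻¹ = (1 + dot p q) / t := by
    rw [← hκ]
    have := (one_add_dot_pos hp hq hs).1.ne'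
    field_simp
  rcases le_total y x with hxy | hxy
  · have := comb h2 h1 (x := y / κ) (y := (x - y) / t) (by positivity)
      (div_nonneg (sub_nonneg.2 hxy) ht.le) (by
        rw [div_eq_mul_inv, hκt, mul_div_assoc', ← add_div, div_le_one ht]
        linarith)
    convert this using 1
    rw [hz]
    have : (κ : ℂ) ≠ 0 := by exact_mod_cast hκ0.ne'
    have : (t : ℂ) ≠ 0 := by exact_mod_cast ht.ne'
    push_cast
    field_simp
    ring
  · have := comb h2 h3 (x := x / κ) (y := (y - x) / t) (by positivity)
      (div_nonneg (sub_nonneg.2 hxy) ht.le) (by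
        rw [div_eq_mul_inv, hκt, mul_div_assoc', ← add_div, div_le_one ht]
        linarith)
    convert this using 1
    rw [hz]
    have : (κ : ℂ) ≠ 0 := by exact_mod_cast hκ0.ne'
    have : (t : ℂ) ≠ 0 := by exact_mod_cast ht.ne'
    push_cast
    field_simp
    ring

lemma isClosed_kite (A p q c : ℂ) : IsClosed (kite A p q c) := by
  have hc : Continuous fun z => cross p (z - A) := by unfold cross; fun_prop
  have hc' : Continuous fun z => cross (z - A) q := by unfold cross; fun_prop
  have hd : ∀ u : ℂ, Continuous fun z => dot u (z - c) := fun u => by unfold dot; fun_prop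
  exact (isClosed_le continuous_const hc).inter ((isClosed_le (hd p) continuous_const).inter
    ((isClosed_le (hd q) continuous_const).inter (isClosed_le continuous_const hc')))

lemma isPolygon_kite (hp : ‖p‖ = 1) (hq : ‖q‖ = 1) (hs : 0 < cross p q) (ht : 0 < t)
    (hκ0 : 0 < κ) (hκ : κ * (1 + dot p q) = t) :
    IsPolygon (kite A p q (A + κ * (p + q))) := by
  have hset := setOf_edgeSide_kiteVertices (A := A) hp hq hs ht hκ0 hκ
  have hD := one_add_dot_pos hp hq hs
  have hpp : dot p p = 1 := by rw [dot_self, hp, one_pow]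
  have hqq : dot q q = 1 := by rw [dot_self, hq, one_pow]
  have cpp : ∀ u : ℂ, cross u u = 0 := fun u => by simp [cross]; ring
  have hks : 0 < κ * cross p q := mul_pos hκ0 hs
  have h2κ : 0 < 2 * κ - t := by nlinarith [hD.2]
  have hcompact : IsCompact (kite A p q (A + κ * (p + q))) := by
    refine IsCompact.of_isClosed_subset (s := convexHull ℝ {A, A + t * p, A + κ * (p + q), A + t * q})
      (((((Set.finite_singleton _).insert _).insert _).insert _).isCompact_convexHull ℝ)
      (isClosed_kite _ _ _ _)
      (kite_subset_convexHull hp hq hs ht hκ0 hκ (convex_convexHull ℝ _) ?_ ?_ ?_ ?_)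
    all_goals exact subset_convexHull ℝ _ (by simp)
  have hside : ∀ (i) (x y : ℝ), edgeSide (kiteVertices A p q t κ) i (A + x * p + y * q) =
      ![t * (y * cross p q), κ * cross p q * (t - x - y * dot p q),
        κ * cross p q * (t - y - x * dot p q), t * (x * cross p q)] i := by
    intro i x y
    obtain ⟨h0, h1, h2, h3⟩ := edgeSide_kiteVertices (A := A) hp hq hκ (A + x * p + y * q)
    have e0 : A + x * p + y * q - A = x * p + y * q := by ring
    have e1 : A + x * p + y * q - (A + κ * (p + q)) = x * p + y * q - κ * (p + q) := by ring
    simp only [e0, e1, cross_add_left, cross_add_right, cross_ofReal_mul_left,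
      cross_ofReal_mul_right, cpp, dot_sub_right, dot_add_right, dot_ofReal_mul_right, hpp, hqq,
      dot_comm q p] at h0 h1 h2 h3
    fin_cases i
    · change edgeSide (kiteVertices A p q t κ) 0 (A + x * p + y * q) = t * (y * cross p q)
      rw [h0]; ring
    · change edgeSide (kiteVertices A p q t κ) 1 (A + x * p + y * q) =
        κ * cross p q * (t - x - y * dot p q)
      rw [h1, ← hκ]; ring
    · change edgeSide (kiteVertices A p q t κ) 2 (A + x * p + y * q) =
        κ * cross p q * (t - y - x * dot p q)
      rw [h2, ← hκ]; ring
    · change edgeSide (kiteVertices A p q t κ) 3 (A + x * p + y * q) = t * (x * cross p q)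
      rw [h3]; ring
  have v0 : kiteVertices A p q t κ 0 = A + (0 : ℝ) * p + (0 : ℝ) * q := by
    change A = _; simp
  have v1 : kiteVertices A p q t κ 1 = A + (t : ℝ) * p + (0 : ℝ) * q := by
    change A + t * p = _; simp
  have v2 : kiteVertices A p q t κ 2 = A + (κ : ℝ) * p + (κ : ℝ) * q := by
    change A + κ * (p + q) = _; ring
  have v3 : kiteVertices A p q t κ 3 = A + (0 : ℝ) * p + (t : ℝ) * q := by
    change A + t * q = _; simp
  have hDt : 0 < t - t * dot p q := by nlinarith [hD.2]
  rw [← hset] at hcompact ⊢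
  -- The interior point chosen is the midpoint of the axis, halfway from the apex to the opposite
  -- vertex.
  refine isPolygon_of_convex (by norm_num) ?_ hcompact
    (z₀ := A + (κ / 2 : ℝ) * p + (κ / 2 : ℝ) * q) ?_
  · have hr : ∀ i : Fin 4, finRotate 4 i = i + 1 := fun i => finRotate_apply i
    intro i j
    rw [hr]
    have c1 : 0 < t * (t * cross p q) := by positivity
    have c2 : 0 < t * (κ * cross p q) := by positivity
    have c3 : 0 < κ * cross p q * t := by positivity
    have c4 : 0 < κ * cross p q * (t - t * dot p q) := by positivity
    fin_cases i <;> fin_cases j <;> intro h1 h2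
    all_goals first
      | exact absurd rfl h1
      | exact absurd rfl h2
      | skip
    · change 0 < edgeSide (kiteVertices A p q t κ) 0 (kiteVertices A p q t κ 2)
      rw [v2, hside]; exact c2
    · change 0 < edgeSide (kiteVertices A p q t κ) 0 (kiteVertices A p q t κ 3)
      rw [v3, hside]; exact c1
    · change 0 < edgeSide (kiteVertices A p q t κ) 1 (kiteVertices A p q t κ 0)
      rw [v0, hside]
      change 0 < κ * cross p q * (t - 0 - 0 * dot p q)
      rw [zero_mul, sub_zero, sub_zero]; exact c3
    · change 0 < edgeSide (kiteVertices A p q t κ) 1 (kiteVertices A p q t κ 3)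
      rw [v3, hside]
      change 0 < κ * cross p q * (t - 0 - t * dot p q)
      rw [sub_zero]; exact c4
    · change 0 < edgeSide (kiteVertices A p q t κ) 2 (kiteVertices A p q t κ 0)
      rw [v0, hside]
      change 0 < κ * cross p q * (t - 0 - 0 * dot p q)
      rw [zero_mul, sub_zero, sub_zero]; exact c3
    · change 0 < edgeSide (kiteVertices A p q t κ) 2 (kiteVertices A p q t κ 1)
      rw [v1, hside]
      change 0 < κ * cross p q * (t - 0 - t * dot p q)
      rw [sub_zero]; exact c4
    · change 0 < edgeSide (kiteVertices A p q t κ) 3 (kiteVertices A p q t κ 1)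
      rw [v1, hside]; exact c1
    · change 0 < edgeSide (kiteVertices A p q t κ) 3 (kiteVertices A p q t κ 2)
      rw [v2, hside]; exact c2
  · intro i
    rw [hside]
    have c1 : 0 < t * (κ / 2 * cross p q) := by positivity
    have c2 : 0 < κ * cross p q * (t - κ / 2 - κ / 2 * dot p q) := by
      refine mul_pos hks ?_
      rw [← hκ]
      nlinarith [mul_pos hκ0 hD.1]
    fin_cases i
    · exact c1
    · exact c2
    · exact c2
    · exact c1

/-- A kite is symmetric about its axis. -/
lemma image_kite (hp : ‖p‖ = 1) (hq : ‖q‖ = 1) (A : ℂ) (κ : ℝ) :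
    (fun z => p * q * starRingEnd ℂ z + (A - p * q * starRingEnd ℂ A)) ''
      kite A p q (A + κ * (p + q)) = kite A p q (A + κ * (p + q)) := by
  have h1 : p * starRingEnd ℂ p = 1 := by
    rw [Complex.mul_conj, Complex.normSq_eq_norm_sq, hp]; norm_num
  have h2 : q * starRingEnd ℂ q = 1 := by
    rw [Complex.mul_conj, Complex.normSq_eq_norm_sq, hq]; norm_num
  have h1' : p.re * p.re + p.im * p.im = 1 := by
    rw [← Complex.normSq_apply, ← Complex.sq_norm, hp, one_pow]
  have h2' : q.re * q.re + q.im * q.im = 1 := by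
    rw [← Complex.normSq_apply, ← Complex.sq_norm, hq, one_pow]
  set σ : ℂ → ℂ := fun z => p * q * starRingEnd ℂ z + (A - p * q * starRingEnd ℂ A) with hσ
  have hinv : ∀ z, σ (σ z) = z := fun z => by
    simp only [hσ, map_add, map_mul, map_sub, Complex.conj_conj]
    linear_combination (z - A) * q * starRingEnd ℂ q * h1 + (z - A) * h2
  have hA : ∀ z, σ z - A = p * q * starRingEnd ℂ (z - A) := fun z => by
    simp only [hσ, map_sub]; ring
  have hc : ∀ z, σ z - (A + κ * (p + q)) = p * q * starRingEnd ℂ (z - (A + κ * (p + q))) := by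
    intro z
    simp only [hσ, map_add, map_mul, map_sub, Complex.conj_ofReal]
    linear_combination κ * q * h1 + κ * p * h2
  have d1 : ∀ z, dot p (p * q * starRingEnd ℂ z) = dot q z := fun z => by
    simp only [dot, Complex.mul_re, Complex.mul_im, Complex.conj_re, Complex.conj_im]
    linear_combination (q.re * z.re + q.im * z.im) * h1'
  have d2 : ∀ z, dot q (p * q * starRingEnd ℂ z) = dot p z := fun z => by
    simp only [dot, Complex.mul_re, Complex.mul_im, Complex.conj_re, Complex.conj_im]
    linear_combination (p.re * z.re + p.im * z.im) * h2'
  have c1 : ∀ z, cross p (p * q * starRingEnd ℂ z) = cross z q := fun z => by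
    simp only [cross, Complex.mul_re, Complex.mul_im, Complex.conj_re, Complex.conj_im]
    linear_combination (z.re * q.im - z.im * q.re) * h1'
  have c2 : ∀ z, cross (p * q * starRingEnd ℂ z) q = cross p z := fun z => by
    simp only [cross, Complex.mul_re, Complex.mul_im, Complex.conj_re, Complex.conj_im]
    linear_combination (p.re * z.im - p.im * z.re) * h2'
  have hmaps : ∀ z ∈ kite A p q (A + κ * (p + q)), σ z ∈ kite A p q (A + κ * (p + q)) := by
    rintro z ⟨hz0, hz1, hz2, hz3⟩
    refine ⟨?_, ?_, ?_, ?_⟩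
    · rw [hA, c1]; exact hz3
    · rw [hc, d1]; exact hz2
    · rw [hc, d2]; exact hz1
    · rw [hA, c2]; exact hz0
  refine Set.Subset.antisymm (Set.image_subset_iff.2 hmaps) fun z hz => ⟨σ z, hmaps z hz, hinv z⟩

end Kite

/-! ### The three kites around the incenter -/

section Corner

variable {u v : ℂ} {l m n : ℝ}

lemma sq_eq_of_norm (hu : ‖u‖ = 1) (hv : ‖v‖ = 1) {w : ℂ} (hw : ‖w‖ = 1)
    (h : (l : ℂ) * u + m * w + n * v = 0) : m ^ 2 = l ^ 2 + n ^ 2 + 2 * l * n * dot u v := by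
  have e : (m : ℂ) * w = -((l : ℂ) * u + n * v) := by linear_combination h
  have h1 : dot u u = 1 := by rw [dot_self, hu, one_pow]
  have h2 : dot v v = 1 := by rw [dot_self, hv, one_pow]
  have h3 : dot w w = 1 := by rw [dot_self, hw, one_pow]
  have h4 : dot (m * w) (m * w) = dot (-((l : ℂ) * u + n * v)) (-((l : ℂ) * u + n * v)) := by
    rw [e]
  rw [dot_neg_left, dot_neg_right, dot_comm (_ + _)] at h4
  simp only [dot_add_right, dot_comm (_ + _), dot_ofReal_mul_right, dot_ofReal_mul_left, h1, h2,
    h3] at h4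
  rw [dot_comm v u] at h4
  linarith

/-- The numerical data of the kite cut off a triangle at a corner by the perpendiculars from the
incenter to the sides. -/
lemma corner_kite (hl : 0 < l) (hm : 0 < m) (hn : 0 < n) (hu : ‖u‖ = 1) (hv : ‖v‖ = 1) {w : ℂ}
    (hw : ‖w‖ = 1) (h : (l : ℂ) * u + m * w + n * v = 0) (hs : 0 < cross v u) :
    l * n / (l + m + n) * (1 + dot u (-v)) = (l + n - m) / 2 ∧ 0 < (l + n - m) / 2 ∧
      (l + n - m) / 2 ≤ l ∧ (l + n - m) / 2 ≤ n := by
  have hsq := sq_eq_of_norm hu hv hw h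
  have hL : 0 < l + m + n := by positivity
  have e1 : l * n / (l + m + n) * (1 + dot u (-v)) = (l + n - m) / 2 := by
    rw [dot_neg_right]
    field_simp
    linarith
  have hs' : 0 < cross u (-v) := by rw [cross_neg_right, cross_swap, neg_neg]; exact hs
  have h1 := one_add_dot_pos hu (by rwa [norm_neg]) hs'
  have hd := h1.2
  rw [dot_neg_right] at hd
  refine ⟨e1, ?_, ?_, ?_⟩
  · rw [← e1]
    exact mul_pos (by positivity) h1.1
  -- The law of cosines yields the triangle inequality that keeps the point of tangency on the side.
  · have : (n - l) ^ 2 ≤ m ^ 2 := by nlinarith [mul_pos hl hn]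
    linarith [abs_le_of_sq_le_sq' this hm.le]
  · have : (l - n) ^ 2 ≤ m ^ 2 := by nlinarith [mul_pos hl hn]
    linarith [abs_le_of_sq_le_sq' this hm.le]

lemma kite_subset_of_corner (hl : 0 < l) (hm : 0 < m) (hn : 0 < n) (hu : ‖u‖ = 1) (hv : ‖v‖ = 1)
    {w : ℂ} (hw : ‖w‖ = 1) (h : (l : ℂ) * u + m * w + n * v = 0) (hs : 0 < cross v u)
    {S : Set ℂ} (hS : Convex ℝ S) {A : ℂ} (h0 : A ∈ S) (h1 : A + l * u ∈ S)
    (h2 : A - n * v ∈ S) :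
    kite A u (-v) (A + (l * n / (l + m + n) : ℝ) * (u + -v)) ⊆ S := by
  obtain ⟨e, ht, htl, htn⟩ := corner_kite hl hm hn hu hv hw h hs
  have hs' : 0 < cross u (-v) := by rw [cross_neg_right, cross_swap, neg_neg]; exact hs
  have hL : 0 < l + m + n := by positivity
  have comb : ∀ x y : ℝ, 0 ≤ x → 0 ≤ y → x / l + y / n ≤ 1 → A + x * u + y * -v ∈ S := by
    intro x y hx hy hxy
    have hx' := div_nonneg hx hl.le
    have hy' := div_nonneg hy hn.le
    have h3 := hS.sum_mem (t := Finset.univ) (w := ![1 - (x / l + y / n), x / l, y / n])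
      (z := ![A, A + l * u, A - n * v]) (by
        intro i _
        fin_cases i
        · simpa using hxy
        · exact hx'
        · exact hy') (by
        simp only [Fin.sum_univ_three, Matrix.cons_val]
        ring) (by
        intro i _
        fin_cases i
        · exact h0
        · exact h1
        · exact h2)
    have hl' : (l : ℂ) ≠ 0 := by exact_mod_cast hl.ne'
    have hn' : (n : ℂ) ≠ 0 := by exact_mod_cast hn.ne'
    convert h3 using 1
    simp only [Fin.sum_univ_three, Complex.real_smul, Matrix.cons_val]
    push_cast
    field_simp
    ring
  refine kite_subset_convexHull hu (by rwa [norm_neg]) hs' ht (by positivity) e hS h0 ?_ ?_ ?_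
  · have := comb _ 0 ht.le le_rfl (by rw [zero_div, add_zero]; exact (div_le_one hl).2 htl)
    simpa using this
  · have := comb (l * n / (l + m + n)) (l * n / (l + m + n)) (by positivity) (by positivity) (by
      have : l * n / (l + m + n) / l + l * n / (l + m + n) / n = (l + n) / (l + m + n) := by
        field_simp
        ring
      rw [this, div_le_one hL]
      linarith)
    convert this using 1
    ring
  · have := comb 0 _ le_rfl ht.le (by rw [zero_div, zero_add]; exact (div_le_one hn).2 htn)
    simpa using this

end Corner

lemma convex_cross_nonneg (w a : ℂ) : Convex ℝ {z | 0 ≤ cross w (z - a)} := by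
  intro x hx y hy s t hs ht hst
  simp only [Set.mem_ofPred_eq] at hx hy ⊢
  have e : s • x + t • y - a = (s : ℂ) * (x - a) + t * (y - a) := by
    rw [Complex.real_smul, Complex.real_smul]
    have : (s : ℂ) + t = 1 := by exact_mod_cast hst
    linear_combination a * this
  rw [e, cross_add_right, cross_ofReal_mul_right, cross_ofReal_mul_right]
  positivity

lemma nonOverlapping_of_dot {P Q : Set ℂ} {w c : ℂ} (hw : w ≠ 0)
    (hP : ∀ z ∈ P, dot w (z - c) ≤ 0) (hQ : ∀ z ∈ Q, 0 ≤ dot w (z - c)) : NonOverlapping P Q := by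
  rw [NonOverlapping, Set.disjoint_iff_inter_eq_empty]
  refine ((isOpen_interior.inter isOpen_interior).measure_eq_zero_iff volume).1
    (measure_mono_null ?_ (volume_line hw (dot w c)))
  rintro z ⟨hz, hz'⟩
  have h1 := hP z (interior_subset hz)
  have h2 := hQ z (interior_subset hz')
  rw [dot_sub_right] at h1 h2
  simp only [Set.mem_ofPred_eq]
  linarith

/-- Without such an index, a nonpositive entry makes its cyclic predecessor negative and hence the
third entry negative too. All signs would then agree against the vanishing sum. It selects the kite
containing a given point. -/
lemma exists_nonpos_nonneg (l c : Fin 3 → ℝ) (hl : ∀ i, 0 < l i) (h : ∑ i, l i * c i = 0) :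
    ∃ i, c i ≤ 0 ∧ 0 ≤ c (i + 2) := by
  by_contra! hc
  by_cases hpos : ∃ i, c i ≤ 0
  · obtain ⟨i, hi⟩ := hpos
    have h2 := hc i hi
    have h1 := hc (i + 2) h2.le
    rw [add_two_add_two] at h1
    have h3 := sum_fin_three_cyclic (fun i => l i * c i) i
    rw [h] at h3
    have a1 := mul_neg_of_pos_of_neg (hl (i + 1)) h1
    have a2 := mul_neg_of_pos_of_neg (hl (i + 2)) h2
    have a0 := mul_nonpos_of_nonneg_of_nonpos (hl i).le hi
    linarith
  · push Not at hpos
    have := Finset.sum_pos (fun i _ => mul_pos (hl i) (hpos i)) (Finset.univ_nonempty (α := Fin 3))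
    linarith

/-- The perpendiculars from the incenter to the sides cut a triangle into three kites, each of which
is mirror symmetric. -/
theorem exists_cutting_of_cross_pos (P : Fin 3 → ℂ) (hP : 0 < cross (P 1 - P 0) (P 2 - P 0)) :
    ∃ K : Fin 3 → Set ℂ, IsCutting K (convexHull ℝ (Set.range P)) ∧
      ∀ i, ∃ ω τ : ℂ, ‖ω‖ = 1 ∧ (fun z => ω * starRingEnd ℂ z + τ) '' K i = K i := by
  have hD : ∀ i, cross (P i - P (i + 2)) (P (i + 1) - P i) = cross (P 1 - P 0) (P 2 - P 0) := by
    intro i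
    fin_cases i <;> simp [cross] <;> ring_nf
  have hne : ∀ i, P (i + 1) - P i ≠ 0 := fun i h => by
    have := hD i
    rw [h] at this
    simp only [cross, Complex.zero_re, Complex.zero_im, mul_zero, sub_zero] at this
    unfold cross at hP
    linarith
  set l : Fin 3 → ℝ := fun i => ‖P (i + 1) - P i‖ with hl
  have hl0 : ∀ i, 0 < l i := fun i => norm_pos_iff.2 (hne i)
  have hlc : ∀ i, (l i : ℂ) ≠ 0 := fun i => by exact_mod_cast (hl0 i).ne'
  set u : Fin 3 → ℂ := fun i => (P (i + 1) - P i) / l i with hu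
  have hlu : ∀ i, (l i : ℂ) * u i = P (i + 1) - P i := fun i => mul_div_cancel₀ _ (hlc i)
  have hu1 : ∀ i, ‖u i‖ = 1 := fun i => by
    rw [hu]
    simp only [norm_div, Complex.norm_real, norm_norm, hl]
    exact div_self (hl0 i).ne'
  have hu0 : ∀ i, u i ≠ 0 := fun i h => by
    have := hu1 i
    rw [h, norm_zero] at this
    exact zero_ne_one this
  have hsum : ∀ i, (l i : ℂ) * u i + l (i + 1) * u (i + 1) + l (i + 2) * u (i + 2) = 0 := by
    intro i
    rw [hlu, hlu, hlu, add_one_add_one, add_two_add_one]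
    ring
  have hcross : ∀ i, 0 < cross (u (i + 2)) (u i) := fun i => by
    have h1 : l (i + 2) * (l i * cross (u (i + 2)) (u i)) = cross (P 1 - P 0) (P 2 - P 0) := by
      rw [← cross_ofReal_mul_right, ← cross_ofReal_mul_left, hlu, hlu, add_two_add_one, hD]
    have h2 : 0 < l (i + 2) * (l i * cross (u (i + 2)) (u i)) := h1 ▸ hP
    exact (mul_pos_iff_of_pos_left (hl0 _)).1 ((mul_pos_iff_of_pos_left (hl0 _)).1 h2)
  -- With this coefficient, the product of the adjacent sides over the perimeter, `c i` is the
  -- incenter seen from `P i`; `hstep` shows that it does not depend on `i`.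
  set κ : Fin 3 → ℝ := fun i => l i * l (i + 2) / (l i + l (i + 1) + l (i + 2)) with hκ
  set c : Fin 3 → ℂ := fun i => P i + κ i * (u i + -u (i + 2)) with hc
  have hL : ∀ i, (l i : ℂ) + l (i + 1) + l (i + 2) ≠ 0 := fun i => by
    have : 0 < l i + l (i + 1) + l (i + 2) := by
      have := hl0 i
      have := hl0 (i + 1)
      have := hl0 (i + 2)
      positivity
    exact_mod_cast this.ne'
  have hstep : ∀ i, c (i + 1) = c i := fun i => by
    have e1 : P (i + 1) = P i + l i * u i := by rw [hlu]; ring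
    have e2 : (l (i + 1) : ℂ) + l (i + 2) + l i = l i + l (i + 1) + l (i + 2) := by ring
    simp only [hc, hκ, add_one_add_one, add_one_add_two, e1]
    push_cast
    rw [e2]
    have := hL i
    field_simp
    linear_combination l i * hsum i
  have hconst : ∀ i, c i = c 0 := by
    intro i
    fin_cases i
    · rfl
    · exact hstep 0
    · exact (hstep 1).trans (hstep 0)
  have ht := fun i => corner_kite (hl0 i) (hl0 (i + 1)) (hl0 (i + 2)) (hu1 i) (hu1 (i + 2))
    (hu1 (i + 1)) (hsum i) (hcross i)
  have hneg : ∀ i, ‖-u i‖ = 1 := fun i => by rw [norm_neg, hu1]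
  have hcross' : ∀ i, 0 < cross (u i) (-u (i + 2)) := fun i => by
    rw [cross_neg_right, cross_swap, neg_neg]; exact hcross i
  have hκ0 : ∀ i, 0 < κ i := fun i => by
    have := hl0 i
    have := hl0 (i + 1)
    have := hl0 (i + 2)
    simp only [hκ]
    positivity
  -- Consecutive kites are separated by the perpendicular from the incenter to their common side
  -- line.
  have hnon : ∀ i, NonOverlapping (kite (P i) (u i) (-u (i + 2)) (c i))
      (kite (P (i + 1)) (u (i + 1)) (-u (i + 1 + 2)) (c (i + 1))) := by
    intro i
    refine nonOverlapping_of_dot (hu0 i) (fun z hz => hz.2.1) fun z hz => ?_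
    have := hz.2.2.1
    rw [hstep, add_one_add_two, dot_neg_left] at this
    linarith
  refine ⟨fun i => kite (P i) (u i) (-u (i + 2)) (c i), ⟨fun i => ?_, ?_, ?_⟩, fun i =>
    ⟨_, _, ?_, image_kite (hu1 i) (hneg _) _ _⟩⟩
  · exact isPolygon_kite (hu1 i) (hneg _) (hcross' i) (ht i).2.1 (hκ0 i) (ht i).1
  · intro i j hij
    rcases Fin.eq_add_of_ne hij.symm with h | h <;> rw [h]
    · exact hnon i
    · have := hnon (i + 2)
      rw [add_two_add_one] at this
      exact this.symm
  · refine Set.Subset.antisymm (Set.iUnion_subset fun i => ?_) fun z hz => ?_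
    · have hmem : ∀ j, P j ∈ convexHull ℝ (Set.range P) := fun j =>
        subset_convexHull ℝ _ (Set.mem_range_self j)
      refine kite_subset_of_corner (hl0 i) (hl0 (i + 1)) (hl0 (i + 2)) (hu1 i) (hu1 (i + 2))
        (hu1 (i + 1)) (hsum i) (hcross i) (convex_convexHull ℝ _) (hmem i) ?_ ?_
      · rw [hlu, add_sub_cancel]; exact hmem _
      · rw [hlu, add_two_add_one, sub_sub_cancel]; exact hmem _
    · have hside : ∀ i, 0 ≤ cross (u i) (z - P i) := fun i => by
        have h1 : 0 ≤ cross (P (i + 1) - P i) (z - P i) := by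
          refine convexHull_min ?_ (convex_cross_nonneg (P (i + 1) - P i) (P i)) hz
          rintro _ ⟨j, rfl⟩
          by_cases hji : j = i
          · simp [hji, cross]
          rcases Fin.eq_add_of_ne hji with h | h <;> rw [h]
          · simp only [Set.mem_ofPred_eq, cross]
            exact le_of_eq (by ring)
          · have := hD i
            simp only [Set.mem_ofPred_eq]
            rw [cross_swap, ← cross_neg_left, neg_sub, this]
            exact hP.le
        rw [← hlu, cross_ofReal_mul_left] at h1
        exact (mul_nonneg_iff_of_pos_left (hl0 i)).1 h1
      obtain ⟨i, hi, hi'⟩ := exists_nonpos_nonneg l (fun i => dot (u i) (z - c 0)) hl0 (by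
        have h1 : ∑ i, l i * dot (u i) (z - c 0) = dot (∑ i, (l i : ℂ) * u i) (z - c 0) := by
          simp only [Fin.sum_univ_three, dot_comm _ (z - c 0), dot_add_right, dot_ofReal_mul_right]
        rw [h1, Fin.sum_univ_three]
        have := hsum 0
        simp only [zero_add] at this
        rw [this]
        simp [dot])
      refine Set.mem_iUnion.2 ⟨i, hside i, ?_, ?_, ?_⟩
      · rw [hconst]; exact hi
      · rw [hconst, dot_neg_left]; linarith
      · have h1 : P i = P (i + 2) + l (i + 2) * u (i + 2) := by
          rw [hlu, add_two_add_one]; ring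
        have h2 := hside (i + 2)
        have h3 : cross (u (i + 2)) (u (i + 2)) = 0 := by unfold cross; ring
        rw [cross_neg_right, cross_swap, neg_neg, h1,
          show z - (P (i + 2) + l (i + 2) * u (i + 2)) =
            (z - P (i + 2)) + -(l (i + 2) * u (i + 2)) by ring,
          cross_add_right, cross_neg_right, cross_ofReal_mul_right, h3]
        linarith
  · rw [norm_mul, hu1, hneg, one_mul]

/-- A triangle can be cut into three mirror symmetric polygons. -/
theorem exists_cutting {P : Fin 3 → ℂ} (hP : AffineIndependent ℝ P) :
    ∃ K : Fin 3 → Set ℂ, IsCutting K (convexHull ℝ (Set.range P)) ∧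
      ∀ i, ∃ ω τ : ℂ, ‖ω‖ = 1 ∧ (fun z => ω * starRingEnd ℂ z + τ) '' K i = K i := by
  obtain ⟨n, hn⟩ := exists_isNormals hP
  rcases lt_or_gt_of_ne hn.cross_ne_zero with h | h
  -- Exchanging two vertices reverses the orientation without changing the triangle.
  · have hr : Set.range (P ∘ Equiv.swap 1 2) = Set.range P := EquivLike.range_comp _ _
    rw [← hr]
    refine exists_cutting_of_cross_pos _ ?_
    have h0 : Equiv.swap (1 : Fin 3) 2 0 = 0 := by decide
    simp only [Function.comp_apply, Equiv.swap_apply_left, Equiv.swap_apply_right, h0]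
    unfold cross
    linarith
  · exact exists_cutting_of_cross_pos _ h

/-- Three pieces always suffice: mirror symmetric pieces can be moved to their mirror images. -/
theorem nicelyCuttable_three {T : Affine.Triangle ℝ ℂ} {box : Set ℂ} (hbox : IsBox T box) :
    NicelyCuttable T box 3 := by
  obtain ⟨ω, τ, hω, rfl⟩ := hbox.exists_antiMotion
  obtain ⟨K, hK, hsym⟩ := exists_cutting T.independent
  rw [Affine.Simplex.convexHull_eq_closedInterior] at hK
  choose a b ha hab using hsym
  set ρ : ℂ → ℂ := fun z => ω * starRingEnd ℂ z + τ with hρ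
  have hω0 : ω ≠ 0 := by rw [← norm_ne_zero_iff, hω]; exact one_ne_zero
  have hρ' : ρ = Complex.conjCLE.toHomeomorph.trans (motionHomeo ω τ hω0) := by
    ext z
    simp [hρ, motionHomeo_apply]
  -- The mirror map of the box after the symmetry of the kite is a proper motion with the same
  -- effect on the kite.
  have himg : ∀ i, (fun z => ω * starRingEnd ℂ (a i) * z + (ω * starRingEnd ℂ (b i) + τ)) '' K i =
      ρ '' K i := fun i => by
    conv_rhs => rw [← hab i]
    rw [Set.image_image]
    refine Set.image_congr' fun z => ?_
    simp only [hρ, map_add, map_mul, Complex.conj_conj]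
    ring
  refine ⟨K, hK, _, fun i => ⟨ω * starRingEnd ℂ (a i), ω * starRingEnd ℂ (b i) + τ, ?_,
    fun _ => rfl⟩, fun i => ?_, fun i j hij => ?_⟩
  · rw [norm_mul, hω, RCLike.norm_conj, ha, one_mul]
  · rw [himg]
    refine Set.image_mono ?_
    rw [← hK.2.2]
    exact Set.subset_iUnion _ i
  · dsimp only
    rw [himg, himg, hρ']
    exact (hK.2.1 hij).image _

/-! ### Generic angles and the triangles that realize them -/

open Real in
-- Countably many triples occur. Equal coefficients would make a nonzero multiple of `π` vanish; any
-- other triple defines a line, which is null.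
lemma ae_int_independent : ∀ᵐ x : ℝ × ℝ, ∀ k l m : ℤ, ¬(k = 0 ∧ l = 0 ∧ m = 0) →
    (k : ℝ) * x.1 + l * x.2 + m * (π - x.1 - x.2) ≠ 0 := by
  simp only [ae_all_iff]
  intro k l m h
  by_cases hkl : k = m ∧ l = m
  · obtain ⟨rfl, rfl⟩ := hkl
    refine Eventually.of_forall fun x hx => ?_
    have h1 : (l : ℝ) * π = 0 := by linear_combination hx
    have h2 : l = 0 := by exact_mod_cast (mul_eq_zero.1 h1).resolve_right pi_ne_zero
    exact h ⟨h2, h2, h2⟩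
  have hw : (⟨k - m, l - m⟩ : ℂ) ≠ 0 := fun h0 => by
    have h1 : (k : ℝ) - m = 0 := congrArg Complex.re h0
    have h2 : (l : ℝ) - m = 0 := congrArg Complex.im h0
    exact hkl ⟨by exact_mod_cast sub_eq_zero.1 h1, by exact_mod_cast sub_eq_zero.1 h2⟩
  have hz : ∀ᵐ z : ℂ, dot ⟨k - m, l - m⟩ z ≠ -(m * π) := by
    have := volume_line hw (-(m * π))
    rw [ae_iff]
    simpa using this
  have hx := (Complex.volume_preserving_equiv_real_prod.symm _).quasiMeasurePreserving.ae hz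
  filter_upwards [hx] with x hx h0
  refine hx ?_
  simp only [dot, Complex.measurableEquivRealProd_symm_apply]
  linear_combination h0

open Real in
lemma angle_sum (T : Affine.Triangle ℝ ℂ) : angleC T = π - angleA T - angleB T := by
  have h01 : T.points 1 ≠ T.points 0 := T.independent.injective.ne (by decide)
  have := angle_add_angle_add_angle_eq_pi (T.points 2) h01
  unfold angleA angleB angleC
  rw [angle_comm (T.points 1) (T.points 0), angle_comm (T.points 0) (T.points 2)]
  linarith

lemma not_exists_relation {T : Affine.Triangle ℝ ℂ} {x : ℝ × ℝ}
    (hx : ∀ k l m : ℤ, ¬(k = 0 ∧ l = 0 ∧ m = 0) →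
      (k : ℝ) * x.1 + l * x.2 + m * (Real.pi - x.1 - x.2) ≠ 0)
    (hA : angleA T = x.1) (hB : angleB T = x.2) :
    ¬∃ k l m : ℤ, ¬(k = 0 ∧ l = 0 ∧ m = 0) ∧
      (k : ℝ) * angleA T + (l : ℝ) * angleB T + (m : ℝ) * angleC T = 0 := by
  rintro ⟨k, l, m, h, h0⟩
  rw [angle_sum, hA, hB] at h0
  exact hx k l m h h0

/-- Equal sides face equal angles, and an equality of two angles is already an integral relation. -/
lemma scalene_of_not_exists_relation {T : Affine.Triangle ℝ ℂ}
    (h : ¬∃ k l m : ℤ, ¬(k = 0 ∧ l = 0 ∧ m = 0) ∧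
      (k : ℝ) * angleA T + (l : ℝ) * angleB T + (m : ℝ) * angleC T = 0) : T.Scalene := by
  rw [Affine.Triangle.scalene_iff_dist_ne_and_dist_ne_and_dist_ne]
  refine ⟨fun hd => h ⟨0, 1, -1, by decide, ?_⟩, fun hd => h ⟨1, 0, -1, by decide, ?_⟩,
    fun hd => h ⟨1, -1, 0, by decide, ?_⟩⟩
  · have := angle_eq_angle_of_dist_eq hd
    unfold angleB angleC
    rw [this]
    push_cast
    ring
  · rw [dist_comm] at hd
    have := angle_eq_angle_of_dist_eq hd
    unfold angleA angleC
    rw [this, angle_comm (T.points 0) (T.points 2)]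
    push_cast
    ring
  · rw [dist_comm, dist_comm (T.points 1)] at hd
    have := angle_eq_angle_of_dist_eq hd
    unfold angleA angleB
    rw [angle_comm, this, angle_comm]
    push_cast
    ring

open Real in
/-- There is a triangle with two given angles. -/
lemma exists_triangle {α β : ℝ} (hα : 0 < α) (hβ : 0 < β) (hαβ : α + β < π) :
    ∃ T : Affine.Triangle ℝ ℂ, angleA T = α ∧ angleB T = β := by
  have ha : 0 < sin α := sin_pos_of_pos_of_lt_pi hα (by linarith)
  have hb : 0 < sin β := sin_pos_of_pos_of_lt_pi hβ (by linarith)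
  have hs : 0 < sin (α + β) := sin_pos_of_pos_of_lt_pi (by linarith) hαβ
  -- The law of sines dictates the two side lengths at the vertex `0`, the third angle having sine
  -- `sin (α + β)`.
  set B : ℂ := (sin (α + β) : ℝ) • 1 with hB
  set C : ℂ := (sin β : ℝ) • Complex.exp (α * Complex.I) with hC
  have hCB : C - B = -((sin α : ℝ) • Complex.exp ((-β : ℝ) * Complex.I)) := by
    rw [hB, hC, Complex.exp_mul_I, Complex.exp_mul_I, sin_add]
    simp only [Complex.real_smul]
    push_cast
    rw [Complex.cos_neg, Complex.sin_neg]
    ring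
  have hAngle : ∀ x : ℝ, |x| < π →
      InnerProductGeometry.angle (1 : ℂ) (Complex.exp (x * Complex.I)) = |x| := fun x hx => by
    rw [Complex.angle_one_left (Complex.exp_ne_zero _), Complex.arg_exp_mul_I,
      (toIocMod_eq_self _).2]
    have := abs_lt.1 hx
    exact ⟨this.1, by linarith⟩
  have h1 : ∠ B 0 C = α := by
    simp only [EuclideanGeometry.angle, vsub_eq_sub, sub_zero]
    rw [InnerProductGeometry.angle_smul_left_of_pos _ _ hs,
      InnerProductGeometry.angle_smul_right_of_pos _ _ hb,
      hAngle _ (by rw [abs_of_pos hα]; linarith), abs_of_pos hα]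
  have h2 : ∠ 0 B C = β := by
    simp only [EuclideanGeometry.angle, vsub_eq_sub, zero_sub]
    rw [hCB, InnerProductGeometry.angle_neg_neg, InnerProductGeometry.angle_smul_left_of_pos _ _ hs,
      InnerProductGeometry.angle_smul_right_of_pos _ _ ha,
      hAngle _ (by rw [abs_neg, abs_of_pos hβ]; linarith), abs_neg, abs_of_pos hβ]
  have hind : AffineIndependent ℝ ![0, B, C] := by
    rw [affineIndependent_iff_not_collinear_set, Set.insert_comm,
      collinear_iff_eq_or_eq_or_angle_eq_zero_or_angle_eq_pi, h1]
    rintro (h | h | h | h)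
    · exact smul_ne_zero hs.ne' one_ne_zero h
    · exact smul_ne_zero hb.ne' (Complex.exp_ne_zero _) h
    · exact hα.ne' h
    · linarith
  exact ⟨⟨![0, B, C], hind⟩, h1, h2⟩

end CakeCutting

theorem theorem1 :
    -- a cake that can be nicely cut into two pieces has integrally dependent angles
    (∀ T : Affine.Triangle ℝ ℂ, T.Scalene → ∀ box : Set ℂ, CakeCutting.IsBox T box →
      CakeCutting.NicelyCuttable T box 2 →
      ∃ k l m : ℤ, ¬(k = 0 ∧ l = 0 ∧ m = 0) ∧
        (k : ℝ) * CakeCutting.angleA T + (l : ℝ) * CakeCutting.angleB T +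
          (m : ℝ) * CakeCutting.angleC T = 0) ∧
    -- for almost all pairs of angles, the least number of pieces is three
    (∀ᵐ p : ℝ × ℝ ∂volume, ∀ T : Affine.Triangle ℝ ℂ, T.Scalene →
      CakeCutting.angleA T = p.1 → CakeCutting.angleB T = p.2 →
      ∀ box : Set ℂ, CakeCutting.IsBox T box →
        IsLeast {n : ℕ | CakeCutting.NicelyCuttable T box n} 3) ∧
    -- the least number of pieces that suffices for every cake is three
    IsLeast {n : ℕ | ∀ T : Affine.Triangle ℝ ℂ, T.Scalene → ∀ box : Set ℂ,
      CakeCutting.IsBox T box → CakeCutting.NicelyCuttable T box n} 3 := by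
  refine ⟨fun T hT box hbox h2 => ?_, ?_, fun T _ box hbox => CakeCutting.nicelyCuttable_three hbox, ?_⟩
  · by_contra h
    have := CakeCutting.three_le_of_nicelyCuttable hT hbox h2 h
    omega
  · filter_upwards [CakeCutting.ae_int_independent] with x hx T hT hA hB box hbox
    exact ⟨CakeCutting.nicelyCuttable_three hbox, fun n hn =>
      CakeCutting.three_le_of_nicelyCuttable hT hbox hn (CakeCutting.not_exists_relation hx hA hB)⟩
  · intro n hn
    have hopen : IsOpen {x : ℝ × ℝ | 0 < x.1 ∧ 0 < x.2 ∧ x.1 + x.2 < Real.pi} :=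
      (isOpen_lt continuous_const continuous_fst).inter
        ((isOpen_lt continuous_const continuous_snd).inter
          (isOpen_lt (continuous_fst.add continuous_snd) continuous_const))
    -- A full-measure set is dense, so it meets the nonempty open set of realizable angle pairs;
    -- `(1, 1)` is such a pair because `2 < π`.
    obtain ⟨x, ⟨hx1, hx2, hx3⟩, hx⟩ :=
      (Measure.dense_of_ae CakeCutting.ae_int_independent).inter_open_nonempty _ hopen
        ⟨(1, 1), one_pos, one_pos, by
          have := Real.pi_gt_three
          norm_num
          linarith⟩
    obtain ⟨T, hA, hB⟩ := CakeCutting.exists_triangle hx1 hx2 hx3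
    have hrel := CakeCutting.not_exists_relation hx hA hB
    have hbox : CakeCutting.IsBox T (EuclideanGeometry.reflection line[ℝ, (0 : ℂ), 1] '' T.closedInterior) :=
      ⟨0, 1, zero_ne_one, rfl⟩
    have hT := CakeCutting.scalene_of_not_exists_relation hrel
    exact CakeCutting.three_le_of_nicelyCuttable hT hbox (hn T hT _ hbox) hrel
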